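/- Let $k\ge 1$ be an integer and let $\alpha_1,\dots,\alpha_k,\beta_1,\dots,\beta_k>0$ be real numbers with $\alpha_1\cdots\alpha_k=\beta_1\cdots\beta_k$ (the edge weights of the $2\times k$-periodic Aztec diamond). Put $$\Phi(z)=\frac{1}{(1-z^{-1})^k}\prod_{m=1}^k\begin{pmatrix}1&\alpha_m z^{-1}\\ \alpha_m^{-1}&1\end{pmatrix}\begin{pmatrix}1&\beta_m z^{-1}\\ \beta_m^{-1}&1\end{pmatrix},\qquad p(z)=\bigl((z-1)^k\operatorname{Tr}\Phi(z)\bigr)^2-4(z-1)^{2k},$$ so that $p$ is a real polynomial. Write $p=q^2p_0$ with real polynomials $q$ and $p_0$, where $q$ is monic and $p_0$ has only simple zeros. Put $k'=\lfloor(\deg p_0+1)/2\rfloor$ and let $x_0>x_1>x_2>\cdots$ be the real zeros of $p_0$. Let $\mathcal R$ be the Riemann surface of $w^2=p_0(z)$: the affine curve $\{(z,w)\in\mathbb C^2: w^2=p_0(z)\}$ together with one point at infinity, and let $\rho(z,w)=\frac12\operatorname{Tr}\Phi(z)+\frac{q(z)w}{2(z-1)^k}$ on $\mathcal R$. For $(\chi,\eta)\in(-1,1)^2$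 consider the multivalued function on $\mathcal R$ $$F(z,w;\chi,\eta)=\tfrac k4(\eta+1)\log z-\tfrac k2\log(z-1)-\tfrac\chi2\log\rho(z,w),$$ whose critical points are the points of $\mathcal R$ at which the derivative, in a holomorphic coordinate of $\mathcal R$, of a local holomorphic branch of $F$ vanishes. For $\ell=1,\dots,k'-1$ let $C_\ell=\{(z,w)\in\mathcal R: z\in[x_{2\ell},x_{2\ell-1}]\}$. The smooth region $\mathcal G_S$ is the set of all $(\chi,\eta)\in(-1,1)^2$ such that $F(\cdot\,;\chi,\eta)$ has four distinct critical points in $C_\ell$ for some $\ell\in\{1,\dots,k'-1\}$. Theorem. The degree of $p_0$ is odd, $\deg p_0=2k'-1$; the number of connected components of $\mathcal G_S$ is exactly $k'-1$; and $k'-1$ is the genus of the compact Riemann surface $\mathcal R$, that is, the dimension of the complex vector space of holomorphic $1$-forms on $\mathcal R$. -/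

import Mathlib

open Polynomial Set Filter Topology
open scoped OnePoint

noncomputable section

namespace AztecDiamond

/-! ### The matrix symbol and its discriminant -/

/-- The matrix symbol
`Φ(z) = (1 - z⁻¹)⁻ᵏ ∏ₘ (1, αₘ z⁻¹; αₘ⁻¹, 1) (1, βₘ z⁻¹; βₘ⁻¹, 1)`,
the product being taken from left to right in increasing order of `m`. -/
def symbol {k : ℕ} (α β : Fin k → ℝ) (z : ℂ) : Matrix (Fin 2) (Fin 2) ℂ :=
  (1 / (1 - z⁻¹) ^ k) •
    (List.ofFn fun m : Fin k =>
      (!![1, (α m : ℂ) * z⁻¹; (α m : ℂ)⁻¹, 1] : Matrix (Fin 2) (Fin 2) ℂ) *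
        !![1, (β m : ℂ) * z⁻¹; (β m : ℂ)⁻¹, 1]).prod

/-- The polynomial matrix `(z - 1)ᵏ Φ(z)`; see `clearedSymbol_map`. -/
def clearedSymbol {k : ℕ} (α β : Fin k → ℝ) : Matrix (Fin 2) (Fin 2) ℝ[X] :=
  (List.ofFn fun m : Fin k =>
    (!![X + C (α m * (β m)⁻¹), C (α m + β m);
        X * C ((α m)⁻¹ + (β m)⁻¹), X + C ((α m)⁻¹ * β m)] :
      Matrix (Fin 2) (Fin 2) ℝ[X])).prod

/-- The polynomial `p(z) = ((z - 1)ᵏ Tr Φ(z))² - 4 (z - 1)²ᵏ`; see `aeval_discrPoly`. -/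
def discrPoly {k : ℕ} (α β : Fin k → ℝ) : ℝ[X] :=
  (clearedSymbol α β).trace ^ 2 - 4 * (X - 1) ^ (2 * k)

theorem clearedSymbol_map {k : ℕ} (α β : Fin k → ℝ) {z : ℂ} (h0 : z ≠ 0) (h1 : z ≠ 1) :
    (clearedSymbol α β).map (aeval z : ℝ[X] →ₐ[ℝ] ℂ) = (z - 1) ^ k • symbol α β z := by
  have hz : (z - 1) ^ k * (1 / (1 - z⁻¹) ^ k) = z ^ k := by
    have h : z - 1 = z * (1 - z⁻¹) := by field_simp
    have h2 : (1 - z⁻¹) ≠ 0 := by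
      intro h3
      rw [h3, mul_zero] at h
      exact h1 (sub_eq_zero.mp h)
    rw [h, mul_pow]
    field_simp
  rw [symbol, smul_smul, hz]
  clear hz h1
  induction k with
  | zero => simp [clearedSymbol]
  | succ n ih =>
    have ih' := ih (fun m => α m.succ) (fun m => β m.succ)
    simp only [clearedSymbol, List.ofFn_succ, List.prod_cons] at ih' ⊢
    have hstep : (!![X + C (α 0 * (β 0)⁻¹), C (α 0 + β 0);
          X * C ((α 0)⁻¹ + (β 0)⁻¹), X + C ((α 0)⁻¹ * β 0)] :
        Matrix (Fin 2) (Fin 2) ℝ[X]).map (aeval z : ℝ[X] →ₐ[ℝ] ℂ) =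
        z • ((!![1, (α 0 : ℂ) * z⁻¹; (α 0 : ℂ)⁻¹, 1] : Matrix (Fin 2) (Fin 2) ℂ) *
          !![1, (β 0 : ℂ) * z⁻¹; (β 0 : ℂ)⁻¹, 1]) := by
      have hu : z * z⁻¹ = 1 := mul_inv_cancel₀ h0
      ext i j
      fin_cases i <;> fin_cases j <;> simp
      · linear_combination -((α 0 : ℂ) * (β 0 : ℂ)⁻¹) * hu
      · linear_combination -((α 0 : ℂ) + (β 0 : ℂ)) * hu
      · linear_combination -((α 0 : ℂ)⁻¹ * (β 0 : ℂ)) * hu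
    rw [Matrix.map_mul, ih', hstep, Matrix.mul_smul, Matrix.smul_mul, smul_smul, pow_succ]

/-- `p` is the polynomial with `p(z) = ((z - 1)ᵏ Tr Φ(z))² - 4 (z - 1)²ᵏ`. -/
theorem aeval_discrPoly {k : ℕ} (α β : Fin k → ℝ) {z : ℂ} (h0 : z ≠ 0) (h1 : z ≠ 1) :
    aeval z (discrPoly α β) =
      ((z - 1) ^ k * (symbol α β z).trace) ^ 2 - 4 * (z - 1) ^ (2 * k) := by
  have h : aeval z (clearedSymbol α β).trace = (z - 1) ^ k * (symbol α β z).trace := by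
    have := congrArg Matrix.trace (clearedSymbol_map α β h0 h1)
    rw [Matrix.trace_smul, smul_eq_mul] at this
    rw [← this, Matrix.trace, Matrix.trace, map_sum]
    rfl
  have h4 : aeval z (4 : ℝ[X]) = (4 : ℂ) := map_ofNat _ 4
  simp [discrPoly, h, h4]

/-! ### The zeros of `p₀` -/

/-- The number `k'`, determined by `deg p₀ = 2 k' - 1`. -/
def kPrime (p₀ : ℝ[X]) : ℕ := (p₀.natDegree + 1) / 2

/-- `x_ℓ`, where `x_0 > x_1 > ⋯` are the real zeros of `p₀` in decreasing order. -/
def branchPoint (p₀ : ℝ[X]) (l : ℕ) : ℝ := (p₀.roots.sort (· ≥ ·)).getD l 0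

/-! ### The Riemann surface `w² = p₀(z)` -/

/-- The affine curve `{(z, w) ∈ ℂ² : w² = p₀(z)}` with the topology of `ℂ²`. -/
abbrev AffineCurve (p₀ : ℝ[X]) : Type :=
  {P : ℂ × ℂ // P.2 ^ 2 = aeval P.1 p₀}

/-- The surface `ℛ`: the affine curve together with one point `∞` at infinity. -/
abbrev Surface (p₀ : ℝ[X]) : Type := OnePoint (AffineCurve p₀)

variable {p₀ : ℝ[X]}

/-- The coordinate function `z` on `ℛ` (the value at `∞` is not used). -/
def zCoord (P : Surface p₀) : ℂ := P.elim 0 fun a : AffineCurve p₀ => a.1.1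

/-- The coordinate function `w` on `ℛ` (the value at `∞` is not used). -/
def wCoord (P : Surface p₀) : ℂ := P.elim 0 fun a : AffineCurve p₀ => a.1.2

/-- The complex structure of `ℛ`, given by its maximal atlas: a homeomorphism `e` from an open
subset of `ℛ` onto an open subset of `ℂ` is a holomorphic chart if its inverse is a regular
holomorphic parametrization `t ↦ (z(t), w(t))` of the affine curve away from `∞`, and `z`, `w`
are meromorphic in the coordinate `t` at `∞`. -/
structure IsHolomorphicChart (e : OpenPartialHomeomorph (Surface p₀) ℂ) : Prop where
  analyticAt_z : ∀ t ∈ e.target, e.symm t ≠ ∞ → AnalyticAt ℂ (fun s => zCoord (e.symm s)) t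
  analyticAt_w : ∀ t ∈ e.target, e.symm t ≠ ∞ → AnalyticAt ℂ (fun s => wCoord (e.symm s)) t
  regular : ∀ t ∈ e.target, e.symm t ≠ ∞ →
    deriv (fun s => zCoord (e.symm s)) t ≠ 0 ∨ deriv (fun s => wCoord (e.symm s)) t ≠ 0
  meromorphicAt_z : ∀ t ∈ e.target, e.symm t = ∞ → MeromorphicAt (fun s => zCoord (e.symm s)) t
  meromorphicAt_w : ∀ t ∈ e.target, e.symm t = ∞ → MeromorphicAt (fun s => wCoord (e.symm s)) t

/-- The set of all holomorphic charts of `ℛ`. -/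
def surfaceAtlas (p₀ : ℝ[X]) : Set (OpenPartialHomeomorph (Surface p₀) ℂ) :=
  {e | IsHolomorphicChart e}

/-! ### Holomorphic differentials and the genus -/

/-- The space of holomorphic `1`-forms on a surface `M` with holomorphic atlas `A`. A form is given
by its coefficients: in each chart `e` it is `f e (t) dt` with `f e` holomorphic on the image of `e`
(and, to make the coefficient unique, `0` elsewhere), and these expressions agree under changes of
coordinates. -/
def holomorphicForms {M : Type} [TopologicalSpace M] (A : Set (OpenPartialHomeomorph M ℂ)) :
    Submodule ℂ (A → ℂ → ℂ) where
  carrier := {f | (∀ e : A, AnalyticOnNhd ℂ (f e) e.1.target) ∧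
    (∀ e : A, ∀ t ∉ e.1.target, f e t = 0) ∧
    ∀ e e' : A, ∀ t ∈ e.1.target, e.1.symm t ∈ e'.1.source →
      f e t = f e' (e'.1 (e.1.symm t)) * deriv (fun s => e'.1 (e.1.symm s)) t}
  zero_mem' := by
    refine ⟨fun e t _ => analyticAt_const, fun e t _ => rfl, fun e e' t _ _ => ?_⟩
    simp
  add_mem' := by
    rintro f g ⟨hf1, hf2, hf3⟩ ⟨hg1, hg2, hg3⟩
    refine ⟨fun e => (hf1 e).add (hg1 e), fun e t ht => ?_, fun e e' t ht ht' => ?_⟩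
    · simp [hf2 e t ht, hg2 e t ht]
    · simp only [Pi.add_apply, hf3 e e' t ht ht', hg3 e e' t ht ht']
      ring
  smul_mem' := by
    rintro c f ⟨hf1, hf2, hf3⟩
    refine ⟨fun e t ht => analyticAt_const.mul (hf1 e t ht), fun e t ht => ?_,
      fun e e' t ht ht' => ?_⟩
    · simp [hf2 e t ht]
    · simp only [Pi.smul_apply, smul_eq_mul, hf3 e e' t ht ht']
      ring

/-- The genus of the compact Riemann surface `ℛ`: the dimension of its space of holomorphic
`1`-forms. -/
def genus (p₀ : ℝ[X]) : Cardinal := Module.rank ℂ (holomorphicForms (surfaceAtlas p₀))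

/-! ### The function `F` and its critical points -/

/-- The meromorphic function `ρ(z, w) = Tr Φ(z) / 2 + q(z) w / (2 (z - 1)ᵏ)` on `ℛ`. -/
def rho {k : ℕ} (α β : Fin k → ℝ) (q : ℝ[X]) (P : Surface p₀) : ℂ :=
  1 / 2 * (symbol α β (zCoord P)).trace +
    aeval (zCoord P) q * wCoord P / (2 * (zCoord P - 1) ^ k)

/-- `G` is, in the chart `e` and near the point `t` of its image, a holomorphic branch of the
multivalued function
`F = (k / 4) (η + 1) log z - (k / 2) log (z - 1) - (χ / 2) log ρ`.
There is none at a logarithmic singularity of `F`, that is, where `z`, `z - 1` or `ρ` has a zero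
or a pole. -/
def IsLocalBranch {k : ℕ} (α β : Fin k → ℝ) (q : ℝ[X]) (χ η : ℝ)
    (e : OpenPartialHomeomorph (Surface p₀) ℂ) (t : ℂ) (G : ℂ → ℂ) : Prop :=
  ∃ L₀ L₁ L : ℂ → ℂ, AnalyticAt ℂ L₀ t ∧ AnalyticAt ℂ L₁ t ∧ AnalyticAt ℂ L t ∧
    ∀ᶠ s in 𝓝 t,
      Complex.exp (L₀ s) = zCoord (e.symm s) ∧
      Complex.exp (L₁ s) = zCoord (e.symm s) - 1 ∧
      Complex.exp (L s) = rho α β q (e.symm s) ∧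
      G s = (k : ℂ) / 4 * ((η : ℂ) + 1) * L₀ s - (k : ℂ) / 2 * L₁ s - (χ : ℂ) / 2 * L s

/-- `P ∈ ℛ` is a critical point of `F(·; χ, η)`: in a holomorphic chart at `P`, the derivative of a
local branch of `F` vanishes at `P`. -/
def IsCriticalPoint {k : ℕ} (α β : Fin k → ℝ) (q : ℝ[X]) (χ η : ℝ) (P : Surface p₀) : Prop :=
  ∃ e : OpenPartialHomeomorph (Surface p₀) ℂ, IsHolomorphicChart e ∧ P ∈ e.source ∧
    P ≠ ∞ ∧ ∃ G : ℂ → ℂ, IsLocalBranch α β q χ η e (e P) G ∧ deriv G (e P) = 0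

/-- The loop `C_ℓ = {(z, w) ∈ ℛ : z ∈ [x_{2ℓ}, x_{2ℓ-1}]}`, for `ℓ ≥ 1`. -/
def loop (p₀ : ℝ[X]) (l : ℕ) : Set (Surface p₀) :=
  {P | ∃ a : AffineCurve p₀, P = (a : Surface p₀) ∧
    ∃ r ∈ Icc (branchPoint p₀ (2 * l)) (branchPoint p₀ (2 * l - 1)), a.1.1 = (r : ℂ)}

/-- The smooth region `𝒢_S`: the points `(χ, η) ∈ (-1, 1)²` for which `F(·; χ, η)` has four
distinct critical points in `C_ℓ` for some `ℓ = 1, …, k' - 1`. -/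
def smoothRegion {k : ℕ} (α β : Fin k → ℝ) (p₀ q : ℝ[X]) : Set (ℝ × ℝ) :=
  {c | c.1 ∈ Ioo (-1 : ℝ) 1 ∧ c.2 ∈ Ioo (-1 : ℝ) 1 ∧
    ∃ l : ℕ, 1 ≤ l ∧ l < kPrime p₀ ∧
      4 ≤ {P : Surface p₀ | P ∈ loop p₀ l ∧ IsCriticalPoint α β q c.1 c.2 P}.encard}

end AztecDiamond

end

namespace AztecDiamond

/-! ### Coefficients of the trace -/

/-! Put T = (z-1)^k Tr Φ, so that p = T² - 4(z-1)^{2k}. The polynomial matrix (z-1)^k Φ has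
nonnegative coefficients and determinant (z-1)^{2k}. In p the terms of degree 2k cancel and the next
coefficient is positive, so deg p = 2k-1; removing q² keeps the degree odd.

Zeros of p. Off (-∞,0] write z = s² with Re s > 0. In the coordinates (u, s v) each elementary
factor raises the Hermitian form Re(ū v) to at least |s+1|² times and at least |s-1|² times its old
value. An eigenvalue of Φ of modulus one would multiply the form by |s²-1|^{2k} over all 2k factors,
and this is incompatible with both bounds (`real_nonpos_of_trace_sq_eq`). So Tr Φ ∈ [-2,2] forces z
≤ 0. In particular all zeros of p are real and nonpositive. Near a multiple zero of p, (Tr Φ)² - 4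
would take small negative values at nonreal points, unless the zero is double with negative leading
coefficient; hence p₀ < 0 at the zeros of q (`p₀_neg_of_q`).

Critical points. From ρ + 1/ρ = Tr Φ one gets dρ/ρ = N dz/((z-1)w) with a polynomial N of degree
less than k' (`exists_numerator`). Off the branch points, F is critical where (k/2) w (η(z-1) -
(z+1)) = χ z N(z). N has opposite signs at the two ends of each gap (`gapData`), so for χ ≠ 0 each
of the two arcs w = ±√p₀ of each loop carries a critical point. Multiplying the equations of the two
arcs and dividing by z gives a polynomial `critPoly` of degree at most 2k'. The k'-1 gaps use up
2(k'-1) of its roots and only two are left. This count carries the argument: four critical points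
occur on at most one loop; then they exhaust the roots, and the absence of roots on [0,∞) forces
|χ|, |η| < 1.

Components. For χ ≠ 0, the l-th loop has four critical points exactly when, on one particular arc,
the real equation function is positive at some x and negative at some larger y of the gap, against
the direction prescribed by its end values (`mem_smoothGap_iff`). For fixed x and y this is a pair
of inequalities affine in (|χ|, η): two convex pieces that meet on the axis χ = 0. The region meets
the axis in the image of the gap under x ↦ (x+1)/(x-1), which ties all pieces together. So each gap
gives one nonempty open connected set, and different gaps give disjoint sets.

Genus. With g = k'-1, the map a ↦ a(z) dz/w from polynomials of degree less than g to holomorphic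
forms is bijective. For surjectivity, the quotient H of a form by dz/w is split into its even and
odd parts under w ↦ -w; removable singularities and growth at infinity make the even part a
polynomial of degree less than g and the odd part zero. -/

theorem clearedSymbol_succ {k : ℕ} (α β : Fin (k + 1) → ℝ) :
    clearedSymbol α β =
      (!![X + C (α 0 * (β 0)⁻¹), C (α 0 + β 0);
          X * C ((α 0)⁻¹ + (β 0)⁻¹), X + C ((α 0)⁻¹ * β 0)] : Matrix (Fin 2) (Fin 2) ℝ[X]) *
        clearedSymbol (fun m => α m.succ) (fun m => β m.succ) := by
  simp [clearedSymbol, List.ofFn_succ]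

theorem coeff_X_mul_eq (P : ℝ[X]) (n : ℕ) :
    (X * P).coeff n = if n = 0 then 0 else P.coeff (n - 1) := by
  cases n <;> simp

/-- To leading order each factor is `X` times a unipotent lower triangular matrix, which gives the
monic diagonal and the missing degree in the upper right corner. Nonnegativity is inherited from the
factors. -/
theorem clearedSymbol_coeff {k : ℕ} (α β : Fin k → ℝ) (hα : ∀ m, 0 < α m) (hβ : ∀ m, 0 < β m) :
    (∀ i j n, 0 ≤ (clearedSymbol α β i j).coeff n) ∧
    ((clearedSymbol α β 0 0).coeff k = 1 ∧ ∀ n, k < n → (clearedSymbol α β 0 0).coeff n = 0) ∧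
    (∀ n, k ≤ n → (clearedSymbol α β 0 1).coeff n = 0) ∧
    (∀ n, k < n → (clearedSymbol α β 1 0).coeff n = 0) ∧
    ((clearedSymbol α β 1 1).coeff k = 1 ∧ ∀ n, k < n → (clearedSymbol α β 1 1).coeff n = 0) := by
  induction k with
  | zero =>
    refine ⟨fun i j n => ?_, ⟨?_, fun n hn => ?_⟩, fun n hn => ?_, fun n hn => ?_,
      ?_, fun n hn => ?_⟩
    · fin_cases i <;> fin_cases j <;> simp [clearedSymbol, coeff_one] <;> split_ifs <;> norm_num
    all_goals simp [clearedSymbol, coeff_one]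
    all_goals omega
  | succ k ih =>
    obtain ⟨h, ⟨h00, h00'⟩, h01, h10, h11, h11'⟩ := ih (fun m => α m.succ) (fun m => β m.succ)
      (fun m => hα _) (fun m => hβ _)
    have ha := hα 0
    have hb := hβ 0
    rw [clearedSymbol_succ]
    set M := clearedSymbol (fun m => α m.succ) (fun m => β m.succ)
    have e (P R : ℝ[X]) (a b : ℝ) (n : ℕ) : ((X + C a) * P + C b * R).coeff n =
        (if n = 0 then 0 else P.coeff (n - 1)) + a * P.coeff n + b * R.coeff n := by
      rw [add_mul, coeff_add, coeff_add, coeff_X_mul_eq, coeff_C_mul, coeff_C_mul]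
    have e' (P R : ℝ[X]) (a b : ℝ) (n : ℕ) : (X * C a * P + (X + C b) * R).coeff n =
        a * (if n = 0 then 0 else P.coeff (n - 1)) + (if n = 0 then 0 else R.coeff (n - 1))
          + b * R.coeff n := by
      rw [add_mul, coeff_add, coeff_add, coeff_X_mul_eq, coeff_C_mul, mul_assoc, coeff_X_mul_eq,
        coeff_C_mul]
      split_ifs <;> ring
    have hp (i j : Fin 2) (n : ℕ) : 0 ≤ if n = 0 then 0 else (M i j).coeff (n - 1) := by
      split_ifs
      · exact le_rfl
      · exact h i j _
    refine ⟨fun i j n => ?_, ⟨?_, fun n hn => ?_⟩, fun n hn => ?_, fun n hn => ?_,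
      ?_, fun n hn => ?_⟩
    · have p1 := hp 0 0 n
      have p2 := hp 0 1 n
      have p3 := hp 1 0 n
      have p4 := hp 1 1 n
      have q1 := h 0 0 n
      have q2 := h 0 1 n
      have q3 := h 1 0 n
      have q4 := h 1 1 n
      fin_cases i <;> fin_cases j <;>
        simp only [Matrix.mul_apply, Fin.sum_univ_two, Fin.zero_eta, Fin.mk_one,
          Matrix.of_apply, Matrix.cons_val_zero, Matrix.cons_val_one, e, e', Fin.isValue,
          Matrix.cons_val_fin_one, Matrix.cons_val'] <;> positivity
    all_goals simp only [Matrix.mul_apply, Fin.sum_univ_two,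
          Matrix.of_apply, Matrix.cons_val_zero, Matrix.cons_val_one, e, e', Fin.isValue,
          Matrix.cons_val_fin_one, Matrix.cons_val']
    · simp [h00, h00', h10]
    · rw [h00' n (by omega), h10 n (by omega), h00' (n - 1) (by omega)]; simp
    · rw [h01 n (by omega), h11' n (by omega), h01 (n - 1) (by omega)]; simp
    · rw [h10 n (by omega), h00' (n - 1) (by omega), h10 (n - 1) (by omega)]; simp
    · simp [h11, h11', h01]
    · rw [h11' n (by omega), h01 (n - 1) (by omega), h11' (n - 1) (by omega)]; simp

/-- At `X = 0` every factor is upper triangular, so the diagonal entries multiply. -/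
theorem clearedSymbol_coeff_zero {k : ℕ} (α β : Fin k → ℝ) :
    (clearedSymbol α β 0 0).coeff 0 = ∏ m, α m * (β m)⁻¹ ∧ (clearedSymbol α β 1 0).coeff 0 = 0 ∧
      (clearedSymbol α β 1 1).coeff 0 = ∏ m, (α m)⁻¹ * β m := by
  induction k with
  | zero => simp [clearedSymbol]
  | succ k ih =>
    obtain ⟨h1, h2, h3⟩ := ih (fun m => α m.succ) (fun m => β m.succ)
    rw [clearedSymbol_succ]
    set M := clearedSymbol (fun m => α m.succ) (fun m => β m.succ)
    rw [Fin.prod_univ_succ, Fin.prod_univ_succ, ← h1, ← h3]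
    simp [Matrix.mul_apply, mul_coeff_zero, h2]

section Trace

variable {k : ℕ} {α β : Fin k → ℝ}

theorem trace_eq : (clearedSymbol α β).trace = clearedSymbol α β 0 0 + clearedSymbol α β 1 1 := by
  simp [Matrix.trace, Fin.sum_univ_two]

theorem trace_coeff_nonneg (hα : ∀ m, 0 < α m) (hβ : ∀ m, 0 < β m) (n : ℕ) :
    0 ≤ (clearedSymbol α β).trace.coeff n := by
  rw [trace_eq, coeff_add]
  have := (clearedSymbol_coeff α β hα hβ).1
  exact add_nonneg (this _ _ _) (this _ _ _)

theorem trace_coeff_top (hα : ∀ m, 0 < α m) (hβ : ∀ m, 0 < β m) :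
    (clearedSymbol α β).trace.coeff k = 2 := by
  obtain ⟨-, ⟨h, -⟩, -, -, h', -⟩ := clearedSymbol_coeff α β hα hβ
  rw [trace_eq, coeff_add, h, h']
  norm_num

theorem trace_natDegree_le (hα : ∀ m, 0 < α m) (hβ : ∀ m, 0 < β m) :
    (clearedSymbol α β).trace.natDegree ≤ k := by
  obtain ⟨-, ⟨-, h⟩, -, -, -, h'⟩ := clearedSymbol_coeff α β hα hβ
  rw [natDegree_le_iff_coeff_eq_zero]
  intro n hn
  rw [trace_eq, coeff_add, h n hn, h' n hn, add_zero]

theorem trace_coeff_zero (hβ : ∀ m, 0 < β m) (hαβ : ∏ m, α m = ∏ m, β m) :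
    (clearedSymbol α β).trace.coeff 0 = 2 := by
  obtain ⟨h, -, h'⟩ := clearedSymbol_coeff_zero α β
  have hne : ∏ m, β m ≠ 0 := (Finset.prod_pos fun m _ => hβ m).ne'
  rw [trace_eq, coeff_add, h, h', Finset.prod_mul_distrib, Finset.prod_mul_distrib,
    Finset.prod_inv_distrib, Finset.prod_inv_distrib, hαβ, mul_inv_cancel₀ hne,
    inv_mul_cancel₀ hne]
  norm_num

theorem trace_eval_pos (hα : ∀ m, 0 < α m) (hβ : ∀ m, 0 < β m) {x : ℝ} (hx : 0 < x) :
    0 < (clearedSymbol α β).trace.eval x := by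
  rw [eval_eq_sum_range' (Nat.lt_succ_of_le (trace_natDegree_le hα hβ)),
    Finset.sum_range_succ, trace_coeff_top hα hβ]
  have : 0 ≤ ∑ i ∈ Finset.range k, (clearedSymbol α β).trace.coeff i * x ^ i :=
    Finset.sum_nonneg fun i _ => mul_nonneg (trace_coeff_nonneg hα hβ i) (pow_nonneg hx.le i)
  positivity

/-- The trace is `2 Xᵏ` plus terms of lower degree. -/
theorem trace_sub_natDegree_lt (hk : 0 < k) (hα : ∀ m, 0 < α m) (hβ : ∀ m, 0 < β m) :
    ((clearedSymbol α β).trace - C 2 * X ^ k).natDegree ≤ k - 1 := by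
  rw [natDegree_le_iff_coeff_eq_zero]
  intro n hn
  rw [coeff_sub, coeff_C_mul, coeff_X_pow]
  rcases (show k ≤ n by omega).eq_or_lt with rfl | h
  · simp [trace_coeff_top hα hβ]
  · rw [if_neg h.ne', natDegree_le_iff_coeff_eq_zero.1 (trace_natDegree_le hα hβ) n h]
    simp

/-- This isolates the two top terms of a power of `X - 1`; the second one decides the leading
coefficient of `discrPoly`. -/
theorem X_sub_one_pow_sub_natDegree (n : ℕ) :
    ((X - 1 : ℝ[X]) ^ (n + 1) - X ^ (n + 1) + C ((n : ℝ) + 1) * X ^ n).natDegree ≤ n - 1 := by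
  induction n with
  | zero => simp
  | succ n ih =>
    have e : (X - 1 : ℝ[X]) ^ (n + 1 + 1) - X ^ (n + 1 + 1) + C (((n + 1 : ℕ) : ℝ) + 1) * X ^ (n + 1)
        = X * ((X - 1 : ℝ[X]) ^ (n + 1) - X ^ (n + 1) + C ((n : ℝ) + 1) * X ^ n)
          - ((X - 1 : ℝ[X]) ^ (n + 1) - X ^ (n + 1) + C ((n : ℝ) + 1) * X ^ n)
          + C ((n : ℝ) + 1) * X ^ n := by
      push_cast
      simp only [C_add, C_1]
      ring
    rw [e]
    rcases n with _ | n
    · simp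
    refine (natDegree_add_le _ _).trans (max_le ((natDegree_sub_le _ _).trans (max_le ?_ ?_)) ?_)
    · refine natDegree_mul_le.trans ?_
      rw [natDegree_X]
      omega
    · omega
    · exact (natDegree_C_mul_X_pow_le _ _).trans (by omega)

/-- The terms 4X^{2k} of T² and of 4(X-1)^{2k} cancel. The coefficient of X^{2k-1} is 4 times the
coefficient of X^{k-1} in the trace plus 8k, hence positive. -/
theorem discrPoly_natDegree (hk : 0 < k) (hα : ∀ m, 0 < α m) (hβ : ∀ m, 0 < β m) :
    (discrPoly α β).natDegree = 2 * k - 1 ∧ 0 < (discrPoly α β).leadingCoeff := by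
  set R := (clearedSymbol α β).trace - C 2 * X ^ k with hR
  have hRd : R.natDegree ≤ k - 1 := trace_sub_natDegree_lt hk hα hβ
  set S := (X - 1 : ℝ[X]) ^ (2 * k - 1 + 1) - X ^ (2 * k - 1 + 1) +
    C (((2 * k - 1 : ℕ) : ℝ) + 1) * X ^ (2 * k - 1) with hS
  have hSd : S.natDegree ≤ 2 * k - 1 - 1 := X_sub_one_pow_sub_natDegree _
  obtain ⟨j, rfl⟩ : ∃ j, k = j + 1 := ⟨k - 1, by omega⟩
  have e2 : 2 * (j + 1) - 1 = 2 * j + 1 := by omega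
  have hT : (clearedSymbol α β).trace = C 2 * X ^ (j + 1) + R := by rw [hR]; ring
  have hp : discrPoly α β = C 4 * X ^ (j + 1) * R + R ^ 2 +
      C (8 * ((j : ℝ) + 1)) * X ^ (2 * j + 1) - C 4 * S := by
    rw [discrPoly, hT, hS, e2, show 2 * (j + 1) = 2 * j + 1 + 1 by ring]
    push_cast
    simp only [C_mul, C_add, C_1, C_ofNat, map_natCast]
    ring
  have hle : (discrPoly α β).natDegree ≤ 2 * j + 1 := by
    rw [hp]
    refine (natDegree_sub_le _ _).trans (max_le ((natDegree_add_le _ _).trans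
      (max_le ((natDegree_add_le _ _).trans (max_le ?_ ?_)) ?_)) ?_)
    · refine natDegree_mul_le.trans ?_
      have := natDegree_C_mul_X_pow_le (4 : ℝ) (j + 1)
      omega
    · refine natDegree_pow_le.trans ?_
      omega
    · exact natDegree_C_mul_X_pow_le _ _
    · refine (natDegree_C_mul_le _ _).trans (by omega)
  have hco : (discrPoly α β).coeff (2 * j + 1) = 4 * R.coeff j + 8 * ((j : ℝ) + 1) := by
    rw [hp, coeff_sub, coeff_add, coeff_add, coeff_C_mul_X_pow, if_pos rfl, coeff_C_mul,
      coeff_eq_zero_of_natDegree_lt (p := S) (by omega),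
      coeff_eq_zero_of_natDegree_lt (p := R ^ 2) (natDegree_pow_le.trans_lt (by omega)),
      mul_assoc, coeff_C_mul, show 2 * j + 1 = j + (j + 1) by ring, mul_comm (X ^ _), coeff_mul_X_pow]
    ring
  have hRj : 0 ≤ R.coeff j := by
    rw [hR, coeff_sub, coeff_C_mul_X_pow, if_neg (by omega), sub_zero]
    exact trace_coeff_nonneg hα hβ j
  have hpos : 0 < (discrPoly α β).coeff (2 * j + 1) := by
    rw [hco]
    positivity
  have hd : (discrPoly α β).natDegree = 2 * j + 1 :=
    le_antisymm hle (le_natDegree_of_ne_zero hpos.ne')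
  rw [e2]
  exact ⟨hd, by rw [leadingCoeff, hd]; exact hpos⟩

theorem discrPoly_eval_zero (hβ : ∀ m, 0 < β m) (hαβ : ∏ m, α m = ∏ m, β m) : (discrPoly α β).eval 0 = 0 := by
  have h := trace_coeff_zero hβ hαβ
  rw [coeff_zero_eq_eval_zero] at h
  simp [discrPoly, h, pow_mul]
  norm_num

/-- The derivative at 0 is 4T'(0) + 8k, because T(0) = 2. So 0 is a simple zero of the discriminant,
hence a zero of `p₀` and not of `q`. -/
theorem discrPoly_derivative_eval_zero (hk : 0 < k) (hα : ∀ m, 0 < α m) (hβ : ∀ m, 0 < β m)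
    (hαβ : ∏ m, α m = ∏ m, β m) : 0 < (derivative (discrPoly α β)).eval 0 := by
  have h := trace_coeff_zero hβ hαβ
  rw [coeff_zero_eq_eval_zero] at h
  have h1 : 0 ≤ (derivative (clearedSymbol α β).trace).eval 0 := by
    rw [← coeff_zero_eq_eval_zero, coeff_derivative]
    have := trace_coeff_nonneg hα hβ 1
    simpa using this
  have h2 : (-1 : ℝ) ^ (2 * k - 1) = -1 := Odd.neg_one_pow (by rw [Nat.odd_iff]; omega)
  have : (derivative (discrPoly α β)).eval 0 =
      4 * (derivative (clearedSymbol α β).trace).eval 0 + 8 * k := by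
    have e4 : (4 : ℝ[X]) = C 4 := rfl
    rw [discrPoly, e4, derivative_sub, derivative_C_mul, derivative_pow, derivative_pow]
    simp [h, h2]
    ring
  rw [this]
  have : (0 : ℝ) < k := by exact_mod_cast hk
  positivity

end Trace
end AztecDiamond

namespace AztecDiamond

/-! ### The spectrum of the symbol -/

/-- The Hermitian form `Re (ū v)`. -/
def pairing (u v : ℂ) : ℝ := u.re * v.re + u.im * v.im

theorem pairing_mul_mul (c u v : ℂ) :
    pairing (c * u) (c * v) = Complex.normSq c * pairing u v := by
  simp [pairing, Complex.normSq_apply]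
  ring

/-- Completing the square: the remainder is nonnegative for Re s > 0. The companion identity with s
- 1 completes the same expression with the opposite sign, so its remainder vanishes on a different
line. -/
theorem pairing_step_add {a : ℝ} (ha : 0 < a) (s u v : ℂ) :
    pairing (s * u + a * v) ((a⁻¹ : ℝ) * u + s * v) =
      Complex.normSq (s + 1) * pairing u v + s.re * (Complex.normSq (u - a * v) / a) := by
  simp [pairing, Complex.normSq_apply]
  field_simp
  ring

theorem pairing_step_sub {a : ℝ} (ha : 0 < a) (s u v : ℂ) :
    pairing (s * u + a * v) ((a⁻¹ : ℝ) * u + s * v) =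
      Complex.normSq (s - 1) * pairing u v + s.re * (Complex.normSq (u + a * v) / a) := by
  simp [pairing, Complex.normSq_apply]
  field_simp
  ring

theorem pairing_step_le_add {a : ℝ} (ha : 0 < a) {s : ℂ} (hs : 0 < s.re) (u v : ℂ) :
    Complex.normSq (s + 1) * pairing u v ≤ pairing (s * u + a * v) ((a⁻¹ : ℝ) * u + s * v) := by
  rw [pairing_step_add ha]
  have := Complex.normSq_nonneg (u - a * v)
  have : 0 ≤ s.re * (Complex.normSq (u - a * v) / a) := by positivity
  linarith

theorem pairing_step_le_sub {a : ℝ} (ha : 0 < a) {s : ℂ} (hs : 0 < s.re) (u v : ℂ) :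
    Complex.normSq (s - 1) * pairing u v ≤ pairing (s * u + a * v) ((a⁻¹ : ℝ) * u + s * v) := by
  rw [pairing_step_sub ha]
  have := Complex.normSq_nonneg (u + a * v)
  have : 0 ≤ s.re * (Complex.normSq (u + a * v) / a) := by positivity
  linarith

/-- If the new value were not positive, both square remainders would vanish, that is u = a v and u =
-a v, whence u = v = 0. -/
theorem pairing_step_pos {a : ℝ} (ha : 0 < a) {s : ℂ} (hs : 0 < s.re) {u v : ℂ}
    (h : 0 ≤ pairing u v) (huv : u ≠ 0 ∨ v ≠ 0) :
    0 < pairing (s * u + a * v) ((a⁻¹ : ℝ) * u + s * v) := by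
  have hs1 : s + 1 ≠ 0 := by
    intro h0
    have := congrArg Complex.re h0
    simp at this
    linarith
  have hp := Complex.normSq_pos.2 hs1
  by_contra hle
  have h1 := pairing_step_add ha s u v
  have h2 := pairing_step_sub ha s u v
  have n1 := Complex.normSq_nonneg (u - a * v)
  have n2 := Complex.normSq_nonneg (u + a * v)
  have p1 : 0 ≤ Complex.normSq (s + 1) * pairing u v := mul_nonneg hp.le h
  have p2 : 0 ≤ Complex.normSq (s - 1) * pairing u v := mul_nonneg (Complex.normSq_nonneg _) h
  have e1 : s.re * (Complex.normSq (u - a * v) / a) = 0 := le_antisymm (by linarith) (by positivity)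
  have e2 : s.re * (Complex.normSq (u + a * v) / a) = 0 := le_antisymm (by linarith) (by positivity)
  have ha' : (a : ℂ) ≠ 0 := by exact_mod_cast ha.ne'
  simp only [mul_eq_zero, hs.ne', false_or, div_eq_zero_iff, ha.ne', or_false,
    Complex.normSq_eq_zero] at e1 e2
  have hu : u = 0 := by linear_combination (e1 + e2) / 2
  have hv : (a : ℂ) * v = 0 := by linear_combination (e2 - e1) / 2
  rcases huv with h | h
  · exact h hu
  · exact h ((mul_eq_zero.1 hv).resolve_left ha')

theorem pairing_pos_ne {u v : ℂ} (h : 0 < pairing u v) : u ≠ 0 ∨ v ≠ 0 := by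
  by_contra! h'
  simp [h'.1, pairing] at h

/-- With z = s² the elementary factor, multiplied by s, sends (u, s v) to (u', s v') with u' = s u +
a v and v' = u/a + s v, which is the step treated above. There are two steps for each of the k
factors, hence the exponent 2k. -/
theorem clearedSymbol_mulVec {k : ℕ} (α β : Fin k → ℝ) (hα : ∀ m, 0 < α m) (hβ : ∀ m, 0 < β m)
    {s : ℂ} (hs : 0 < s.re) (u v : ℂ) :
    ∃ u' v' : ℂ,
      ((clearedSymbol α β).map (aeval (s ^ 2) : ℝ[X] →ₐ[ℝ] ℂ)).mulVec ![u, s * v] = ![u', s * v'] ∧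
      Complex.normSq (s + 1) ^ (2 * k) * pairing u v ≤ pairing u' v' ∧
      Complex.normSq (s - 1) ^ (2 * k) * pairing u v ≤ pairing u' v' ∧
      (u ≠ 0 ∨ v ≠ 0 → 0 ≤ pairing u v →
        (u' ≠ 0 ∨ v' ≠ 0) ∧ 0 ≤ pairing u' v' ∧ (0 < k → 0 < pairing u' v')) := by
  induction k with
  | zero =>
    refine ⟨u, v, ?_, by simp, by simp, fun h h' => ⟨h, h', by simp⟩⟩
    have : (clearedSymbol α β).map (aeval (s ^ 2) : ℝ[X] →ₐ[ℝ] ℂ) = 1 := by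
      simp [clearedSymbol]
    rw [this, Matrix.one_mulVec]
  | succ k ih =>
    obtain ⟨u₁, v₁, h1, h2, h3, h4⟩ := ih (fun m => α m.succ) (fun m => β m.succ)
      (fun m => hα _) (fun m => hβ _)
    have ha := hα 0
    have hb := hβ 0
    set a := α 0
    set b := β 0
    set u₂ := s * u₁ + b * v₁ with hu₂
    set v₂ := ((b⁻¹ : ℝ) : ℂ) * u₁ + s * v₁ with hv₂
    have g1 : Complex.normSq (s + 1) * pairing u₁ v₁ ≤ pairing u₂ v₂ := pairing_step_le_add hb hs _ _
    have g2 : Complex.normSq (s - 1) * pairing u₁ v₁ ≤ pairing u₂ v₂ := pairing_step_le_sub hb hs _ _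
    have n1 := Complex.normSq_nonneg (s + 1)
    have n2 := Complex.normSq_nonneg (s - 1)
    refine ⟨s * u₂ + a * v₂, ((a⁻¹ : ℝ) : ℂ) * u₂ + s * v₂, ?_, ?_, ?_, ?_⟩
    · rw [clearedSymbol_succ, Matrix.map_mul, ← Matrix.mulVec_mulVec, h1]
      ext i
      fin_cases i <;> simp [Matrix.mulVec, dotProduct, Fin.sum_univ_two, hu₂, hv₂] <;>
        simp only [← Complex.ofReal_inv] <;> ring
    · refine le_trans ?_ (pairing_step_le_add ha hs _ _)
      rw [show 2 * (k + 1) = 2 * k + 1 + 1 by ring, pow_succ', pow_succ', mul_assoc, mul_assoc]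
      exact mul_le_mul_of_nonneg_left ((mul_le_mul_of_nonneg_left h2 n1).trans g1) n1
    · refine le_trans ?_ (pairing_step_le_sub ha hs _ _)
      rw [show 2 * (k + 1) = 2 * k + 1 + 1 by ring, pow_succ', pow_succ', mul_assoc, mul_assoc]
      exact mul_le_mul_of_nonneg_left ((mul_le_mul_of_nonneg_left h3 n2).trans g2) n2
    · intro huv hp
      obtain ⟨huv₁, hp₁, -⟩ := h4 huv hp
      have hp₂ : 0 < pairing u₂ v₂ := pairing_step_pos hb hs hp₁ huv₁
      have hp₃ := pairing_step_pos ha hs hp₂.le (pairing_pos_ne hp₂)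
      exact ⟨pairing_pos_ne hp₃, hp₃.le, fun _ => hp₃⟩

section Spectrum

variable {k : ℕ} {α β : Fin k → ℝ}

theorem clearedSymbol_det : (clearedSymbol α β).det = (X - 1) ^ (2 * k) ∨ ∃ m, α m = 0 ∨ β m = 0 := by
  by_cases h : ∃ m, α m = 0 ∨ β m = 0
  · exact Or.inr h
  push Not at h
  left
  induction k with
  | zero => simp [clearedSymbol]
  | succ k ih =>
    rw [clearedSymbol_succ, Matrix.det_mul, ih fun m => h _, Matrix.det_fin_two]
    obtain ⟨ha, hb⟩ := h 0
    have e : (X + C (α 0 * (β 0)⁻¹)) * (X + C ((α 0)⁻¹ * β 0)) -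
        C (α 0 + β 0) * (X * C ((α 0)⁻¹ + (β 0)⁻¹)) = (X - 1) ^ 2 := by
      have e1 : C (α 0) * C (α 0)⁻¹ = 1 := by rw [← C_mul, mul_inv_cancel₀ ha, C_1]
      have e2 : C (β 0) * C (β 0)⁻¹ = 1 := by rw [← C_mul, mul_inv_cancel₀ hb, C_1]
      simp only [C_mul, C_add]
      linear_combination (C (β 0) * C (β 0)⁻¹ - X) * e1 + (1 - X) * e2
    simp only [Matrix.of_apply, Matrix.cons_val_zero, Matrix.cons_val_one, Matrix.cons_val_fin_one,
      Matrix.cons_val']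
    rw [e]
    ring

theorem normSq_add_one_lt {s : ℂ} (hs : 0 < s.re) :
    Complex.normSq (s - 1) < Complex.normSq (s + 1) := by
  simp [Complex.normSq_apply]
  nlinarith

/-- The eigenvalues of the symbol lie on the unit circle only for `z ≤ 0`. -/
theorem real_nonpos_of_trace_sq_eq (hk : 0 < k) (hα : ∀ m, 0 < α m) (hβ : ∀ m, 0 < β m) {z : ℂ}
    {c : ℝ} (hc : c ^ 2 ≤ 4)
    (h : aeval z (clearedSymbol α β).trace = c * (z - 1) ^ k) : z.im = 0 ∧ z.re ≤ 0 := by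
  by_contra hz
  have hslit : z ∈ Complex.slitPlane := by
    rw [Complex.mem_slitPlane_iff]
    by_contra h'
    push Not at h'
    exact hz ⟨h'.2, h'.1⟩
  have hz1 : z ≠ 1 := by
    rintro rfl
    rw [sub_self, zero_pow hk.ne', mul_zero] at h
    have h1 := trace_eval_pos hα hβ (one_pos)
    have h2 : aeval (1 : ℂ) (clearedSymbol α β).trace =
        (((clearedSymbol α β).trace.eval 1 : ℝ) : ℂ) := by
      have := aeval_algebraMap_apply ℂ (1 : ℝ) (clearedSymbol α β).trace
      simpa using this
    rw [h2, Complex.ofReal_eq_zero] at h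
    exact h1.ne' h
  obtain ⟨s, hs, rfl⟩ : ∃ s : ℂ, 0 < s.re ∧ s ^ 2 = z := by
    have hz0 : z ≠ 0 := Complex.slitPlane_ne_zero hslit
    refine ⟨Complex.exp (Complex.log z / 2), ?_, ?_⟩
    · rw [Complex.exp_re]
      refine mul_pos (Real.exp_pos _) (Real.cos_pos_of_mem_Ioo ?_)
      have h1 := Complex.neg_pi_lt_log_im z
      have h2 : (Complex.log z).im < Real.pi := by
        rw [Complex.log_im]
        exact lt_of_le_of_ne (Complex.arg_le_pi z) (Complex.mem_slitPlane_iff_arg.1 hslit).1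
      have e : (Complex.log z / 2).im = (Complex.log z).im / 2 := by
        simp
      rw [e]
      constructor <;> linarith
    · rw [← Complex.exp_nat_mul]
      push_cast
      rw [mul_div_cancel₀ _ (two_ne_zero' ℂ), Complex.exp_log hz0]
  set M := (clearedSymbol α β).map (aeval (s ^ 2) : ℝ[X] →ₐ[ℝ] ℂ) with hM
  set d := (s ^ 2 - 1) ^ k with hd
  have htr : M.trace = c * d := by
    rw [← h, hM, Matrix.trace, Matrix.trace, map_sum]
    rfl
  have hdet : M.det = d ^ 2 := by
    have h1 : (clearedSymbol α β).det = (X - 1) ^ (2 * k) := by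
      refine clearedSymbol_det.resolve_right ?_
      rintro ⟨m, h | h⟩
      · exact (hα m).ne' h
      · exact (hβ m).ne' h
    have h2 := (aeval (s ^ 2) : ℝ[X] →ₐ[ℝ] ℂ).map_det (clearedSymbol α β)
    rw [h1] at h2
    rw [hM, hd]
    refine Eq.trans h2.symm ?_
    simp
    ring
  -- Since c² ≤ 4, the roots of e² - c e + 1 have modulus one. One of them, times (z-1)^k, is an
  -- eigenvalue of the cleared matrix.
  set r := √(4 - c ^ 2) with hr
  have hr2 : r ^ 2 = 4 - c ^ 2 := Real.sq_sqrt (by linarith)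
  set e : ℂ := ⟨c / 2, r / 2⟩ with he
  have he2 : e ^ 2 - c * e + 1 = 0 := by
    apply Complex.ext <;> simp [he, pow_two]
    · nlinarith
    · ring
  have hen : Complex.normSq e = 1 := by
    simp [he, Complex.normSq_apply]
    nlinarith
  have hev : (M - Matrix.scalar (Fin 2) (e * d)).det = 0 := by
    have ht2 : M 0 0 + M 1 1 = c * d := by rw [← htr, Matrix.trace, Fin.sum_univ_two]; rfl
    rw [Matrix.det_fin_two] at hdet ⊢
    simp
    linear_combination hdet - e * d * ht2 + d ^ 2 * he2
  obtain ⟨x, hx0, hx⟩ := Matrix.exists_mulVec_eq_zero_iff.2 hev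
  have hs0 : s ≠ 0 := by
    rintro rfl
    simp at hs
  rw [Matrix.sub_mulVec, sub_eq_zero] at hx
  set u := x 0
  set v := s⁻¹ * x 1
  have hxe : x = ![u, s * v] := by
    ext i
    fin_cases i <;> simp [u, v, hs0]
  have huv : u ≠ 0 ∨ v ≠ 0 := by
    by_contra! h'
    apply hx0
    rw [hxe, h'.1, h'.2]
    ext i
    fin_cases i <;> simp
  obtain ⟨u', v', h1, h2, h3, h4⟩ := clearedSymbol_mulVec α β hα hβ hs u v
  rw [← hM, ← hxe, hx] at h1
  have hu' : u' = e * d * u := by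
    have := congrFun h1 0
    rw [hxe] at this
    simpa using this.symm
  have hv' : v' = e * d * v := by
    have := congrFun h1 1
    rw [hxe] at this
    simp at this
    refine mul_left_cancel₀ hs0 ?_
    rw [← this]
    ring
  have hpair : pairing u' v' =
      (Complex.normSq (s - 1) * Complex.normSq (s + 1)) ^ k * pairing u v := by
    rw [hu', hv', pairing_mul_mul, Complex.normSq_mul, hen, one_mul, hd, map_pow,
      show s ^ 2 - 1 = (s - 1) * (s + 1) by ring, Complex.normSq_mul]
  have hlt := normSq_add_one_lt hs
  have hn1 : 0 < Complex.normSq (s - 1) := by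
    refine Complex.normSq_pos.2 fun h0 => hz1 ?_
    rw [sub_eq_zero.1 h0, one_pow]
  have hp := hn1.trans hlt
  have hpow := pow_lt_pow_left₀ hlt hn1.le hk.ne'
  have hq1 := pow_pos hn1 k
  have hq2 := pow_pos hp k
  rw [hpair, mul_pow] at h2 h3
  rw [pow_mul', pow_two] at h2 h3
  -- On the eigenvector the form is multiplied exactly by (|s-1|²|s+1|²)^k. This is too large for
  -- the bound with |s-1| if the form is negative, too small for the bound with |s+1| if it is
  -- positive, and contradicts strict positivity if it is zero.
  rcases lt_trichotomy (pairing u v) 0 with hneg | hzero | hpos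
  · have := mul_pos (mul_pos hq1 (sub_pos.2 hpow)) (neg_pos.2 hneg)
    nlinarith
  · have := (h4 huv hzero.ge).2.2 hk
    rw [hpair, hzero, mul_zero] at this
    exact this.false
  · have := mul_pos (mul_pos hq2 (sub_pos.2 hpow)) hpos
    nlinarith

end Spectrum
end AztecDiamond

namespace AztecDiamond

/-! ### Multiple zeros of the discriminant -/

/-- Near a zero of order `m`, an analytic function takes small negative values at nonreal points,
unless `m = 1` or the function is negative on the real axis to order `2`. -/
theorem exists_nonreal_neg_value {x a : ℝ} {m : ℕ} {h : ℂ → ℂ} (hh : AnalyticAt ℂ h x)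
    (hha : h x = a) (ha : a ≠ 0) (hm : 2 ≤ m) (hma : 3 ≤ m ∨ 0 < a) {U : Set ℂ}
    (hU : U ∈ 𝓝 (x : ℂ)) :
    ∃ z ∈ U, z.im ≠ 0 ∧ ∃ ε ∈ Icc (0 : ℝ) 4, (z - x) ^ m * h z = -(ε : ℂ) := by
  have hm0 : (m : ℂ) ≠ 0 := by
    norm_cast
    omega
  have haC : (a : ℂ) ≠ 0 := by exact_mod_cast ha
  -- A direction in the upper half plane along which a·(z-x)^m is negative: angle π/m if a > 0, and
  -- 2π/m if a < 0. The latter is nonreal only because m ≥ 3.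
  obtain ⟨ω, hωim, hω⟩ : ∃ ω : ℂ, 0 < ω.im ∧ (a : ℂ) * ω ^ m = -(|a| : ℝ) := by
    have hmR : (0 : ℝ) < m := by exact_mod_cast (show 0 < m by omega)
    have im_pos (t : ℝ) (h0 : 0 < t) (h1 : t < m) :
        0 < (Complex.exp ((t * Real.pi / m : ℝ) * Complex.I)).im := by
      rw [Complex.exp_ofReal_mul_I_im]
      apply Real.sin_pos_of_pos_of_lt_pi
      · have := Real.pi_pos
        positivity
      · rw [div_lt_iff₀ hmR, mul_comm]
        exact mul_lt_mul_of_pos_left h1 Real.pi_pos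
    have hpow (t : ℝ) : Complex.exp ((t * Real.pi / m : ℝ) * Complex.I) ^ m =
        Complex.exp (t * Real.pi * Complex.I) := by
      rw [← Complex.exp_nat_mul]
      congr 1
      push_cast
      field_simp
    rcases lt_or_gt_of_ne ha with hneg | hpos
    · have h3 : 3 ≤ m := hma.resolve_right hneg.not_gt
      refine ⟨_, im_pos 2 (by norm_num) (by exact_mod_cast (show 2 < m by omega)), ?_⟩
      rw [hpow, abs_of_neg hneg]
      push_cast
      rw [Complex.exp_two_pi_mul_I]
      ring
    · refine ⟨_, im_pos 1 (by norm_num) (by exact_mod_cast (show 1 < m by omega)), ?_⟩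
      rw [hpow, abs_of_pos hpos]
      push_cast
      rw [one_mul, Complex.exp_pi_mul_I]
      ring
  -- Taking an m-th root of h/a, the function becomes a·φ^m with φ a local coordinate of derivative
  -- 1 at x. The points sought are the φ-preimages of δω for small δ > 0.
  set ℓ : ℂ → ℂ := fun z => Complex.log (h z / a) with hℓ
  have hℓx : ℓ x = 0 := by simp [hℓ, hha, haC]
  have hquot : AnalyticAt ℂ (fun z => h z / a) x := hh.div_const
  have hℓan : AnalyticAt ℂ ℓ x := by
    refine hquot.clog ?_
    rw [hha, div_self haC]
    exact Complex.one_mem_slitPlane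
  set φ : ℂ → ℂ := fun z => (z - x) * Complex.exp (ℓ z / m) with hφ
  have hφan : AnalyticAt ℂ φ x :=
    (analyticAt_id.sub analyticAt_const).mul (hℓan.div_const.cexp)
  have hφx : φ x = 0 := by simp [hφ]
  have hφd : HasDerivAt φ 1 x := by
    have h1 : HasDerivAt (fun z : ℂ => z - x) 1 x := (hasDerivAt_id _).sub_const _
    have h2 := h1.mul hℓan.div_const.cexp.differentiableAt.hasDerivAt (d := fun z => Complex.exp (ℓ z / m))
    exact h2.congr_deriv (by simp [hℓx])
  have hφs : HasStrictDerivAt φ 1 x := by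
    have := hφan.hasStrictDerivAt
    rwa [hφd.deriv] at this
  have hφpow : ∀ᶠ z in 𝓝 (x : ℂ), (z - x) ^ m * h z = a * φ z ^ m := by
    have hne : ∀ᶠ z in 𝓝 (x : ℂ), h z ≠ 0 := hh.continuousAt.eventually_ne (by rwa [hha])
    filter_upwards [hne] with z hz
    rw [hφ]
    simp only
    rw [mul_pow, ← Complex.exp_nat_mul, mul_div_cancel₀ _ hm0, hℓ,
      Complex.exp_log (div_ne_zero hz haC)]
    field_simp
  set ψ := hφs.localInverse φ 1 x one_ne_zero with hψ
  have hψd : HasStrictDerivAt ψ 1⁻¹ (φ x) := hφs.to_localInverse one_ne_zero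
  have hψr := hφs.eventually_right_inverse one_ne_zero
  rw [← hψ] at hψr
  rw [hφx, inv_one] at hψd
  rw [hφx] at hψr
  have hψ0 : ψ 0 = x := by
    rw [← hφx]
    exact HasStrictFDerivAt.localInverse_apply_image ..
  have hline : HasDerivAt (fun δ : ℝ => (δ : ℂ) * ω) ω 0 := by
    simpa using (Complex.ofRealCLM.hasDerivAt (x := (0 : ℝ))).mul_const ω
  -- The curve δ ↦ ψ(δω) leaves x with velocity ω, so it is off the real axis for small δ > 0.
  have hγ : HasDerivAt (fun δ : ℝ => ψ (δ * ω)) ω 0 := by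
    have h1 : HasDerivAt ψ 1 (((0 : ℝ) : ℂ) * ω) := by simpa using hψd.hasDerivAt
    exact (h1.scomp (0 : ℝ) hline).congr_deriv (by simp)
  have hγt : Tendsto (fun δ : ℝ => ψ (δ * ω)) (𝓝 0) (𝓝 (x : ℂ)) := by
    have := hγ.continuousAt.tendsto
    simpa [hψ0] using this
  have hlt : Tendsto (fun δ : ℝ => (δ : ℂ) * ω) (𝓝 0) (𝓝 0) := by
    have := hline.continuousAt.tendsto
    simpa using this
  have hγim : HasDerivAt (fun δ : ℝ => (ψ (δ * ω)).im) ω.im 0 := by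
    exact Complex.imCLM.hasFDerivAt.comp_hasDerivAt (0 : ℝ) hγ
  have hpos : ∀ᶠ δ : ℝ in 𝓝[>] (0 : ℝ), 0 < (ψ (δ * ω)).im := by
    have := hγim.tendsto_slope.eventually (lt_mem_nhds hωim)
    have h2 : 𝓝[>] (0 : ℝ) ≤ 𝓝[≠] 0 := nhdsWithin_mono _ fun y hy => ne_of_gt hy
    filter_upwards [h2 this, self_mem_nhdsWithin] with δ hδ hδ0
    simp only [slope, hψ0, vsub_eq_sub, sub_zero, smul_eq_mul, Complex.ofReal_zero, zero_mul,
      Complex.ofReal_im] at hδ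
    exact pos_of_mul_pos_right hδ (inv_pos.2 hδ0).le
  have hsmall : ∀ᶠ δ : ℝ in 𝓝[>] (0 : ℝ), |a| * δ ^ m < 4 := by
    have : Tendsto (fun δ : ℝ => |a| * δ ^ m) (𝓝 0) (𝓝 (|a| * 0 ^ m)) :=
      (Continuous.tendsto (by fun_prop) 0)
    rw [zero_pow (by omega), mul_zero] at this
    exact nhdsWithin_le_nhds (this.eventually (gt_mem_nhds (by norm_num)))
  have hev := ((hγt.eventually_mem hU).and ((hγt.eventually hφpow).and
    (hlt.eventually hψr))).filter_mono (nhdsWithin_le_nhds (s := Ioi (0 : ℝ)))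
  obtain ⟨δ, h1, h2, ⟨h3, h4, h5⟩, hδ⟩ :=
    (hpos.and (hsmall.and (hev.and self_mem_nhdsWithin))).exists
  have hδ' : (0 : ℝ) < δ := hδ
  refine ⟨ψ (δ * ω), h3, h1.ne', |a| * δ ^ m, ⟨by positivity, h2.le⟩, ?_⟩
  rw [h4, h5, mul_pow]
  push_cast
  linear_combination (δ : ℂ) ^ m * hω

/-- The data of the theorem. -/
structure SpectralData {k : ℕ} (α β : Fin k → ℝ) (p₀ q : ℝ[X]) : Prop where
  hk : 0 < k
  hα : ∀ m, 0 < α m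
  hβ : ∀ m, 0 < β m
  hαβ : ∏ m, α m = ∏ m, β m
  hq : q.Monic
  hp₀ : Squarefree p₀
  hp : discrPoly α β = q ^ 2 * p₀

theorem aeval_ofReal (P : ℝ[X]) (x : ℝ) : aeval (x : ℂ) P = ((P.eval x : ℝ) : ℂ) := by
  simpa using aeval_algebraMap_apply ℂ x P

namespace SpectralData

variable {k : ℕ} {α β : Fin k → ℝ} {p₀ q : ℝ[X]} (S : SpectralData α β p₀ q)
include S

/-- The hypothesis says T² = (4-ε)(z-1)^{2k}, that is T = ±√(4-ε)(z-1)^k, and the spectral statement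
applies with c = ±√(4-ε). -/
theorem real_nonpos_of_discr {z : ℂ} {ε : ℝ} (hε : ε ∈ Icc (0 : ℝ) 4)
    (h : aeval z (discrPoly α β) = -ε * (z - 1) ^ (2 * k)) : z.im = 0 ∧ z.re ≤ 0 := by
  set t := aeval z (clearedSymbol α β).trace with ht
  have h4 : aeval z (4 : ℝ[X]) = (4 : ℂ) := map_ofNat _ 4
  have e : aeval z (discrPoly α β) = t ^ 2 - 4 * (z - 1) ^ (2 * k) := by
    simp [discrPoly, h4, ht]
  have hs : (√(4 - ε)) ^ 2 = 4 - ε := Real.sq_sqrt (by linarith [hε.2])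
  have hsC : ((√(4 - ε) : ℝ) : ℂ) ^ 2 = 4 - ε := by
    rw [← Complex.ofReal_pow, hs]
    push_cast
    ring
  have key : (t - (√(4 - ε) : ℝ) * (z - 1) ^ k) * (t + (√(4 - ε) : ℝ) * (z - 1) ^ k) = 0 := by
    rw [e, pow_mul'] at h
    linear_combination h - ((z - 1) ^ k) ^ 2 * hsC
  have hle : (√(4 - ε)) ^ 2 ≤ 4 := by rw [hs]; linarith [hε.1]
  rcases mul_eq_zero.1 key with h0 | h0
  · exact real_nonpos_of_trace_sq_eq S.hk S.hα S.hβ hle (by linear_combination h0)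
  · refine real_nonpos_of_trace_sq_eq S.hk S.hα S.hβ (c := -√(4 - ε)) (by simpa using hle) ?_
    push_cast
    linear_combination h0

theorem real_nonpos_of_root {z : ℂ} (h : aeval z p₀ = 0) : z.im = 0 ∧ z.re ≤ 0 :=
  S.real_nonpos_of_discr (ε := 0) (by norm_num) (by rw [S.hp, map_mul, h]; simp)

theorem discr_ne_zero : discrPoly α β ≠ 0 := by
  have := (discrPoly_natDegree S.hk S.hα S.hβ).2
  intro h
  simp [h] at this

theorem p₀_ne_zero : p₀ ≠ 0 := S.hp₀.ne_zero

theorem leadingCoeff_pos : 0 < p₀.leadingCoeff := by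
  have := (discrPoly_natDegree S.hk S.hα S.hβ).2
  rwa [S.hp, leadingCoeff_mul, (S.hq.pow 2).leadingCoeff, one_mul] at this

theorem natDegree_add : 2 * q.natDegree + p₀.natDegree + 1 = 2 * k := by
  have h := (discrPoly_natDegree S.hk S.hα S.hβ).1
  have := S.hk
  rw [S.hp, natDegree_mul (S.hq.pow 2).ne_zero S.p₀_ne_zero, S.hq.natDegree_pow] at h
  omega

theorem natDegree_succ : p₀.natDegree + 1 = 2 * kPrime p₀ := by
  have := S.natDegree_add
  rw [kPrime]
  omega

theorem kPrime_add : q.natDegree + kPrime p₀ = k := by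
  have := S.natDegree_add
  rw [kPrime]
  omega

theorem splits : p₀.Splits := by
  refine Splits.of_splits_map (algebraMap ℝ ℂ) (IsAlgClosed.splits _) fun z hz => ?_
  have : aeval z p₀ = 0 := by
    rw [aeval_def, ← eval_map]
    exact (mem_roots'.1 hz).2
  refine ⟨z.re, Complex.ext (by simp) ?_⟩
  simp [(S.real_nonpos_of_root this).1]

theorem root_nonpos {x : ℝ} (h : p₀.eval x = 0) : x ≤ 0 := by
  have := S.real_nonpos_of_root (z := x) (by rw [aeval_ofReal, h, Complex.ofReal_zero])
  simpa using this.2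

theorem separable : p₀.Separable := PerfectField.separable_iff_squarefree.2 S.hp₀

theorem derivative_ne_zero {x : ℝ} (h : p₀.eval x = 0) : (derivative p₀).eval x ≠ 0 :=
  S.separable.eval₂_derivative_ne_zero (RingHom.id ℝ) h

theorem discr_derivative_eval : (derivative (discrPoly α β)).eval 0 =
    q.eval 0 * (2 * (derivative q).eval 0 * p₀.eval 0 + q.eval 0 * (derivative p₀).eval 0) := by
  rw [S.hp]
  simp [derivative_pow]
  ring

theorem q_zero : q.eval 0 ≠ 0 := by
  intro h
  have := discrPoly_derivative_eval_zero S.hk S.hα S.hβ S.hαβ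
  rw [S.discr_derivative_eval, h, zero_mul] at this
  exact this.false

theorem p₀_zero : p₀.eval 0 = 0 := by
  have := discrPoly_eval_zero S.hβ S.hαβ
  rw [S.hp, eval_mul, eval_pow] at this
  exact (mul_eq_zero.1 this).resolve_left (pow_ne_zero _ S.q_zero)

/-- `p₀` is negative at the real zeros of `q`. -/
theorem p₀_neg_of_q {x : ℝ} (hx : q.eval x = 0) : p₀.eval x < 0 := by
  by_contra! hge
  have hx0 : x ≤ 0 := by
    have := S.real_nonpos_of_discr (z := x) (ε := 0) (by norm_num)
      (by rw [S.hp, map_mul, map_pow, aeval_ofReal, hx]; simp)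
    simpa using this.2
  -- If p₀(x) = 0 as well, then q²p₀ vanishes to order at least 3. If p₀(x) > 0, the order is even
  -- and the leading coefficient is positive. Both cases fit `exists_nonreal_neg_value`.
  obtain ⟨m, P, a, hm, hma, hP, hPa, ha⟩ : ∃ (m : ℕ) (P : ℝ[X]) (a : ℝ), 2 ≤ m ∧
      (3 ≤ m ∨ 0 < a) ∧ discrPoly α β = (X - C x) ^ m * P ∧ P.eval x = a ∧ a ≠ 0 := by
    rcases hge.eq_or_lt with h0 | hpos
    · obtain ⟨P, hP, hnd⟩ := exists_eq_pow_rootMultiplicity_mul_and_not_dvd _ S.discr_ne_zero x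
      have h3 : (X - C x) ^ 3 ∣ discrPoly α β := by
        rw [S.hp, show 3 = 2 + 1 from rfl, pow_succ]
        exact mul_dvd_mul (pow_dvd_pow_of_dvd (dvd_iff_isRoot.2 hx) 2) (dvd_iff_isRoot.2 h0.symm)
      have h3' := (le_rootMultiplicity_iff S.discr_ne_zero).2 h3
      exact ⟨_, P, _, by omega, Or.inl h3', hP, rfl, fun h => hnd (dvd_iff_isRoot.2 h)⟩
    · obtain ⟨P, hP, hnd⟩ := exists_eq_pow_rootMultiplicity_mul_and_not_dvd _ S.hq.ne_zero x
      have h1 : 0 < rootMultiplicity x q := (rootMultiplicity_pos S.hq.ne_zero).2 hx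
      have hPx : P.eval x ≠ 0 := fun h => hnd (dvd_iff_isRoot.2 h)
      have hpos' : 0 < (P ^ 2 * p₀).eval x := by
        rw [eval_mul, eval_pow]
        positivity
      refine ⟨2 * rootMultiplicity x q, P ^ 2 * p₀, _, by omega, Or.inr hpos', ?_, rfl, hpos'.ne'⟩
      rw [S.hp, pow_mul', ← mul_assoc, ← mul_pow, ← hP]
  have hx1 : (x : ℂ) - 1 ≠ 0 := by
    norm_cast
    intro h
    linarith
  have hx1' : (x - 1) ^ (2 * k) > 0 := by
    have : x - 1 ≠ 0 := by linarith
    rw [pow_mul]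
    positivity
  -- The lemma is applied to p/(z-1)^{2k} = (Tr Φ)² - 4, for which a value in [-4,0] at a nonreal
  -- point is forbidden.
  obtain ⟨z, hz1, hzim, ε, hε, hz⟩ := exists_nonreal_neg_value (x := x)
    (a := a / (x - 1) ^ (2 * k)) (m := m)
    (h := fun z => aeval z P / (z - 1) ^ (2 * k)) (U := {z | z - 1 ≠ 0})
    (AnalyticAt.div (analyticAt_id.aeval_polynomial P)
      (by fun_prop) (pow_ne_zero _ hx1))
    (by rw [aeval_ofReal, hPa]; push_cast; rfl) (div_ne_zero ha hx1'.ne') hm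
    (hma.imp_right fun h => div_pos h hx1')
    ((continuous_id.sub continuous_const).continuousAt.eventually_ne hx1)
  refine hzim (S.real_nonpos_of_discr hε ?_).1
  rw [hP, map_mul, map_pow, map_sub, aeval_X, aeval_C, Complex.coe_algebraMap, ← hz]
  field_simp [pow_ne_zero (2 * k) (show z - 1 ≠ 0 from hz1)]

/-! ### The logarithmic derivative of `ρ` -/

/-- The operator (X-1)d/dX - 2k kills (X-1)^{2k}; up to a power of X-1 it is the differentiation of
p/(X-1)^{2k}. -/
theorem discr_derivative :
    (X - 1) * derivative (discrPoly α β) - C (2 * k : ℝ) * discrPoly α β =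
      2 * (clearedSymbol α β).trace *
        ((X - 1) * derivative (clearedSymbol α β).trace - C (k : ℝ) * (clearedSymbol α β).trace) := by
  have e4 : (4 : ℝ[X]) = C 4 := rfl
  obtain ⟨j, hj⟩ : ∃ j, k = j + 1 := ⟨k - 1, by have := S.hk; omega⟩
  have h1 : derivative ((X - 1 : ℝ[X]) ^ (2 * k)) * (X - 1) = C (2 * k : ℝ) * (X - 1) ^ (2 * k) := by
    rw [derivative_pow, derivative_sub, derivative_X, derivative_one, sub_zero, mul_one, mul_assoc,
      ← pow_succ, show 2 * k - 1 + 1 = 2 * k by omega]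
    simp
  rw [discrPoly, e4, derivative_sub, derivative_C_mul, derivative_pow]
  simp only [C_mul, C_ofNat, map_natCast] at h1 ⊢
  simp only [Nat.cast_ofNat, Nat.add_one_sub_one, pow_one]
  linear_combination -4 * h1

/-- A common factor of the discriminant and the trace would divide a power of `X - 1`, but the trace
is positive at 1. -/
theorem trace_coprime : IsCoprime q (clearedSymbol α β).trace := by
  have h1 : IsCoprime ((X - 1 : ℝ[X]) ^ (2 * k)) (clearedSymbol α β).trace := by
    refine IsCoprime.pow_left ?_
    rw [show (X - 1 : ℝ[X]) = X - C 1 by simp]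
    refine (irreducible_X_sub_C 1).coprime_iff_not_dvd.2 fun h => ?_
    exact (trace_eval_pos S.hα S.hβ one_pos).ne' (dvd_iff_isRoot.1 h)
  have h2 : IsCoprime (discrPoly α β) (clearedSymbol α β).trace := by
    have e : discrPoly α β = -4 * (X - 1) ^ (2 * k) +
        (clearedSymbol α β).trace * (clearedSymbol α β).trace := by
      rw [discrPoly]
      ring
    rw [e, IsCoprime.add_mul_left_left_iff]
    have e4 : (-4 : ℝ[X]) = C (-4) := by rw [C_neg]; rfl
    rw [e4]
    exact (isCoprime_mul_unit_left_left (isUnit_C.2 (by norm_num)) _ _).2 h1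
  refine IsCoprime.of_isCoprime_of_dvd_left h2 ?_
  rw [S.hp, pow_two, mul_assoc]
  exact dvd_mul_right _ _

/-- There is a polynomial `N` with `dρ / ρ = N(z) dz / ((z - 1) w)`. -/
theorem exists_numerator : ∃ N : ℝ[X],
    (X - 1) * derivative (clearedSymbol α β).trace - C (k : ℝ) * (clearedSymbol α β).trace = q * N ∧
    2 * (clearedSymbol α β).trace * N =
      2 * ((X - 1) * derivative q - C (k : ℝ) * q) * p₀ + q * (X - 1) * derivative p₀ := by
  have h := S.discr_derivative
  have e : (X - 1) * derivative (discrPoly α β) - C (2 * k : ℝ) * discrPoly α β =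
      q * (2 * ((X - 1) * derivative q - C (k : ℝ) * q) * p₀ + q * (X - 1) * derivative p₀) := by
    rw [S.hp, derivative_mul, derivative_pow]
    simp only [C_mul, C_ofNat, map_natCast]
    simp only [Nat.cast_ofNat, Nat.add_one_sub_one, pow_one]
    ring
  -- Differentiating ρ + 1/ρ = Tr Φ gives (ρ - 1/ρ) dρ/ρ = d Tr Φ, where ρ - 1/ρ = q w/(z-1)^k. The
  -- quotient by q of the numerator of d Tr Φ is therefore the desired N; divisibility holds because
  -- q divides the product of that numerator with the trace and is coprime to the trace.
  have hd : q ∣ (X - 1) * derivative (clearedSymbol α β).trace -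
      C (k : ℝ) * (clearedSymbol α β).trace := by
    have e2 : (2 : ℝ[X]) = C 2 := rfl
    have : q ∣ 2 * ((clearedSymbol α β).trace * ((X - 1) * derivative (clearedSymbol α β).trace -
        C (k : ℝ) * (clearedSymbol α β).trace)) := by
      rw [← mul_assoc, ← h, e]
      exact dvd_mul_right _ _
    rw [e2] at this
    exact S.trace_coprime.dvd_of_dvd_mul_left
      ((IsUnit.dvd_mul_left (isUnit_C.2 (by norm_num))).1 this)
  obtain ⟨N, hN⟩ := hd
  refine ⟨N, hN, mul_left_cancel₀ S.hq.ne_zero ?_⟩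
  rw [← e, h, hN]
  ring

end SpectralData

end AztecDiamond

namespace AztecDiamond

/-! ### The gaps between the zeros of `p₀` -/

/-- `p₀` has odd degree, positive leading coefficient and simple zeros, all of them real and
nonpositive, one of them `0`. -/
structure NonposRooted (p₀ : ℝ[X]) : Prop where
  splits : p₀.Splits
  separable : p₀.Separable
  lead : 0 < p₀.leadingCoeff
  deg : p₀.natDegree + 1 = 2 * kPrime p₀
  zero : p₀.eval 0 = 0
  nonpos : ∀ x, p₀.eval x = 0 → x ≤ 0

/-- The gap `(x_{2ℓ}, x_{2ℓ-1})`. -/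
def gap (p₀ : ℝ[X]) (l : ℕ) : Set ℝ := Ioo (branchPoint p₀ (2 * l)) (branchPoint p₀ (2 * l - 1))

namespace NonposRooted

variable {p₀ : ℝ[X]} (R : NonposRooted p₀)
include R

theorem length_sort : (p₀.roots.sort (· ≥ ·)).length = p₀.natDegree := by
  rw [Multiset.length_sort, R.splits.natDegree_eq_card_roots]

theorem branchPoint_eq {i : ℕ} (hi : i < p₀.natDegree) :
    branchPoint p₀ i = (p₀.roots.sort (· ≥ ·))[i]'(by rwa [R.length_sort]) := by
  rw [branchPoint, List.getD_eq_getElem]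

theorem eval_branchPoint {i : ℕ} (hi : i < p₀.natDegree) : p₀.eval (branchPoint p₀ i) = 0 := by
  rw [R.branchPoint_eq hi]
  have h : (p₀.roots.sort (· ≥ ·))[i]'(by rwa [R.length_sort]) ∈ p₀.roots.sort (· ≥ ·) :=
    List.getElem_mem _
  rw [Multiset.mem_sort] at h
  exact (mem_roots'.1 h).2

theorem branchPoint_lt {i j : ℕ} (hij : i < j) (hj : j < p₀.natDegree) :
    branchPoint p₀ j < branchPoint p₀ i := by
  rw [R.branchPoint_eq hj, R.branchPoint_eq (hij.trans hj)]
  have hn : (p₀.roots.sort (· ≥ ·)).Nodup := by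
    rw [← Multiset.coe_nodup, Multiset.sort_eq]
    exact nodup_roots R.separable
  have h1 := List.pairwise_iff_getElem.1 (Multiset.pairwise_sort p₀.roots (· ≥ ·)) i j
    (by rw [R.length_sort]; exact hij.trans hj) (by rwa [R.length_sort]) hij
  refine lt_of_le_of_ne h1 fun h => hij.ne' ?_
  exact (hn.getElem_inj_iff).1 h

theorem eval_eq_prod (x : ℝ) : p₀.eval x =
    p₀.leadingCoeff * ∏ i ∈ Finset.range p₀.natDegree, (x - branchPoint p₀ i) := by
  have h1 := congrArg (eval x) R.splits.eq_prod_roots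
  rw [eval_mul, eval_C, eval_multiset_prod, Multiset.map_map] at h1
  rw [h1]
  congr 1
  have h2 : p₀.roots = ((p₀.roots.sort (· ≥ ·) : List ℝ) : Multiset ℝ) :=
    (Multiset.sort_eq _ _).symm
  rw [h2, Multiset.map_coe, Multiset.prod_coe, Finset.prod_range]
  rw [← List.prod_ofFn]
  congr 1
  refine List.ext_getElem (by simp [R.length_sort]) fun i hi hi' => ?_
  rw [List.getElem_map, List.getElem_ofFn, R.branchPoint_eq (by simpa using hi')]
  simp

theorem eval_pos {x : ℝ} (hx : 0 < x) : 0 < p₀.eval x := by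
  rw [R.eval_eq_prod]
  refine mul_pos R.lead (Finset.prod_pos fun i hi => ?_)
  have := R.nonpos _ (R.eval_branchPoint (Finset.mem_range.1 hi))
  linarith

theorem branchPoint_neg {i : ℕ} (h0 : 0 < i) (hi : i < p₀.natDegree) : branchPoint p₀ i < 0 :=
  (R.branchPoint_lt h0 hi).trans_le (R.nonpos _ (R.eval_branchPoint (h0.trans hi)))

theorem two_mul_lt {l : ℕ} (hl : l < kPrime p₀) : 2 * l < p₀.natDegree := by
  have := R.deg
  omega

variable {l : ℕ} (hl : 1 ≤ l) (hlk : l < kPrime p₀)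
include hl hlk

theorem gap_left_lt_right : branchPoint p₀ (2 * l) < branchPoint p₀ (2 * l - 1) :=
  R.branchPoint_lt (by omega) (R.two_mul_lt hlk)

theorem gap_right_neg : branchPoint p₀ (2 * l - 1) < 0 :=
  R.branchPoint_neg (by omega) (by have := R.two_mul_lt hlk; omega)

theorem gap_neg {x : ℝ} (hx : x ∈ gap p₀ l) : x < 0 := hx.2.trans (R.gap_right_neg hl hlk)

omit hl in
theorem eval_left : p₀.eval (branchPoint p₀ (2 * l)) = 0 := R.eval_branchPoint (R.two_mul_lt hlk)

theorem eval_right : p₀.eval (branchPoint p₀ (2 * l - 1)) = 0 :=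
  R.eval_branchPoint (by have := R.two_mul_lt hlk; omega)

/-- To the left of x_{2ℓ-1} exactly the 2ℓ factors with indices 0, …, 2ℓ-1 are negative, an even
number. -/
theorem eval_gap_pos {x : ℝ} (hx : x ∈ gap p₀ l) : 0 < p₀.eval x := by
  have h2 := R.two_mul_lt hlk
  rw [R.eval_eq_prod, ← Finset.prod_range_mul_prod_Ico _ h2.le]
  refine mul_pos R.lead (mul_pos ?_ (Finset.prod_pos fun i hi => ?_))
  · have e : ∏ i ∈ Finset.range (2 * l), (x - branchPoint p₀ i) =
        ∏ i ∈ Finset.range (2 * l), (branchPoint p₀ i - x) := by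
      rw [← Finset.prod_congr rfl fun i _ => neg_sub (branchPoint p₀ i) x, Finset.prod_neg]
      simp
    rw [e]
    refine Finset.prod_pos fun i hi => ?_
    have hi' := Finset.mem_range.1 hi
    rcases (show i ≤ 2 * l - 1 by omega).eq_or_lt with rfl | h
    · linarith [hx.2]
    · have := R.branchPoint_lt h (by omega)
      linarith [hx.2]
  · have hi' := Finset.mem_Ico.1 hi
    rcases hi'.1.eq_or_lt with rfl | h
    · linarith [hx.1]
    · have := R.branchPoint_lt h hi'.2
      linarith [hx.1]

omit hl in
theorem gap_lt_gap {l' : ℕ} (hll : l' < l) {x x' : ℝ} (hx : x ∈ gap p₀ l)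
    (hx' : x' ∈ gap p₀ l') : x < x' :=
  (hx.2.trans (R.branchPoint_lt (by omega) (by have := R.two_mul_lt hlk; omega))).trans hx'.1

omit hl hlk in
theorem gap_unique {l' : ℕ} (hlk : l < kPrime p₀) (hlk' : l' < kPrime p₀) {x : ℝ}
    (hx : x ∈ gap p₀ l) (hx' : x ∈ gap p₀ l') : l = l' := by
  rcases lt_trichotomy l l' with h | h | h
  · exact absurd (R.gap_lt_gap hlk' h hx' hx) (lt_irrefl _)
  · exact h
  · exact absurd (R.gap_lt_gap hlk h hx hx') (lt_irrefl _)

end NonposRooted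

theorem derivative_eval_nonneg_of_pos_right {P : ℝ[X]} {a b : ℝ} (hab : a < b) (h0 : P.eval a = 0)
    (h : ∀ x ∈ Ioo a b, 0 < P.eval x) : 0 ≤ (derivative P).eval a := by
  have h1 := (hasDerivAt_iff_tendsto_slope.1 (P.hasDerivAt a)).mono_left
    (nhdsWithin_mono (s := Ioi a) a fun y (hy : a < y) => hy.ne')
  refine ge_of_tendsto h1 ?_
  filter_upwards [Ioo_mem_nhdsGT hab] with x hx
  simp only [slope, h0, vsub_eq_sub, sub_zero, smul_eq_mul]
  exact mul_nonneg (inv_nonneg.2 (sub_nonneg.2 hx.1.le)) (h x hx).le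

theorem derivative_eval_nonpos_of_pos_left {P : ℝ[X]} {a b : ℝ} (hab : a < b) (h0 : P.eval b = 0)
    (h : ∀ x ∈ Ioo a b, 0 < P.eval x) : (derivative P).eval b ≤ 0 := by
  have h1 := (hasDerivAt_iff_tendsto_slope.1 (P.hasDerivAt b)).mono_left
    (nhdsWithin_mono (s := Iio b) b fun y (hy : y < b) => hy.ne)
  refine le_of_tendsto h1 ?_
  filter_upwards [Ioo_mem_nhdsLT hab] with x hx
  simp only [slope, h0, vsub_eq_sub, sub_zero, smul_eq_mul]
  exact mul_nonpos_of_nonpos_of_nonneg (inv_nonpos.2 (sub_nonpos.2 hx.2.le)) (h x hx).le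

theorem same_sign_of_ne_zero {P : ℝ[X]} {a b : ℝ} (hab : a ≤ b)
    (h : ∀ x ∈ Icc a b, P.eval x ≠ 0) : 0 < P.eval a * P.eval b := by
  by_contra! hle
  have hne := mul_ne_zero (h a ⟨le_rfl, hab⟩) (h b ⟨hab, le_rfl⟩)
  have hlt := lt_of_le_of_ne hle hne
  have hc : ContinuousOn (fun x => P.eval x) (Icc a b) := P.continuous.continuousOn
  rcases mul_neg_iff.1 hlt with ⟨h1, h2⟩ | ⟨h1, h2⟩
  · obtain ⟨x, hx, hx0⟩ := intermediate_value_Icc' hab hc ⟨h2.le, h1.le⟩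
    exact h x hx hx0
  · obtain ⟨x, hx, hx0⟩ := intermediate_value_Icc hab hc ⟨h1.le, h2.le⟩
    exact h x hx hx0

/-- A polynomial `N` of degree less than `k'` that changes sign in every gap. -/
structure GapData (k : ℕ) (p₀ N : ℝ[X]) : Prop extends NonposRooted p₀ where
  hk : 0 < k
  N_deg : N.natDegree + 1 ≤ kPrime p₀
  N_one : N.eval 1 ^ 2 = k ^ 2 * p₀.eval 1
  N_sign : ∀ l, 1 ≤ l → l < kPrime p₀ →
    N.eval (branchPoint p₀ (2 * l)) * N.eval (branchPoint p₀ (2 * l - 1)) < 0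

/-! ### Degree and signs of the numerator N. -/

namespace SpectralData

variable {k : ℕ} {α β : Fin k → ℝ} {p₀ q : ℝ[X]} (S : SpectralData α β p₀ q)
include S

theorem nonposRooted : NonposRooted p₀ where
  splits := S.splits
  separable := S.separable
  lead := S.leadingCoeff_pos
  deg := S.natDegree_succ
  zero := S.p₀_zero
  nonpos := fun _ => S.root_nonpos

theorem q_ne_zero_of_nonneg {x : ℝ} (h : 0 ≤ p₀.eval x) : q.eval x ≠ 0 :=
  fun hq => (S.p₀_neg_of_q hq).not_ge h

/-- T² = q²p₀ + 4(x-1)^{2k} is positive there. -/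
theorem trace_ne_zero {x : ℝ} (hx : x < 1) (h : 0 ≤ p₀.eval x) :
    (clearedSymbol α β).trace.eval x ≠ 0 := by
  intro h0
  have e4 : (4 : ℝ[X]) = C 4 := rfl
  have h1 := congrArg (eval x) S.hp
  simp only [discrPoly, e4, eval_sub, eval_mul, eval_pow, h0, eval_C, eval_X, eval_one] at h1
  have h2 : 0 < (x - 1) ^ (2 * k) := by
    have : x - 1 ≠ 0 := by linarith
    rw [pow_mul]
    positivity
  have h3 : 0 ≤ q.eval x ^ 2 * p₀.eval x := by positivity
  norm_num at h1
  linarith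

/-- At a zero of p₀ the second relation becomes 2TN = q(x-1)p₀'. On a closed gap T and q keep their
signs, while p₀' is positive at the left end and negative at the right end; so N changes sign. The
value N(1)² = k²p₀(1) comes from setting x = 1 in the first relation and in p = q²p₀. -/
theorem gapData {N : ℝ[X]}
    (hN : (X - 1) * derivative (clearedSymbol α β).trace -
      C (k : ℝ) * (clearedSymbol α β).trace = q * N)
    (hN' : 2 * (clearedSymbol α β).trace * N =
      2 * ((X - 1) * derivative q - C (k : ℝ) * q) * p₀ + q * (X - 1) * derivative p₀) :
    GapData k p₀ N where
  toNonposRooted := S.nonposRooted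
  hk := S.hk
  N_deg := by
    have hTd := trace_natDegree_le S.hα S.hβ
    -- The operator (X-1)d/dX - k cancels the term of degree k. Dividing by q then leaves degree at
    -- most k - 1 - deg q = k' - 1.
    have hW : ((X - 1) * derivative (clearedSymbol α β).trace -
        C (k : ℝ) * (clearedSymbol α β).trace).natDegree ≤ k - 1 := by
      rw [natDegree_le_iff_coeff_eq_zero]
      intro n hn
      have hn' : k ≤ n := by omega
      have hk := S.hk
      obtain ⟨j, rfl⟩ : ∃ j, n = j + 1 := ⟨n - 1, by omega⟩
      rw [sub_mul, one_mul, coeff_sub, coeff_sub, coeff_X_mul, coeff_C_mul, coeff_derivative,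
        coeff_derivative, coeff_eq_zero_of_natDegree_lt (n := j + 1 + 1) (by omega)]
      rcases hn'.eq_or_lt with rfl | h
      · push_cast
        ring
      · rw [coeff_eq_zero_of_natDegree_lt (n := j + 1) (by omega)]
        simp
    have hk := S.kPrime_add
    have hk0 := S.hk
    by_cases h0 : N = 0
    · rw [h0, natDegree_zero]
      have := S.natDegree_succ
      omega
    · rw [hN, natDegree_mul S.hq.ne_zero h0] at hW
      have := S.natDegree_succ
      omega
  N_one := by
    have e4 : (4 : ℝ[X]) = C 4 := rfl
    have h1 := congrArg (eval 1) hN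
    have h2 := congrArg (eval 1) S.hp
    have hk := S.hk
    simp only [discrPoly, e4, eval_sub, eval_mul, eval_pow, eval_C, eval_X, eval_one, sub_self,
      zero_mul, zero_sub] at h1 h2
    rw [zero_pow (by omega), mul_zero, sub_zero] at h2
    have hq : q.eval 1 ≠ 0 := S.q_ne_zero_of_nonneg (S.nonposRooted.eval_pos one_pos).le
    refine mul_left_cancel₀ (pow_ne_zero 2 hq) ?_
    linear_combination (-q.eval 1 * N.eval 1 + k * (clearedSymbol α β).trace.eval 1) * h1
      + (k : ℝ) ^ 2 * h2
  N_sign := by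
    intro l hl hlk
    have R := S.nonposRooted
    set A := branchPoint p₀ (2 * l)
    set B := branchPoint p₀ (2 * l - 1)
    have hAB : A < B := R.gap_left_lt_right hl hlk
    have hB0 : B < 0 := R.gap_right_neg hl hlk
    have hA : p₀.eval A = 0 := R.eval_left hlk
    have hB : p₀.eval B = 0 := R.eval_right hl hlk
    have hpos : ∀ x ∈ Ioo A B, 0 < p₀.eval x := fun x hx => R.eval_gap_pos hl hlk hx
    have hnn : ∀ x ∈ Icc A B, 0 ≤ p₀.eval x := by
      intro x hx
      rcases hx.1.eq_or_lt with rfl | h1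
      · exact hA.ge
      rcases hx.2.eq_or_lt with rfl | h2
      · exact hB.ge
      exact (hpos x ⟨h1, h2⟩).le
    have dA : 0 < (derivative p₀).eval A :=
      lt_of_le_of_ne (derivative_eval_nonneg_of_pos_right hAB hA hpos) (S.derivative_ne_zero hA).symm
    have dB : (derivative p₀).eval B < 0 :=
      lt_of_le_of_ne (derivative_eval_nonpos_of_pos_left hAB hB hpos) (S.derivative_ne_zero hB)
    have hq := same_sign_of_ne_zero hAB.le fun x hx => S.q_ne_zero_of_nonneg (hnn x hx)
    have hT := same_sign_of_ne_zero hAB.le fun x hx =>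
      S.trace_ne_zero (hx.2.trans_lt (hB0.trans one_pos)) (hnn x hx)
    have e2 : (2 : ℝ[X]) = C 2 := rfl
    have h1 := congrArg (eval A) hN'
    have h2 := congrArg (eval B) hN'
    simp only [e2, eval_mul, eval_add, eval_C, hA, hB, mul_zero, zero_add, eval_sub, eval_X,
      eval_one] at h1 h2
    set T := (clearedSymbol α β).trace
    have key : 4 * (T.eval A * T.eval B) * (N.eval A * N.eval B) =
        (q.eval A * q.eval B) * ((A - 1) * (B - 1)) *
          ((derivative p₀).eval A * (derivative p₀).eval B) := by
      linear_combination (2 * T.eval B * N.eval B) * h1 +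
        (q.eval A * (A - 1) * (derivative p₀).eval A) * h2
    have hd : (derivative p₀).eval A * (derivative p₀).eval B < 0 := mul_neg_of_pos_of_neg dA dB
    have h11 : 0 < (A - 1) * (B - 1) := mul_pos_of_neg_of_neg (by linarith) (by linarith)
    have : 4 * (T.eval A * T.eval B) * (N.eval A * N.eval B) < 0 := by
      rw [key]
      exact mul_neg_of_pos_of_neg (mul_pos hq h11) hd
    exact neg_of_mul_neg_right this (by positivity)

end SpectralData
end AztecDiamond

namespace AztecDiamond

/-! ### Counting real critical points -/

/-- The critical points of `F` on the loop `C_ℓ` are the points `(x, ± √p₀(x))` at which this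
function, with `χ` replaced by `± χ`, vanishes; here `(μ, ν) = (η, 1)`. -/
noncomputable def critFun (k : ℕ) (p₀ N : ℝ[X]) (χ μ ν x : ℝ) : ℝ :=
  k / 2 * √(p₀.eval x) * (μ * (x - 1) - ν * (x + 1)) - χ * (x * N.eval x)

/-- The product of `critFun` for `χ` and `-χ`, divided by `x`. -/
noncomputable def critPoly (k : ℕ) (p₀ N : ℝ[X]) (χ μ ν : ℝ) : ℝ[X] :=
  C ((k : ℝ) ^ 2 / 4) * (p₀.divX * (C (μ - ν) * X - C (μ + ν)) ^ 2) - C (χ ^ 2) * (X * N ^ 2)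

theorem continuous_critFun (k : ℕ) (p₀ N : ℝ[X]) (χ μ ν : ℝ) :
    Continuous (critFun k p₀ N χ μ ν) := by
  unfold critFun
  have h1 := p₀.continuous
  have h2 := N.continuous
  fun_prop

theorem exists_zero_Ioo {f : ℝ → ℝ} (hf : Continuous f) {a b : ℝ} (hab : a < b)
    (h : f a * f b < 0) : ∃ x ∈ Ioo a b, f x = 0 := by
  rcases mul_neg_iff.1 h with ⟨h1, h2⟩ | ⟨h1, h2⟩
  · exact intermediate_value_Ioo' hab.le hf.continuousOn ⟨h2, h1⟩
  · exact intermediate_value_Ioo hab.le hf.continuousOn ⟨h1, h2⟩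

/-- `z = (± 1, x)` with `x` in the `l`-th gap and `(x, ± √p₀(x))` a critical point. -/
def IsGapZero (k : ℕ) (p₀ N : ℝ[X]) (χ μ ν : ℝ) (l : ℕ) (z : ℝ × ℝ) : Prop :=
  (z.1 = 1 ∨ z.1 = -1) ∧ z.2 ∈ gap p₀ l ∧ critFun k p₀ N (z.1 * χ) μ ν z.2 = 0

namespace GapData

variable {k : ℕ} {p₀ N : ℝ[X]} (G : GapData k p₀ N)
include G

theorem k_pos : (0 : ℝ) < k := by exact_mod_cast G.hk

theorem X_mul_divX : X * p₀.divX = p₀ := by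
  have h := X_mul_divX_add p₀
  rwa [coeff_zero_eq_eval_zero, G.zero, C_0, add_zero] at h

theorem eval_divX (x : ℝ) : x * p₀.divX.eval x = p₀.eval x := by
  conv_rhs => rw [← G.X_mul_divX]
  simp

theorem divX_natDegree : p₀.divX.natDegree + 2 = 2 * kPrime p₀ := by
  have := G.deg
  rw [natDegree_divX_eq_natDegree_tsub_one]
  have h : p₀.natDegree ≠ 0 := by
    intro h
    omega
  omega

theorem kPrime_pos : 1 ≤ kPrime p₀ := by
  have := G.N_deg
  omega

theorem divX_zero_pos : 0 < p₀.divX.eval 0 := by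
  have h : (derivative p₀).eval 0 = p₀.divX.eval 0 := by
    conv_lhs => rw [← G.X_mul_divX]
    simp
  rw [← h]
  exact lt_of_le_of_ne
    (derivative_eval_nonneg_of_pos_right one_pos G.zero fun x hx => G.eval_pos hx.1)
    (G.separable.eval₂_derivative_ne_zero (RingHom.id ℝ) G.zero).symm

theorem mul_eval_critPoly (χ μ ν : ℝ) {x : ℝ} (hx : 0 ≤ p₀.eval x) :
    x * (critPoly k p₀ N χ μ ν).eval x =
      critFun k p₀ N χ μ ν x * critFun k p₀ N (-χ) μ ν x := by
  have h1 := Real.sq_sqrt hx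
  have h2 := G.eval_divX x
  simp only [critPoly, critFun, eval_sub, eval_mul, eval_C, eval_pow, eval_X]
  linear_combination (k : ℝ) ^ 2 / 4 * ((μ - ν) * x - (μ + ν)) ^ 2 * (h2 - h1)

theorem critPoly_natDegree (χ μ ν : ℝ) : (critPoly k p₀ N χ μ ν).natDegree ≤ 2 * kPrime p₀ := by
  have h1 := G.divX_natDegree
  have h2 := G.N_deg
  refine (natDegree_sub_le _ _).trans (max_le ?_ ?_)
  · refine (natDegree_C_mul_le _ _).trans (natDegree_mul_le.trans ?_)
    have : ((C (μ - ν) * X - C (μ + ν)) ^ 2).natDegree ≤ 2 * 1 :=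
      natDegree_pow_le_of_le 2 (by compute_degree)
    omega
  · refine (natDegree_C_mul_le _ _).trans (natDegree_mul_le.trans ?_)
    have : (N ^ 2).natDegree ≤ 2 * N.natDegree := natDegree_pow_le
    rw [natDegree_X]
    omega

/-- For μ = ν the squared linear factor is constant, so the count of roots loses at least one. -/
theorem critPoly_natDegree_of_eq (χ μ : ℝ) : (critPoly k p₀ N χ μ μ).natDegree + 1 ≤ 2 * kPrime p₀ := by
  have h1 := G.divX_natDegree
  have h2 := G.N_deg
  suffices (critPoly k p₀ N χ μ μ).natDegree ≤ 2 * kPrime p₀ - 1 by omega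
  refine (natDegree_sub_le _ _).trans (max_le ?_ ?_)
  · refine (natDegree_C_mul_le _ _).trans (natDegree_mul_le.trans ?_)
    have : ((C (μ - μ) * X - C (μ + μ)) ^ 2).natDegree ≤ 2 * 0 :=
      natDegree_pow_le_of_le 2 (by rw [sub_self, C_0, zero_mul, zero_sub, natDegree_neg, natDegree_C])
    omega
  · refine (natDegree_C_mul_le _ _).trans (natDegree_mul_le.trans ?_)
    have : (N ^ 2).natDegree ≤ 2 * N.natDegree := natDegree_pow_le
    rw [natDegree_X]
    omega

variable {l : ℕ} (hl : 1 ≤ l) (hlk : l < kPrime p₀) {χ μ ν : ℝ}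
include hl hlk

theorem N_left_ne : N.eval (branchPoint p₀ (2 * l)) ≠ 0 :=
  left_ne_zero_of_mul (G.N_sign l hl hlk).ne

theorem N_right_ne : N.eval (branchPoint p₀ (2 * l - 1)) ≠ 0 :=
  right_ne_zero_of_mul (G.N_sign l hl hlk).ne

omit hl in
theorem critFun_left : critFun k p₀ N χ μ ν (branchPoint p₀ (2 * l)) =
    -χ * (branchPoint p₀ (2 * l) * N.eval (branchPoint p₀ (2 * l))) := by
  rw [critFun, G.eval_left hlk]
  simp

theorem critFun_right : critFun k p₀ N χ μ ν (branchPoint p₀ (2 * l - 1)) =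
    -χ * (branchPoint p₀ (2 * l - 1) * N.eval (branchPoint p₀ (2 * l - 1))) := by
  rw [critFun, G.eval_right hl hlk]
  simp

theorem critPoly_ne_zero (hχ : χ ≠ 0) : critPoly k p₀ N χ μ ν ≠ 0 := by
  intro h
  have h1 := G.mul_eval_critPoly χ μ ν (G.eval_left hlk).ge
  rw [h, eval_zero, mul_zero, G.critFun_left hlk, G.critFun_left hlk] at h1
  have hA := ((G.gap_left_lt_right hl hlk).trans (G.gap_right_neg hl hlk)).ne
  have hN := G.N_left_ne hl hlk
  simp [hχ, hA, hN] at h1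

/-- At the ends of the gap √p₀ vanishes and the function equals -χ x N(x), where x < 0 at both ends
and N changes sign. -/
theorem exists_gap_zero (hχ : χ ≠ 0) : ∃ x ∈ gap p₀ l, critFun k p₀ N χ μ ν x = 0 := by
  refine exists_zero_Ioo (continuous_critFun _ _ _ _ _ _) (G.gap_left_lt_right hl hlk) ?_
  rw [G.critFun_left hlk, G.critFun_right hl hlk]
  have hB := G.gap_right_neg hl hlk
  have hA := (G.gap_left_lt_right hl hlk).trans hB
  have h1 := mul_pos_of_neg_of_neg hA hB
  have h2 := G.N_sign l hl hlk
  have h3 : 0 < χ ^ 2 := by positivity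
  have h4 := mul_neg_of_pos_of_neg (mul_pos h3 h1) h2
  linarith

omit hl hlk in
theorem linear_eq_zero_of_common {x : ℝ} (hx : 0 < p₀.eval x)
    (h1 : critFun k p₀ N χ μ ν x = 0) (h2 : critFun k p₀ N (-χ) μ ν x = 0) :
    μ * (x - 1) - ν * (x + 1) = 0 ∧ χ * (x * N.eval x) = 0 := by
  have hk := G.k_pos
  have hs := Real.sqrt_pos.2 hx
  rw [critFun] at h1 h2
  constructor
  · have : k / 2 * √(p₀.eval x) * (μ * (x - 1) - ν * (x + 1)) = 0 := by linarith
    exact (mul_eq_zero.1 this).resolve_left (by positivity)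
  · linarith

omit hl hlk in
-- Zeros on the two sheets may share their abscissa x. Then the linear factor and N both vanish at
-- x, so (X-x)² divides each term of `critPoly`, and the root is counted twice as required.
theorem map_snd_le (hχ : χ ≠ 0) (hQ : critPoly k p₀ N χ μ ν ≠ 0) {Z : Finset (ℝ × ℝ)}
    (hZ : ∀ z ∈ Z, ∃ l, 1 ≤ l ∧ l < kPrime p₀ ∧ IsGapZero k p₀ N χ μ ν l z) :
    Z.val.map Prod.snd ≤ (critPoly k p₀ N χ μ ν).roots.filter (· < 0) := by
  rw [Multiset.le_iff_count]
  intro x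
  rw [Multiset.count_map]
  set W := Z.filter fun z => x = z.2 with hW
  have hcard : (Multiset.filter (fun z : ℝ × ℝ => x = z.2) Z.val).card = W.card := rfl
  rw [hcard]
  rcases W.eq_empty_or_nonempty with h0 | ⟨z, hz⟩
  · rw [h0]
    simp
  have hsub : W ⊆ {((1 : ℝ), x), ((-1 : ℝ), x)} := by
    intro y hy
    obtain ⟨hyZ, hyx⟩ := Finset.mem_filter.1 hy
    obtain ⟨l, -, -, hs, -, -⟩ := hZ y hyZ
    obtain ⟨y1, y2⟩ := y
    simp only at hyx hs
    subst hyx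
    rcases hs with rfl | rfl <;> simp
  have hfacts : ∀ y ∈ W, x < 0 ∧ 0 < p₀.eval x ∧ critFun k p₀ N (y.1 * χ) μ ν x = 0 := by
    intro y hy
    obtain ⟨hyZ, hyx⟩ := Finset.mem_filter.1 hy
    obtain ⟨l, hl, hlk, hs, hg, hc⟩ := hZ y hyZ
    rw [← hyx] at hg hc
    exact ⟨G.gap_neg hl hlk hg, G.eval_gap_pos hl hlk hg, hc⟩
  obtain ⟨hx0, hxp, hc⟩ := hfacts z hz
  rw [Multiset.count_filter_of_pos (p := (· < 0)) hx0, count_roots]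
  have hroot : (critPoly k p₀ N χ μ ν).eval x = 0 := by
    have h1 := G.mul_eval_critPoly χ μ ν hxp.le
    have h2 := Finset.mem_insert.1 (hsub hz)
    rw [Finset.mem_singleton] at h2
    have h3 : critFun k p₀ N χ μ ν x * critFun k p₀ N (-χ) μ ν x = 0 := by
      rcases h2 with rfl | rfl
      · rw [one_mul] at hc
        rw [hc, zero_mul]
      · rw [neg_one_mul] at hc
        rw [hc, mul_zero]
    rw [h3] at h1
    exact (mul_eq_zero.1 h1).resolve_left hx0.ne
  by_cases hW1 : W.card ≤ 1
  · exact hW1.trans ((rootMultiplicity_pos hQ).2 hroot)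
  · have hcard2 : ({((1 : ℝ), x), ((-1 : ℝ), x)} : Finset (ℝ × ℝ)).card = 2 :=
      Finset.card_pair (by simp; norm_num)
    have hWe : W = {((1 : ℝ), x), ((-1 : ℝ), x)} :=
      Finset.eq_of_subset_of_card_le hsub (by omega)
    have c1 := (hfacts (1, x) (by simp [hWe])).2.2
    have c2 := (hfacts (-1, x) (by simp [hWe])).2.2
    simp only [one_mul, neg_one_mul] at c1 c2
    obtain ⟨hlin, hN⟩ := G.linear_eq_zero_of_common hxp c1 c2
    have hN0 : N.eval x = 0 := by simpa [hχ, hx0.ne] using hN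
    rw [hWe, hcard2, le_rootMultiplicity_iff hQ]
    have d1 : X - C x ∣ C (μ - ν) * X - C (μ + ν) := by
      rw [dvd_iff_isRoot, IsRoot]
      simp
      linarith
    have d2 : X - C x ∣ N := dvd_iff_isRoot.2 hN0
    exact dvd_sub (((pow_dvd_pow_of_dvd d1 2).mul_left _).mul_left _)
      (((pow_dvd_pow_of_dvd d2 2).mul_left _).mul_left _)

omit hl hlk in
theorem biUnion_zero {Z : ℕ → Finset (ℝ × ℝ)}
    (hZ : ∀ l, 1 ≤ l → l < kPrime p₀ → ∀ z ∈ Z l, IsGapZero k p₀ N χ μ ν l z) :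
    (∀ z ∈ (Finset.Ico 1 (kPrime p₀)).biUnion Z,
      ∃ l, 1 ≤ l ∧ l < kPrime p₀ ∧ IsGapZero k p₀ N χ μ ν l z) ∧
    ((Finset.Ico 1 (kPrime p₀)).biUnion Z).card = ∑ l ∈ Finset.Ico 1 (kPrime p₀), (Z l).card := by
  constructor
  · intro z hz
    obtain ⟨l, hl, hz⟩ := Finset.mem_biUnion.1 hz
    rw [Finset.mem_Ico] at hl
    exact ⟨l, hl.1, hl.2, hZ l hl.1 hl.2 z hz⟩
  · refine Finset.card_biUnion fun i hi j hj hij => ?_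
    rw [Finset.mem_coe, Finset.mem_Ico] at hi hj
    refine Finset.disjoint_left.2 ?_
    intro z hzi hzj
    exact hij (G.gap_unique hi.2 hj.2 (hZ i hi.1 hi.2 z hzi).2.1 (hZ j hj.1 hj.2 z hzj).2.1)

omit hl hlk in
-- Gap zeros are paid for by negative roots of `critPoly`, the points of `E` by nonnegative ones,
-- and the gaps are disjoint.
theorem sum_card_add_le (hχ : χ ≠ 0) (hQ : critPoly k p₀ N χ μ ν ≠ 0) {Z : ℕ → Finset (ℝ × ℝ)}
    (hZ : ∀ l, 1 ≤ l → l < kPrime p₀ → ∀ z ∈ Z l, IsGapZero k p₀ N χ μ ν l z) {E : Finset ℝ}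
    (hE : ∀ y ∈ E, 0 ≤ y ∧ (critPoly k p₀ N χ μ ν).eval y = 0) :
    ∑ l ∈ Finset.Ico 1 (kPrime p₀), (Z l).card + E.card ≤ (critPoly k p₀ N χ μ ν).natDegree := by
  obtain ⟨h1, h2⟩ := G.biUnion_zero hZ
  have h3 := Multiset.card_le_card (G.map_snd_le hχ hQ h1)
  have h4 : E.val ≤ (critPoly k p₀ N χ μ ν).roots.filter (fun x => ¬ x < 0) := by
    rw [Multiset.le_iff_subset E.nodup]
    intro y hy
    obtain ⟨h, h'⟩ := hE y hy
    exact Multiset.mem_filter.2 ⟨(mem_roots hQ).2 h', h.not_gt⟩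
  have h5 := Multiset.card_le_card h4
  have h6 := congrArg Multiset.card
    (Multiset.filter_add_not (· < 0) (critPoly k p₀ N χ μ ν).roots)
  rw [Multiset.card_add] at h6
  rw [Multiset.card_map] at h3
  have h7 := card_roots' (critPoly k p₀ N χ μ ν)
  have h8 : Multiset.card ((Finset.Ico 1 (kPrime p₀)).biUnion Z).val =
    ∑ l ∈ Finset.Ico 1 (kPrime p₀), (Z l).card := h2
  have h9 : Multiset.card E.val = E.card := rfl
  omega

omit hl hlk in
theorem exists_zeros (μ ν : ℝ) (hχ : χ ≠ 0) : ∃ Z : ℕ → Finset (ℝ × ℝ), ∀ l, 1 ≤ l → l < kPrime p₀ →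
    (∀ z ∈ Z l, IsGapZero k p₀ N χ μ ν l z) ∧ (Z l).card = 2 := by
  have : ∀ l, ∃ Z : Finset (ℝ × ℝ), 1 ≤ l → l < kPrime p₀ →
      (∀ z ∈ Z, IsGapZero k p₀ N χ μ ν l z) ∧ Z.card = 2 := by
    intro l
    by_cases h : 1 ≤ l ∧ l < kPrime p₀
    · obtain ⟨x, hx, hx'⟩ := G.exists_gap_zero (μ := μ) (ν := ν) h.1 h.2 hχ
      obtain ⟨y, hy, hy'⟩ := G.exists_gap_zero (μ := μ) (ν := ν) h.1 h.2 (neg_ne_zero.2 hχ)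
      refine ⟨{(1, x), (-1, y)}, fun _ _ => ⟨?_, Finset.card_pair ?_⟩⟩
      · intro z hz
        rw [Finset.mem_insert, Finset.mem_singleton] at hz
        rcases hz with rfl | rfl
        · exact ⟨Or.inl rfl, hx, by simpa using hx'⟩
        · exact ⟨Or.inr rfl, hy, by simpa using hy'⟩
      · intro h
        have := congrArg Prod.fst h
        norm_num at this
    · exact ⟨∅, fun h1 h2 => absurd ⟨h1, h2⟩ h⟩
  choose Z hZ using this
  exact ⟨Z, hZ⟩

/-- Each of the k' - 2 other gaps supplies two zeros, one on each sheet. The total is `Z₀.card` +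
2(k'-2), written without subtraction. -/
theorem exists_zeros_update (hχ : χ ≠ 0) {Z₀ : Finset (ℝ × ℝ)}
    (hZ₀ : ∀ z ∈ Z₀, IsGapZero k p₀ N χ μ ν l z) :
    ∃ Z : ℕ → Finset (ℝ × ℝ), (∀ l, 1 ≤ l → l < kPrime p₀ → ∀ z ∈ Z l, IsGapZero k p₀ N χ μ ν l z) ∧
      Z l = Z₀ ∧
      ∑ l ∈ Finset.Ico 1 (kPrime p₀), (Z l).card + 4 = Z₀.card + 2 * kPrime p₀ := by
  obtain ⟨Z, hZ⟩ := G.exists_zeros μ ν hχ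
  refine ⟨Function.update Z l Z₀, ?_, Function.update_self .., ?_⟩
  · intro j hj hjk z hz
    by_cases h : j = l
    · subst h
      rw [Function.update_self] at hz
      exact hZ₀ z hz
    · rw [Function.update_of_ne h] at hz
      exact (hZ j hj hjk).1 z hz
  · have hmem : l ∈ Finset.Ico 1 (kPrime p₀) := Finset.mem_Ico.2 ⟨hl, hlk⟩
    rw [← Finset.add_sum_erase _ _ hmem, Function.update_self]
    have : ∑ j ∈ (Finset.Ico 1 (kPrime p₀)).erase l, (Function.update Z l Z₀ j).card =
        ∑ j ∈ (Finset.Ico 1 (kPrime p₀)).erase l, 2 := by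
      refine Finset.sum_congr rfl fun j hj => ?_
      rw [Finset.mem_erase, Finset.mem_Ico] at hj
      rw [Function.update_of_ne hj.1]
      exact (hZ j hj.2.1 hj.2.2).2
    rw [this, Finset.sum_const, Finset.card_erase_of_mem hmem, Nat.card_Ico, smul_eq_mul]
    omega

/-- The other gaps occupy 2(k'-2) of at most 2k' roots, which leaves four for this gap and the
half-line [0,∞) together. -/
theorem card_add_le_four (hχ : χ ≠ 0) {Z₀ : Finset (ℝ × ℝ)}
    (hZ₀ : ∀ z ∈ Z₀, IsGapZero k p₀ N χ μ ν l z) {E : Finset ℝ}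
    (hE : ∀ y ∈ E, 0 ≤ y ∧ (critPoly k p₀ N χ μ ν).eval y = 0) : Z₀.card + E.card ≤ 4 := by
  obtain ⟨Z, hZ, -, hs⟩ := G.exists_zeros_update hl hlk hχ hZ₀
  have h1 := G.sum_card_add_le hχ (G.critPoly_ne_zero hl hlk hχ) hZ hE
  have h2 := G.critPoly_natDegree χ μ ν
  omega

theorem card_le_three_of_eq (hχ : χ ≠ 0) {Z₀ : Finset (ℝ × ℝ)}
    (hZ₀ : ∀ z ∈ Z₀, IsGapZero k p₀ N χ μ μ l z) : Z₀.card ≤ 3 := by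
  obtain ⟨Z, hZ, -, hs⟩ := G.exists_zeros_update hl hlk hχ hZ₀
  have h1 := G.sum_card_add_le (E := ∅) hχ (G.critPoly_ne_zero hl hlk hχ) hZ (by simp)
  have h2 := G.critPoly_natDegree_of_eq χ μ
  rw [Finset.card_empty] at h1
  omega

/-- The remaining k' - 3 gaps occupy 2(k'-3) roots, so six are left for the two given gaps. Two gaps
with four zeros each are thus excluded. -/
theorem card_add_card_le {l' : ℕ} (hl' : 1 ≤ l') (hlk' : l' < kPrime p₀) (hll : l ≠ l')
    (hχ : χ ≠ 0) {Z₀ Z₁ : Finset (ℝ × ℝ)} (hZ₀ : ∀ z ∈ Z₀, IsGapZero k p₀ N χ μ ν l z)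
    (hZ₁ : ∀ z ∈ Z₁, IsGapZero k p₀ N χ μ ν l' z) : Z₀.card + Z₁.card ≤ 6 := by
  have hQ := G.critPoly_ne_zero hl hlk hχ (μ := μ) (ν := ν)
  obtain ⟨B, hB⟩ := G.exists_zeros μ ν hχ
  set Y := Function.update (Function.update B l Z₀) l' Z₁ with hY
  have hYz : ∀ l, 1 ≤ l → l < kPrime p₀ → ∀ z ∈ Y l, IsGapZero k p₀ N χ μ ν l z := by
    intro j hj hjk z hz
    by_cases h : j = l'
    · subst h
      rw [hY, Function.update_self] at hz
      exact hZ₁ z hz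
    rw [hY, Function.update_of_ne h] at hz
    by_cases h : j = l
    · subst h
      rw [Function.update_self] at hz
      exact hZ₀ z hz
    rw [Function.update_of_ne h] at hz
    exact (hB j hj hjk).1 z hz
  have h1 := G.sum_card_add_le (E := ∅) hχ hQ hYz (by simp)
  have h2 := G.critPoly_natDegree χ μ ν
  have hmem : l ∈ Finset.Ico 1 (kPrime p₀) := Finset.mem_Ico.2 ⟨hl, hlk⟩
  have hmem' : l' ∈ (Finset.Ico 1 (kPrime p₀)).erase l :=
    Finset.mem_erase.2 ⟨hll.symm, Finset.mem_Ico.2 ⟨hl', hlk'⟩⟩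
  rw [← Finset.add_sum_erase _ _ hmem, ← Finset.add_sum_erase _ _ hmem'] at h1
  have h3 : ∑ j ∈ ((Finset.Ico 1 (kPrime p₀)).erase l).erase l', (Y j).card =
      ∑ j ∈ ((Finset.Ico 1 (kPrime p₀)).erase l).erase l', 2 := by
    refine Finset.sum_congr rfl fun j hj => ?_
    rw [Finset.mem_erase, Finset.mem_erase, Finset.mem_Ico] at hj
    rw [hY, Function.update_of_ne hj.1, Function.update_of_ne hj.2.1]
    exact (hB j hj.2.2.1 hj.2.2.2).2
  rw [h3, Finset.sum_const, Finset.card_erase_of_mem hmem', Finset.card_erase_of_mem hmem,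
    Nat.card_Ico, smul_eq_mul, hY, Function.update_self, Function.update_of_ne hll,
    Function.update_self, Finset.card_empty] at h1
  have h4 : 2 ≤ kPrime p₀ - 1 := by omega
  omega

/-- If there are four critical points in one gap, all of them are simple. -/
theorem derivative_critPoly_ne_zero (hχ : χ ≠ 0) {Z₀ : Finset (ℝ × ℝ)}
    (hZ₀ : ∀ z ∈ Z₀, IsGapZero k p₀ N χ μ ν l z) (hc : 4 ≤ Z₀.card) {x : ℝ} (hx : ((1 : ℝ), x) ∈ Z₀)
    (hne : critFun k p₀ N (-χ) μ ν x ≠ 0) :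
    (derivative (critPoly k p₀ N χ μ ν)).eval x ≠ 0 := by
  obtain ⟨Z, hZ, hZl, hs⟩ := G.exists_zeros_update hl hlk hχ hZ₀
  have hQ := G.critPoly_ne_zero hl hlk hχ (μ := μ) (ν := ν)
  obtain ⟨h1, h2⟩ := G.biUnion_zero hZ
  set W := (Finset.Ico 1 (kPrime p₀)).biUnion Z with hW
  have h3 := (G.map_snd_le hχ hQ h1).trans (Multiset.filter_le _ _)
  -- Four zeros in one gap bring the total to 2k', so the gap zeros are all the roots, with
  -- multiplicity. The multiplicity of x is then the number of listed zeros above x.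
  have h4 : W.val.map Prod.snd = (critPoly k p₀ N χ μ ν).roots := by
    refine Multiset.eq_of_le_of_card_le h3 ?_
    have h5 := card_roots' (critPoly k p₀ N χ μ ν)
    have h6 := G.critPoly_natDegree χ μ ν
    have h7 : Multiset.card W.val = W.card := rfl
    rw [Multiset.card_map]
    omega
  have hroot : (critPoly k p₀ N χ μ ν).IsRoot x := by
    rw [← mem_roots hQ, ← h4]
    refine Multiset.mem_map.2 ⟨(1, x), ?_, rfl⟩
    exact Finset.mem_biUnion.2 ⟨l, Finset.mem_Ico.2 ⟨hl, hlk⟩, by rwa [hZl]⟩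
  intro hd
  have h5 := (one_lt_rootMultiplicity_iff_isRoot hQ).2 ⟨hroot, hd⟩
  rw [← count_roots, ← h4, Multiset.count_map] at h5
  have h6 : (Multiset.filter (fun z : ℝ × ℝ => x = z.2) W.val).card =
    (W.filter fun z => x = z.2).card := rfl
  rw [h6] at h5
  have h7 : (W.filter fun z => x = z.2) ⊆ {((1 : ℝ), x)} := by
    intro z hz
    obtain ⟨hzW, hzx⟩ := Finset.mem_filter.1 hz
    obtain ⟨j, -, -, hs, -, hz0⟩ := h1 z hzW
    obtain ⟨z1, z2⟩ := z
    simp only at hzx hs hz0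
    subst hzx
    rcases hs with rfl | rfl
    · simp
    · rw [neg_one_mul] at hz0
      exact absurd hz0 hne
  have h8 := Finset.card_le_card h7
  rw [Finset.card_singleton] at h8
  omega

end GapData
end AztecDiamond

namespace AztecDiamond

/-! ### The components of the smooth region -/

/-- The sign of `N` at the right end of the gap. -/
noncomputable def gapSign (p₀ N : ℝ[X]) (l : ℕ) : ℝ :=
  if 0 < N.eval (branchPoint p₀ (2 * l - 1)) then 1 else -1

/-- The pairs `(χ, η)` for which `critFun` is positive at `x` and negative at `y`. -/
def signPair (k : ℕ) (p₀ N : ℝ[X]) (l : ℕ) (x y : ℝ) : Set (ℝ × ℝ) :=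
  {c | 0 < critFun k p₀ N (gapSign p₀ N l * |c.1|) c.2 1 x ∧
    critFun k p₀ N (gapSign p₀ N l * |c.1|) c.2 1 y < 0}

/-- The component of the smooth region that belongs to the `l`-th gap. -/
def smoothGap (k : ℕ) (p₀ N : ℝ[X]) (l : ℕ) : Set (ℝ × ℝ) :=
  ⋃ x ∈ gap p₀ l, ⋃ y ∈ gap p₀ l, ⋃ _ : x < y, signPair k p₀ N l x y

theorem mem_smoothGap {k : ℕ} {p₀ N : ℝ[X]} {l : ℕ} {c : ℝ × ℝ} :
    c ∈ smoothGap k p₀ N l ↔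
      ∃ x ∈ gap p₀ l, ∃ y ∈ gap p₀ l, x < y ∧ c ∈ signPair k p₀ N l x y := by
  simp only [smoothGap, mem_iUnion, exists_prop]

theorem abs_gapSign (p₀ N : ℝ[X]) (l : ℕ) : |gapSign p₀ N l| = 1 := by
  rw [gapSign]
  split_ifs <;> simp

theorem gapSign_cases (p₀ N : ℝ[X]) (l : ℕ) : gapSign p₀ N l = 1 ∨ gapSign p₀ N l = -1 := by
  rw [gapSign]
  split_ifs <;> simp

theorem continuous_critFun_param (k : ℕ) (p₀ N : ℝ[X]) (l : ℕ) (x : ℝ) :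
    Continuous fun c : ℝ × ℝ => critFun k p₀ N (gapSign p₀ N l * |c.1|) c.2 1 x := by
  unfold critFun
  fun_prop

theorem isOpen_smoothGap (k : ℕ) (p₀ N : ℝ[X]) (l : ℕ) : IsOpen (smoothGap k p₀ N l) := by
  refine isOpen_biUnion fun x _ => isOpen_biUnion fun y _ => isOpen_iUnion fun _ => ?_
  exact (isOpen_lt continuous_const (continuous_critFun_param k p₀ N l x)).inter
    (isOpen_lt (continuous_critFun_param k p₀ N l y) continuous_const)

theorem convex_pos_of_affine {f : ℝ × ℝ → ℝ}
    (hf : ∀ c c' : ℝ × ℝ, ∀ s t : ℝ, s + t = 1 → f (s • c + t • c') = s * f c + t * f c') :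
    Convex ℝ {c | 0 < f c} := by
  intro c hc c' hc' s t hs ht hst
  rw [mem_ofPred_eq, hf c c' s t hst]
  exact convex_Ioi (0 : ℝ) hc hc' hs ht hst

theorem critFun_affine (k : ℕ) (p₀ N : ℝ[X]) (σ x : ℝ) (c c' : ℝ × ℝ) (s t : ℝ) (hst : s + t = 1) :
    critFun k p₀ N (σ * (s • c + t • c').1) (s • c + t • c').2 1 x =
      s * critFun k p₀ N (σ * c.1) c.2 1 x + t * critFun k p₀ N (σ * c'.1) c'.2 1 x := by
  simp only [critFun, Prod.fst_add, Prod.snd_add, Prod.smul_fst, Prod.smul_snd, smul_eq_mul]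
  linear_combination (k / 2 * √(p₀.eval x) * (x + 1)) * hst

theorem convex_signHalf (k : ℕ) (p₀ N : ℝ[X]) (σ x y : ℝ) :
    Convex ℝ {c : ℝ × ℝ | 0 < critFun k p₀ N (σ * c.1) c.2 1 x ∧
      critFun k p₀ N (σ * c.1) c.2 1 y < 0} := by
  have h1 := convex_pos_of_affine (f := fun c => critFun k p₀ N (σ * c.1) c.2 1 x)
    fun c c' s t hst => critFun_affine k p₀ N σ x c c' s t hst
  have h2 := convex_pos_of_affine (f := fun c => -critFun k p₀ N (σ * c.1) c.2 1 y)
    fun c c' s t hst => by rw [critFun_affine k p₀ N σ y c c' s t hst]; ring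
  have h3 : {c : ℝ × ℝ | 0 < critFun k p₀ N (σ * c.1) c.2 1 x ∧
      critFun k p₀ N (σ * c.1) c.2 1 y < 0} = {c | 0 < critFun k p₀ N (σ * c.1) c.2 1 x} ∩
      {c | 0 < -critFun k p₀ N (σ * c.1) c.2 1 y} := by
    ext c
    simp
  rw [h3]
  exact h1.inter h2

/-- The absolute value of χ makes the set the union of its halves χ ≥ 0 and χ ≤ 0. On each half the
inequalities are affine, so the half is convex, and the halves share the given point of the axis. -/
theorem isPreconnected_signPair (k : ℕ) (p₀ N : ℝ[X]) (l : ℕ) {x y η : ℝ}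
    (h : ((0 : ℝ), η) ∈ signPair k p₀ N l x y) : IsPreconnected (signPair k p₀ N l x y) := by
  set σ := gapSign p₀ N l
  have e : signPair k p₀ N l x y =
      ({c : ℝ × ℝ | 0 ≤ c.1} ∩ {c : ℝ × ℝ | 0 < critFun k p₀ N (σ * c.1) c.2 1 x ∧
        critFun k p₀ N (σ * c.1) c.2 1 y < 0}) ∪
      ({c : ℝ × ℝ | c.1 ≤ 0} ∩ {c : ℝ × ℝ | 0 < critFun k p₀ N (-σ * c.1) c.2 1 x ∧
        critFun k p₀ N (-σ * c.1) c.2 1 y < 0}) := by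
    ext c
    simp only [signPair, mem_union, mem_inter_iff, mem_ofPred_eq]
    rcases le_total 0 c.1 with h0 | h0
    · rw [abs_of_nonneg h0]
      refine ⟨fun h => Or.inl ⟨h0, h⟩, ?_⟩
      rintro (⟨-, h⟩ | ⟨h1, h⟩)
      · exact h
      · have : c.1 = 0 := le_antisymm h1 h0
        simpa [this] using h
    · rw [abs_of_nonpos h0, show gapSign p₀ N l * -c.1 = -σ * c.1 by ring]
      refine ⟨fun h => Or.inr ⟨h0, h⟩, ?_⟩
      rintro (⟨h1, h⟩ | ⟨-, h⟩)
      · have : c.1 = 0 := le_antisymm h0 h1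
        simpa [this] using h
      · exact h
  have h' := h
  rw [signPair] at h'
  rw [e]
  refine IsPreconnected.union ((0 : ℝ), η) ⟨le_refl (0 : ℝ), ?_⟩ ⟨le_refl (0 : ℝ), ?_⟩ ?_ ?_
  · simpa using h'
  · simpa using h'
  · refine (Convex.inter ?_ (convex_signHalf ..)).isPreconnected
    exact convex_halfSpace_ge ⟨fun _ _ => rfl, fun _ _ => rfl⟩ 0
  · refine (Convex.inter ?_ (convex_signHalf ..)).isPreconnected
    exact convex_halfSpace_le ⟨fun _ _ => rfl, fun _ _ => rfl⟩ 0

theorem axis_linear {x₀ x : ℝ} (h : x₀ < 0) :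
    (x₀ + 1) / (x₀ - 1) * (x - 1) - 1 * (x + 1) = 2 * (x - x₀) / (x₀ - 1) := by
  have : x₀ - 1 ≠ 0 := by linarith
  field_simp
  ring

theorem exists_sign_near {f : ℝ → ℝ} {f' r : ℝ} (hf : HasDerivAt f f' r) (h0 : f r = 0)
    (hf' : 0 < f') : (∀ᶠ x in 𝓝[>] r, 0 < f x) ∧ ∀ᶠ x in 𝓝[<] r, f x < 0 := by
  have h := (hasDerivAt_iff_tendsto_slope.1 hf).eventually (lt_mem_nhds hf')
  constructor
  · have h2 : 𝓝[>] r ≤ 𝓝[≠] r := nhdsWithin_mono _ fun y hy => ne_of_gt hy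
    filter_upwards [h2 h, self_mem_nhdsWithin] with x hx hxr
    simp only [slope, h0, vsub_eq_sub, sub_zero, smul_eq_mul] at hx
    exact pos_of_mul_pos_right hx (inv_pos.2 (sub_pos.2 hxr)).le
  · have h2 : 𝓝[<] r ≤ 𝓝[≠] r := nhdsWithin_mono _ fun y hy => ne_of_lt hy
    filter_upwards [h2 h, self_mem_nhdsWithin] with x hx hxr
    simp only [slope, h0, vsub_eq_sub, sub_zero, smul_eq_mul] at hx
    have h3 : (x - r)⁻¹ < 0 := inv_lt_zero.2 (sub_neg.2 hxr)
    by_contra! hge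
    exact hx.not_ge (mul_nonpos_of_nonpos_of_nonneg h3.le hge)

/-- Two simple zeros of a function force a sign change from `+` to `-`. -/
theorem exists_pos_neg_of_two_zeros {f : ℝ → ℝ} {a b r₁ r₂ d₁ d₂ : ℝ} (h₁ : r₁ ∈ Ioo a b)
    (h₂ : r₂ ∈ Ioo a b) (h12 : r₁ < r₂) (hf₁ : HasDerivAt f d₁ r₁) (hf₂ : HasDerivAt f d₂ r₂)
    (z₁ : f r₁ = 0) (z₂ : f r₂ = 0) (hd₁ : d₁ ≠ 0) (hd₂ : d₂ ≠ 0) :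
    ∃ x ∈ Ioo a b, ∃ y ∈ Ioo a b, x < y ∧ 0 < f x ∧ f y < 0 := by
  have key : ∀ r ∈ Ioo a b, ∀ d, HasDerivAt f d r → f r = 0 → d < 0 →
      ∃ x ∈ Ioo a b, ∃ y ∈ Ioo a b, x < y ∧ 0 < f x ∧ f y < 0 := by
    intro r hr d hfd hz hd
    obtain ⟨hR, hL⟩ := exists_sign_near hfd.neg (by simp [hz]) (neg_pos.2 hd)
    obtain ⟨y, hy, hyr⟩ := (hR.and (Ioo_mem_nhdsGT hr.2)).exists
    obtain ⟨x, hx, hxr⟩ := (hL.and (Ioo_mem_nhdsLT hr.1)).exists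
    simp only [Pi.neg_apply, Left.neg_pos_iff, Left.neg_neg_iff] at hy hx
    exact ⟨x, ⟨hxr.1, hxr.2.trans hr.2⟩, y, ⟨hr.1.trans hyr.1, hyr.2⟩, hxr.2.trans hyr.1, hx, hy⟩
  rcases lt_or_gt_of_ne hd₁ with h | h1
  · exact key r₁ h₁ d₁ hf₁ z₁ h
  rcases lt_or_gt_of_ne hd₂ with h | h2
  · exact key r₂ h₂ d₂ hf₂ z₂ h
  -- With both derivatives positive, the function is positive just to the right of r₁ and negative
  -- just to the left of r₂; the point m keeps the two choices in order.
  obtain ⟨hR, -⟩ := exists_sign_near hf₁ z₁ h1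
  obtain ⟨-, hL⟩ := exists_sign_near hf₂ z₂ h2
  obtain ⟨m, hm1, hm2⟩ := exists_between h12
  obtain ⟨x, hx, hxr⟩ := (hR.and (Ioo_mem_nhdsGT hm1)).exists
  obtain ⟨y, hy, hyr⟩ := (hL.and (Ioo_mem_nhdsLT hm2)).exists
  exact ⟨x, ⟨h₁.1.trans hxr.1, hxr.2.trans (hm2.trans h₂.2)⟩, y,
    ⟨(h₁.1.trans hm1).trans hyr.1, hyr.2.trans h₂.2⟩, hxr.2.trans hyr.1, hx, hy⟩

namespace GapData

variable {k : ℕ} {p₀ N : ℝ[X]} (G : GapData k p₀ N)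
include G

theorem sqrt_factor_pos {x : ℝ} (hx : 0 < p₀.eval x) : 0 < k / 2 * √(p₀.eval x) := by
  have := G.k_pos
  have := Real.sqrt_pos.2 hx
  positivity

/-- The roots of `critPoly` with `ν = 0` outside the gaps. -/
theorem exists_two_nonneg_roots {χ μ : ℝ} (hχ : χ ≠ 0) (hμ : μ ≠ 0) :
    ∃ E : Finset ℝ, E.card = 2 ∧ ∀ y ∈ E, 0 ≤ y ∧ (critPoly k p₀ N χ μ 0).eval y = 0 := by
  have hk := G.k_pos
  set Q := critPoly k p₀ N χ μ 0 with hQ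
  have h0 : 0 < Q.eval 0 := by
    have := G.divX_zero_pos
    simp [hQ, critPoly]
    positivity
  -- For ν = 0 the linear factor is μ(X-1), so only -χ²N(1)² remains at 1. The signs +, -, + at 0,
  -- at 1 and far to the right give the two roots.
  have h1 : Q.eval 1 < 0 := by
    have := G.N_one
    have h2 := G.eval_pos one_pos
    simp [hQ, critPoly, this]
    positivity
  obtain ⟨y, hy1, hy⟩ : ∃ y, 1 < y ∧ 0 < Q.eval y := by
    have hp := G.divX_natDegree
    have hN := G.N_deg
    have hlead : p₀.divX.leadingCoeff = p₀.leadingCoeff := by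
      conv_rhs => rw [← G.X_mul_divX]
      simp
    have hp1 : p₀.divX ≠ 0 := by
      intro h
      have := G.divX_zero_pos
      simp [h] at this
    set A := C ((k : ℝ) ^ 2 / 4) * (p₀.divX * (C (μ - 0) * X - C (μ + 0)) ^ 2) with hA
    set B := C (χ ^ 2) * (X * N ^ 2) with hB
    have hlin : (C (μ - 0) * X - C (μ + 0)) = C μ * (X - C 1) := by
      simp
      ring
    have hAlead : 0 < A.leadingCoeff := by
      rw [hA, hlin]
      simp only [leadingCoeff_mul, leadingCoeff_C, leadingCoeff_pow, leadingCoeff_X_sub_C, hlead]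
      have := G.lead
      positivity
    have hAne : A ≠ 0 := by
      intro h
      simp [h] at hAlead
    have hAdeg : A.natDegree = 2 * kPrime p₀ := by
      rw [hA, hlin, natDegree_C_mul (by positivity), natDegree_mul hp1
        (pow_ne_zero _ (mul_ne_zero (C_ne_zero.2 hμ) (X_sub_C_ne_zero 1))), natDegree_pow,
        natDegree_C_mul hμ, natDegree_X_sub_C]
      omega
    have hBdeg : B.natDegree < A.natDegree := by
      rw [hAdeg, hB]
      refine (natDegree_C_mul_le _ _).trans_lt (natDegree_mul_le.trans_lt ?_)
      have : (N ^ 2).natDegree ≤ 2 * N.natDegree := natDegree_pow_le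
      rw [natDegree_X]
      omega
    have hdeg := degree_lt_degree hBdeg
    have hQA : Q = A - B := rfl
    have hQl : 0 < Q.leadingCoeff := by
      rw [hQA, leadingCoeff_sub_of_degree_lt hdeg]
      exact hAlead
    have hQd : 0 < Q.degree := by
      rw [hQA, degree_sub_eq_left_of_degree_lt hdeg, degree_eq_natDegree hAne, hAdeg]
      have := G.kPrime_pos
      exact_mod_cast (show 0 < 2 * kPrime p₀ by omega)
    have ht := Q.tendsto_atTop_of_leadingCoeff_nonneg hQd hQl.le
    obtain ⟨y, hy⟩ := ((eventually_gt_atTop (1 : ℝ)).and (ht.eventually_gt_atTop 0)).exists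
    exact ⟨y, hy⟩
  obtain ⟨a, ha, ha0⟩ := exists_zero_Ioo Q.continuous one_pos (mul_neg_of_pos_of_neg h0 h1)
  obtain ⟨b, hb, hb0⟩ := exists_zero_Ioo Q.continuous hy1 (mul_neg_of_neg_of_pos h1 hy)
  refine ⟨{a, b}, Finset.card_pair (ha.2.trans hb.1).ne, ?_⟩
  intro z hz
  rw [Finset.mem_insert, Finset.mem_singleton] at hz
  rcases hz with rfl | rfl
  · exact ⟨ha.1.le, ha0⟩
  · exact ⟨(one_pos.trans hb.1).le, hb0⟩

variable {l : ℕ} (hl : 1 ≤ l) (hlk : l < kPrime p₀)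
include hl hlk

theorem gapSign_mul_right_pos : 0 < gapSign p₀ N l * N.eval (branchPoint p₀ (2 * l - 1)) := by
  have h := G.N_right_ne hl hlk
  rw [gapSign]
  split_ifs with h0
  · linarith
  · have := lt_of_le_of_ne (not_lt.1 h0) h
    linarith

/-- A sign change from `+` to `-` of `critFun` gives four critical points. -/
theorem exists_four_zeros {χ μ ν x y : ℝ} (hχ : 0 < χ * N.eval (branchPoint p₀ (2 * l - 1)))
    (hx : x ∈ gap p₀ l) (hy : y ∈ gap p₀ l) (hxy : x < y) (hfx : 0 < critFun k p₀ N χ μ ν x)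
    (hfy : critFun k p₀ N χ μ ν y < 0) :
    ∃ Z : Finset (ℝ × ℝ), Z.card = 4 ∧ ∀ z ∈ Z, IsGapZero k p₀ N χ μ ν l z := by
  have hB := G.gap_right_neg hl hlk
  have hA := (G.gap_left_lt_right hl hlk).trans hB
  have hχ0 : χ ≠ 0 := left_ne_zero_of_mul hχ.ne'
  have hχA : χ * N.eval (branchPoint p₀ (2 * l)) < 0 := by
    have h1 := G.N_sign l hl hlk
    have h2 : 0 < χ ^ 2 := by positivity
    have h3 : (χ * N.eval (branchPoint p₀ (2 * l))) * (χ * N.eval (branchPoint p₀ (2 * l - 1))) < 0 := by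
      have := mul_neg_of_pos_of_neg h2 h1
      linarith
    exact neg_of_mul_neg_left h3 hχ.le
  -- The end values are negative on the left and positive on the right, so the pattern is -, +, -,
  -- +: three zeros on this sheet. The fourth lies on the other sheet.
  have fA : critFun k p₀ N χ μ ν (branchPoint p₀ (2 * l)) < 0 := by
    rw [G.critFun_left hlk]
    have := mul_pos_of_neg_of_neg hA hχA
    linarith
  have fB : 0 < critFun k p₀ N χ μ ν (branchPoint p₀ (2 * l - 1)) := by
    rw [G.critFun_right hl hlk]
    have := mul_neg_of_neg_of_pos hB hχ
    linarith
  have hc := continuous_critFun k p₀ N χ μ ν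
  obtain ⟨r₁, h1, z1⟩ := exists_zero_Ioo hc hx.1 (mul_neg_of_neg_of_pos fA hfx)
  obtain ⟨r₂, h2, z2⟩ := exists_zero_Ioo hc hxy (mul_neg_of_pos_of_neg hfx hfy)
  obtain ⟨r₃, h3, z3⟩ := exists_zero_Ioo hc hy.2 (mul_neg_of_neg_of_pos hfy fB)
  obtain ⟨r₄, h4, z4⟩ := G.exists_gap_zero (μ := μ) (ν := ν) hl hlk (neg_ne_zero.2 hχ0)
  have h12 : r₁ < r₂ := h1.2.trans h2.1
  have h23 : r₂ < r₃ := h2.2.trans h3.1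
  refine ⟨{(1, r₁), (1, r₂), (1, r₃), (-1, r₄)}, ?_, ?_⟩
  · rw [Finset.card_insert_of_notMem, Finset.card_insert_of_notMem, Finset.card_pair]
    · intro h
      have := congrArg Prod.fst h
      norm_num at this
    · simp only [Finset.mem_insert, Finset.mem_singleton, Prod.mk.injEq, true_and]
      rintro (h | h)
      · exact h23.ne h
      · norm_num at h
    · simp only [Finset.mem_insert, Finset.mem_singleton, Prod.mk.injEq, true_and]
      rintro (h | h | h)
      · exact h12.ne h
      · exact (h12.trans h23).ne h
      · norm_num at h
  · intro z hz
    simp only [Finset.mem_insert, Finset.mem_singleton] at hz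
    rcases hz with rfl | rfl | rfl | rfl
    · exact ⟨Or.inl rfl, ⟨h1.1, h1.2.trans hx.2⟩, by simpa using z1⟩
    · exact ⟨Or.inl rfl, ⟨hx.1.trans h2.1, h2.2.trans hy.2⟩, by simpa using z2⟩
    · exact ⟨Or.inl rfl, ⟨hy.1.trans h3.1, h3.2⟩, by simpa using z3⟩
    · exact ⟨Or.inr rfl, h4, by simpa using z4⟩

/-- On the other half of the loop there is only one critical point. -/
theorem neg_zero_unique {χ μ r₁ r₂ : ℝ} (hχ : 0 < χ * N.eval (branchPoint p₀ (2 * l - 1)))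
    (h₁ : r₁ ∈ gap p₀ l) (h₂ : r₂ ∈ gap p₀ l) (h12 : r₁ < r₂)
    (z₁ : critFun k p₀ N (-χ) μ 1 r₁ = 0) (z₂ : critFun k p₀ N (-χ) μ 1 r₂ = 0) : False := by
  have hχ0 : χ ≠ 0 := left_ne_zero_of_mul hχ.ne'
  have n1 := G.gap_neg hl hlk h₁
  have n2 := G.gap_neg hl hlk h₂
  -- At a zero of the function with -χ the term χ x N can be eliminated. There the function with χ
  -- and parameters (d, 0) has the sign of (r-1)(d - b r). The parameter ν is kept free for the sake
  -- of this passage to ν = 0.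
  set b : ℝ → ℝ := fun r => (r + 1) / (r - 1) - μ with hb
  have hval : ∀ r < 0, critFun k p₀ N (-χ) μ 1 r = 0 → ∀ d,
      critFun k p₀ N χ d 0 r = k / 2 * √(p₀.eval r) * ((r - 1) * (d - b r)) := by
    intro r hr hz d
    have hr1 : r - 1 ≠ 0 := by linarith
    have e : (r - 1) * b r = (r + 1) - μ * (r - 1) := by
      rw [hb]
      field_simp
    rw [critFun] at hz ⊢
    linear_combination -hz + (k / 2 * √(p₀.eval r)) * e
  have hlt : b r₂ < b r₁ := by
    have h1 : r₁ - 1 < 0 := by linarith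
    have h2 : r₂ - 1 < 0 := by linarith
    have : b r₁ - b r₂ = 2 * (r₂ - r₁) / ((r₁ - 1) * (r₂ - 1)) := by
      rw [hb]
      field_simp [h1.ne, h2.ne]
      ring
    have h3 : 0 < 2 * (r₂ - r₁) / ((r₁ - 1) * (r₂ - 1)) :=
      div_pos (by linarith) (mul_pos_of_neg_of_neg h1 h2)
    linarith
  -- Any d between the two values of b gives the sign change from + to -; d ≠ 0 is needed for the
  -- two nonnegative roots below.
  obtain ⟨d, hd0, hd2, hd1⟩ : ∃ d, d ≠ 0 ∧ b r₂ < d ∧ d < b r₁ := by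
    obtain ⟨d, h1, h2⟩ := exists_between hlt
    by_cases h : d = 0
    · obtain ⟨d', h3, h4⟩ := exists_between h1
      exact ⟨d', by rw [h] at h4; exact h4.ne, h3, h4.trans h2⟩
    · exact ⟨d, h, h1, h2⟩
  have hf1 : 0 < critFun k p₀ N χ d 0 r₁ := by
    rw [hval r₁ n1 z₁]
    exact mul_pos (G.sqrt_factor_pos (G.eval_gap_pos hl hlk h₁))
      (mul_pos_of_neg_of_neg (by linarith) (by linarith))
  have hf2 : critFun k p₀ N χ d 0 r₂ < 0 := by
    rw [hval r₂ n2 z₂]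
    exact mul_neg_of_pos_of_neg (G.sqrt_factor_pos (G.eval_gap_pos hl hlk h₂))
      (mul_neg_of_neg_of_pos (by linarith) (by linarith))
  -- Four zeros in the gap together with two nonnegative roots exceed the bound of
  -- `card_add_le_four`.
  obtain ⟨Z, hZ4, hZ⟩ := G.exists_four_zeros hl hlk hχ h₁ h₂ h12 hf1 hf2
  obtain ⟨E, hE2, hE⟩ := G.exists_two_nonneg_roots hχ0 hd0
  have := G.card_add_le_four hl hlk hχ0 hZ hE
  omega

theorem hasDerivAt_critFun {χ μ ν x : ℝ} (hx : x ∈ gap p₀ l) :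
    HasDerivAt (critFun k p₀ N χ μ ν) (deriv (critFun k p₀ N χ μ ν) x) x := by
  apply DifferentiableAt.hasDerivAt
  have h1 := (G.eval_gap_pos hl hlk hx).ne'
  unfold critFun
  have h2 : DifferentiableAt ℝ (fun x => √(p₀.eval x)) x := p₀.differentiable.differentiableAt.sqrt h1
  have h3 : DifferentiableAt ℝ (fun x => N.eval x) x := N.differentiable.differentiableAt
  fun_prop

/-- Differentiate the identity of `mul_eval_critPoly` at x. If the function and its derivative both
vanished, the right side would have derivative 0, while the left side has derivative x Q'(x). -/
theorem deriv_critFun_ne_zero {χ μ ν x : ℝ} (hx : x ∈ gap p₀ l)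
    (h0 : critFun k p₀ N χ μ ν x = 0) (hd : (derivative (critPoly k p₀ N χ μ ν)).eval x ≠ 0) :
    deriv (critFun k p₀ N χ μ ν) x ≠ 0 := by
  intro h
  have hx0 := (G.gap_neg hl hlk hx).ne
  have h1 := G.hasDerivAt_critFun hl hlk (χ := χ) (μ := μ) (ν := ν) hx
  have h2 := G.hasDerivAt_critFun hl hlk (χ := -χ) (μ := μ) (ν := ν) hx
  have h3 := h1.mul h2
  have h4 : HasDerivAt (fun y => y * (critPoly k p₀ N χ μ ν).eval y)
      (1 * (critPoly k p₀ N χ μ ν).eval x + x * (derivative (critPoly k p₀ N χ μ ν)).eval x) x :=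
    (hasDerivAt_id x).mul ((critPoly k p₀ N χ μ ν).hasDerivAt x)
  have h5 : (critFun k p₀ N χ μ ν * critFun k p₀ N (-χ) μ ν) =ᶠ[𝓝 x]
      fun y => y * (critPoly k p₀ N χ μ ν).eval y := by
    filter_upwards [isOpen_Ioo.mem_nhds hx] with y hy
    exact (G.mul_eval_critPoly χ μ ν (G.eval_gap_pos hl hlk hy).le).symm
  have h6 := (h4.congr_of_eventuallyEq h5).unique h3
  have h7 := G.mul_eval_critPoly χ μ ν (G.eval_gap_pos hl hlk hx).le
  rw [h0, zero_mul] at h7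
  have h8 := (mul_eq_zero.1 h7).resolve_left hx0
  rw [h8, h, h0] at h6
  simp only [mul_zero, zero_mul, add_zero, zero_add, mul_eq_zero, hx0, false_or] at h6
  exact hd h6

/-- For χ = 0 the function is a positive factor times a linear function of x, which changes sign
from + to - in the gap exactly when its zero lies there. -/
theorem mem_smoothGap_axis {η : ℝ} :
    ((0 : ℝ), η) ∈ smoothGap k p₀ N l ↔ ∃ x ∈ gap p₀ l, η * (x - 1) = x + 1 := by
  have hf : ∀ x, critFun k p₀ N (gapSign p₀ N l * |(0 : ℝ)|) η 1 x =
      k / 2 * √(p₀.eval x) * (η * (x - 1) - 1 * (x + 1)) := by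
    intro x
    simp [critFun]
  rw [mem_smoothGap]
  constructor
  · rintro ⟨x, hx, y, hy, hxy, h1, h2⟩
    simp only [hf] at h1 h2
    have s1 := G.sqrt_factor_pos (G.eval_gap_pos hl hlk hx)
    have s2 := G.sqrt_factor_pos (G.eval_gap_pos hl hlk hy)
    have h1' := pos_of_mul_pos_right h1 s1.le
    have h2' := neg_of_mul_neg_right h2 s2.le
    obtain ⟨z, hz, hz0⟩ := exists_zero_Ioo (f := fun x => η * (x - 1) - 1 * (x + 1))
      (by fun_prop) hxy (mul_neg_of_pos_of_neg h1' h2')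
    exact ⟨z, ⟨hx.1.trans hz.1, hz.2.trans hy.2⟩, by linarith⟩
  · rintro ⟨x₀, hx₀, h0⟩
    have n0 := G.gap_neg hl hlk hx₀
    have hη : η = (x₀ + 1) / (x₀ - 1) := by
      rw [eq_div_iff (by linarith)]
      exact h0
    obtain ⟨x, hx1, hx2⟩ := exists_between hx₀.1
    obtain ⟨y, hy1, hy2⟩ := exists_between hx₀.2
    have hx : x ∈ gap p₀ l := ⟨hx1, hx2.trans hx₀.2⟩
    have hy : y ∈ gap p₀ l := ⟨hx₀.1.trans hy1, hy2⟩
    refine ⟨x, hx, y, hy, hx2.trans hy1, ?_, ?_⟩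
    · simp only [hf]
      refine mul_pos (G.sqrt_factor_pos (G.eval_gap_pos hl hlk hx)) ?_
      rw [hη, axis_linear n0]
      exact div_pos_of_neg_of_neg (by linarith) (by linarith)
    · simp only [hf]
      refine mul_neg_of_pos_of_neg (G.sqrt_factor_pos (G.eval_gap_pos hl hlk hy)) ?_
      rw [hη, axis_linear n0]
      exact div_neg_of_pos_of_neg (by linarith) (by linarith)

theorem smoothGap_nonempty : (smoothGap k p₀ N l).Nonempty := by
  obtain ⟨x, hx⟩ := exists_between (G.gap_left_lt_right hl hlk)
  have hx' : x ∈ gap p₀ l := hx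
  have n := G.gap_neg hl hlk hx'
  exact ⟨(0, (x + 1) / (x - 1)), (G.mem_smoothGap_axis hl hlk).2
    ⟨x, hx', div_mul_cancel₀ _ (by linarith)⟩⟩

/-- Each pair set meets the axis segment, the continuous image of the gap under x ↦ (x+1)/(x-1): any
m between x and y gives a common point. So every point is joined to a fixed point of the segment. -/
theorem isPreconnected_smoothGap : IsPreconnected (smoothGap k p₀ N l) := by
  set S : Set (ℝ × ℝ) := (fun x : ℝ => ((0 : ℝ), (x + 1) / (x - 1))) '' gap p₀ l with hS
  have hSc : IsPreconnected S := by
    refine isPreconnected_Ioo.image _ fun x hx => ?_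
    have n := G.gap_neg hl hlk hx
    have : x - 1 ≠ 0 := by linarith
    refine ContinuousAt.continuousWithinAt ?_
    fun_prop (disch := assumption)
  have hSsub : S ⊆ smoothGap k p₀ N l := by
    rintro _ ⟨x, hx, rfl⟩
    have n := G.gap_neg hl hlk hx
    exact (G.mem_smoothGap_axis hl hlk).2 ⟨x, hx, div_mul_cancel₀ _ (by linarith)⟩
  obtain ⟨x₀, hx₀⟩ := exists_between (G.gap_left_lt_right hl hlk)
  refine isPreconnected_of_forall ((0 : ℝ), (x₀ + 1) / (x₀ - 1)) fun c hc => ?_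
  obtain ⟨x, hx, y, hy, hxy, hcV⟩ := mem_smoothGap.1 hc
  have hVsub : signPair k p₀ N l x y ⊆ smoothGap k p₀ N l := fun c hc =>
    mem_smoothGap.2 ⟨x, hx, y, hy, hxy, hc⟩
  obtain ⟨m, hm1, hm2⟩ := exists_between hxy
  have hm : m ∈ gap p₀ l := ⟨hx.1.trans hm1, hm2.trans hy.2⟩
  have n := G.gap_neg hl hlk hm
  have hmV : ((0 : ℝ), (m + 1) / (m - 1)) ∈ signPair k p₀ N l x y := by
    have hf : ∀ x, critFun k p₀ N (gapSign p₀ N l * |(0 : ℝ)|) ((m + 1) / (m - 1)) 1 x =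
        k / 2 * √(p₀.eval x) * (2 * (x - m) / (m - 1)) := by
      intro x
      rw [← axis_linear n]
      simp [critFun]
    simp only [signPair, mem_ofPred_eq, hf]
    exact ⟨mul_pos (G.sqrt_factor_pos (G.eval_gap_pos hl hlk hx))
      (div_pos_of_neg_of_neg (by linarith) (by linarith)),
      mul_neg_of_pos_of_neg (G.sqrt_factor_pos (G.eval_gap_pos hl hlk hy))
      (div_neg_of_pos_of_neg (by linarith) (by linarith))⟩
  refine ⟨signPair k p₀ N l x y ∪ S, union_subset hVsub hSsub, Or.inr ⟨x₀, hx₀, rfl⟩,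
    Or.inl hcV, ?_⟩
  exact IsPreconnected.union _ hmV ⟨m, hm, rfl⟩ (isPreconnected_signPair k p₀ N l hmV) hSc

omit hl hlk in
theorem gapSign_mul_abs_pos (hl : 1 ≤ l) (hlk : l < kPrime p₀) {χ : ℝ} (hχ : χ ≠ 0) :
    0 < gapSign p₀ N l * |χ| * N.eval (branchPoint p₀ (2 * l - 1)) := by
  have := mul_pos (abs_pos.2 hχ) (G.gapSign_mul_right_pos hl hlk)
  linarith

/-- Off the axis `χ = 0`, the points of `smoothGap` are those with four critical points. -/
theorem mem_smoothGap_iff {c : ℝ × ℝ} (hc : c.1 ≠ 0) : c ∈ smoothGap k p₀ N l ↔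
    ∃ Z : Finset (ℝ × ℝ), Z.card = 4 ∧
      ∀ z ∈ Z, IsGapZero k p₀ N (gapSign p₀ N l * |c.1|) c.2 1 l z := by
  have hpos := G.gapSign_mul_abs_pos hl hlk hc
  set χ := gapSign p₀ N l * |c.1| with hχ
  have hχ0 : χ ≠ 0 := left_ne_zero_of_mul hpos.ne'
  constructor
  · intro h
    obtain ⟨x, hx, y, hy, hxy, h1, h2⟩ := mem_smoothGap.1 h
    exact G.exists_four_zeros hl hlk hpos hx hy hxy h1 h2
  · rintro ⟨Z, hZ4, hZ⟩
    classical
    -- `Zm` collects the zeros whose abscissa is a zero for -χ. By `neg_zero_unique` there is one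
    -- such abscissa at most, hence at most two elements. At least two zeros remain; they lie on the
    -- sheet of χ and are simple, since all four extra roots are used.
    set Zm := Z.filter fun z => critFun k p₀ N (-χ) c.2 1 z.2 = 0 with hZm
    set Zp := Z.filter fun z => ¬ critFun k p₀ N (-χ) c.2 1 z.2 = 0 with hZp
    have hsame : ∀ z ∈ Zm, ∀ z' ∈ Zm, z.2 = z'.2 := by
      intro z hz z' hz'
      obtain ⟨hz1, hz2⟩ := Finset.mem_filter.1 hz
      obtain ⟨hz1', hz2'⟩ := Finset.mem_filter.1 hz'
      rcases lt_trichotomy z.2 z'.2 with h | h | h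
      · exact (G.neg_zero_unique hl hlk hpos (hZ z hz1).2.1 (hZ z' hz1').2.1 h hz2 hz2').elim
      · exact h
      · exact (G.neg_zero_unique hl hlk hpos (hZ z' hz1').2.1 (hZ z hz1).2.1 h hz2' hz2).elim
    have hZm2 : Zm.card ≤ 2 := by
      rcases Zm.eq_empty_or_nonempty with h0 | ⟨z, hz⟩
      · simp [h0]
      have hsub : Zm ⊆ {((1 : ℝ), z.2), ((-1 : ℝ), z.2)} := by
        intro y hy
        have h1 := hsame y hy z hz
        obtain ⟨y1, y2⟩ := y
        simp only at h1
        subst h1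
        rcases (hZ _ (Finset.mem_filter.1 hy).1).1 with h | h
        · simp only at h
          simp [h]
        · simp only at h
          simp [h]
      exact (Finset.card_le_card hsub).trans Finset.card_le_two
    have hsum : Zm.card + Zp.card = Z.card := Finset.card_filter_add_card_filter_not _
    obtain ⟨a, ha, b, hb, hab⟩ := Finset.one_lt_card.1 (show 1 < Zp.card by omega)
    have hone : ∀ z ∈ Zp, z ∈ Z ∧ z = (1, z.2) ∧ critFun k p₀ N (-χ) c.2 1 z.2 ≠ 0 := by
      intro z hz
      obtain ⟨hzZ, hz0⟩ := Finset.mem_filter.1 hz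
      refine ⟨hzZ, ?_, hz0⟩
      obtain ⟨z1, z2⟩ := z
      rcases (hZ _ hzZ).1 with h | h
      · simp only at h
        rw [h]
      · have := (hZ _ hzZ).2.2
        simp only at h this hz0
        rw [h, neg_one_mul] at this
        exact absurd this hz0
    have hsimple : ∀ z ∈ Zp, z.2 ∈ gap p₀ l ∧ critFun k p₀ N χ c.2 1 z.2 = 0 ∧
        deriv (critFun k p₀ N χ c.2 1) z.2 ≠ 0 := by
      intro z hz
      obtain ⟨hzZ, hz1, hz0⟩ := hone z hz
      have h1 := hZ z hzZ
      have h2 := h1.2.2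
      rw [hz1, one_mul] at h2
      rw [hz1] at hzZ
      exact ⟨h1.2.1, h2, G.deriv_critFun_ne_zero hl hlk h1.2.1 h2
        (G.derivative_critPoly_ne_zero hl hlk hχ0 hZ hZ4.ge hzZ hz0)⟩
    have hne : a.2 ≠ b.2 := by
      intro h
      apply hab
      rw [(hone a ha).2.1, (hone b hb).2.1, h]
    obtain ⟨ga, za, da⟩ := hsimple a ha
    obtain ⟨gb, zb, db⟩ := hsimple b hb
    have fin : ∃ x ∈ gap p₀ l, ∃ y ∈ gap p₀ l, x < y ∧
        0 < critFun k p₀ N χ c.2 1 x ∧ critFun k p₀ N χ c.2 1 y < 0 := by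
      rcases lt_or_gt_of_ne hne with h | h
      · exact exists_pos_neg_of_two_zeros ga gb h (G.hasDerivAt_critFun hl hlk ga)
          (G.hasDerivAt_critFun hl hlk gb) za zb da db
      · exact exists_pos_neg_of_two_zeros gb ga h (G.hasDerivAt_critFun hl hlk gb)
          (G.hasDerivAt_critFun hl hlk ga) zb za db da
    obtain ⟨x, hx, y, hy, hxy, h1, h2⟩ := fin
    exact mem_smoothGap.2 ⟨x, hx, y, hy, hxy, h1, h2⟩

/-- Off the axis, four gap zeros leave no root of Q = `critPoly` on [0,∞), and η = 1 is excluded by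
the drop of degree, η = -1 by Q(0) = 0. Then Q > 0 on [0,∞). At 1 this reads k²p₀(1)(1-χ²) > 0. At y
= (η+1)/(η-1) the square vanishes, so Q(y) would be nonpositive if y were positive; hence |η| < 1.
-/
theorem smoothGap_subset {c : ℝ × ℝ} (hc : c ∈ smoothGap k p₀ N l) :
    c.1 ∈ Ioo (-1 : ℝ) 1 ∧ c.2 ∈ Ioo (-1 : ℝ) 1 := by
  by_cases h0 : c.1 = 0
  · have h1 : c = (0, c.2) := Prod.ext h0 rfl
    rw [h1, G.mem_smoothGap_axis hl hlk] at hc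
    obtain ⟨x, hx, hx'⟩ := hc
    have n := G.gap_neg hl hlk hx
    rw [h0]
    refine ⟨by norm_num, ?_, ?_⟩ <;> nlinarith
  obtain ⟨Z, hZ4, hZ⟩ := (G.mem_smoothGap_iff hl hlk h0).1 hc
  have hpos := G.gapSign_mul_abs_pos hl hlk h0
  set χ := gapSign p₀ N l * |c.1| with hχ
  have hχ0 : χ ≠ 0 := left_ne_zero_of_mul hpos.ne'
  have hχ2 : χ ^ 2 = c.1 ^ 2 := by
    rw [← sq_abs, hχ, abs_mul, abs_gapSign, one_mul, abs_abs, sq_abs]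
  set Q := critPoly k p₀ N χ c.2 1 with hQ
  have noroot : ∀ y, 0 ≤ y → Q.eval y ≠ 0 := by
    intro y hy h
    have := G.card_add_le_four (E := {y}) hl hlk hχ0 hZ (by simpa using ⟨hy, h⟩)
    rw [Finset.card_singleton] at this
    omega
  have hk := G.k_pos
  have hη1 : c.2 ≠ 1 := by
    intro h
    rw [h] at hZ
    have := G.card_le_three_of_eq hl hlk hχ0 hZ
    omega
  have hQ0 : Q.eval 0 = (k : ℝ) ^ 2 / 4 * (p₀.divX.eval 0 * (c.2 + 1) ^ 2) := by
    simp only [hQ, critPoly, eval_sub, eval_mul, eval_C, eval_pow, eval_X]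
    ring
  have hηm : c.2 + 1 ≠ 0 := by
    intro h
    exact noroot 0 le_rfl (by rw [hQ0, h]; simp)
  have hQ0pos : 0 < Q.eval 0 := by
    have := G.divX_zero_pos
    rw [hQ0]
    positivity
  have hpos : ∀ y, 0 < y → 0 < Q.eval y := by
    intro y hy
    by_contra! hle
    have := lt_of_le_of_ne hle (noroot y hy.le)
    obtain ⟨z, hz, hz0⟩ := exists_zero_Ioo Q.continuous hy (mul_neg_of_pos_of_neg hQ0pos this)
    exact noroot z hz.1.le hz0
  have hQ1 : Q.eval 1 = (k : ℝ) ^ 2 * p₀.eval 1 * (1 - c.1 ^ 2) := by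
    have h1 := G.eval_divX 1
    have h2 := G.N_one
    rw [one_mul] at h1
    simp only [hQ, critPoly, eval_sub, eval_mul, eval_C, eval_pow, eval_X, h1, hχ2]
    linear_combination -c.1 ^ 2 * h2
  constructor
  · have h1 := hpos 1 one_pos
    have h2 := G.eval_pos one_pos
    rw [hQ1] at h1
    have h3 := pos_of_mul_pos_right h1 (by positivity)
    exact abs_lt.1 ((sq_lt_one_iff_abs_lt_one _).1 (by linarith))
  · by_contra hno
    have hgt : 0 < (c.2 + 1) / (c.2 - 1) := by
      rcases lt_or_gt_of_ne hη1 with h | h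
      · have : c.2 + 1 < 0 := by
          by_contra! h'
          exact hno ⟨by linarith [lt_of_le_of_ne h' hηm.symm], h⟩
        exact div_pos_of_neg_of_neg this (by linarith)
      · exact div_pos (by linarith) (by linarith)
    have h1 := hpos _ hgt
    have h2 : (c.2 - 1) * ((c.2 + 1) / (c.2 - 1)) - (c.2 + 1) = 0 := by
      rw [mul_div_cancel₀ _ (sub_ne_zero.2 hη1), sub_self]
    rw [hQ, critPoly] at h1
    simp only [eval_sub, eval_mul, eval_C, eval_pow, eval_X, h2] at h1
    have h3 : 0 ≤ χ ^ 2 * ((c.2 + 1) / (c.2 - 1) * N.eval ((c.2 + 1) / (c.2 - 1)) ^ 2) := by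
      positivity
    norm_num at h1
    linarith

omit G hl hlk in
theorem isGapZero_neg {χ μ ν : ℝ} {z : ℝ × ℝ} (h : IsGapZero k p₀ N χ μ ν l z) :
    IsGapZero k p₀ N (-χ) μ ν l (-z.1, z.2) := by
  refine ⟨?_, h.2.1, by simpa using h.2.2⟩
  rcases h.1 with h | h <;> simp [h]

omit G hl hlk in
theorem exists_zeros_neg {χ μ ν : ℝ} {n : ℕ}
    (h : ∃ Z : Finset (ℝ × ℝ), Z.card = n ∧ ∀ z ∈ Z, IsGapZero k p₀ N χ μ ν l z) :
    ∃ Z : Finset (ℝ × ℝ), Z.card = n ∧ ∀ z ∈ Z, IsGapZero k p₀ N (-χ) μ ν l z := by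
  obtain ⟨Z, hn, hZ⟩ := h
  refine ⟨Z.image fun z => (-z.1, z.2), ?_, ?_⟩
  · rw [Finset.card_image_of_injective _ fun a b h => ?_, hn]
    simpa [Prod.ext_iff] using h
  · intro z hz
    obtain ⟨y, hy, rfl⟩ := Finset.mem_image.1 hz
    exact isGapZero_neg (hZ y hy)

/-- Exchanging the two sheets turns χ into -χ, so the sign normalisation can be dropped. -/
theorem mem_smoothGap_iff' {c : ℝ × ℝ} (hc : c.1 ≠ 0) : c ∈ smoothGap k p₀ N l ↔
    ∃ Z : Finset (ℝ × ℝ), Z.card = 4 ∧ ∀ z ∈ Z, IsGapZero k p₀ N c.1 c.2 1 l z := by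
  rw [G.mem_smoothGap_iff hl hlk hc]
  have h : gapSign p₀ N l * |c.1| = c.1 ∨ gapSign p₀ N l * |c.1| = -c.1 := by
    rcases gapSign_cases p₀ N l with h | h <;> rcases abs_choice c.1 with h' | h' <;> simp [h, h']
  rcases h with h | h
  · rw [h]
  · rw [h]
    exact ⟨fun h => by simpa using exists_zeros_neg h, exists_zeros_neg⟩

/-- Off the axis two gaps cannot hold four zeros each. On the axis η determines x, and the gaps are
disjoint. -/
theorem disjoint_smoothGap {l' : ℕ} (hl' : 1 ≤ l') (hlk' : l' < kPrime p₀) (hll : l ≠ l') :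
    Disjoint (smoothGap k p₀ N l) (smoothGap k p₀ N l') := by
  rw [Set.disjoint_left]
  intro c h h'
  by_cases h0 : c.1 = 0
  · have h1 : c = (0, c.2) := Prod.ext h0 rfl
    rw [h1, G.mem_smoothGap_axis hl hlk] at h
    rw [h1, G.mem_smoothGap_axis hl' hlk'] at h'
    obtain ⟨x, hx, hx'⟩ := h
    obtain ⟨y, hy, hy'⟩ := h'
    have : x = y := by
      have h2 : (c.2 - 1) * (x - y) = 0 := by linarith
      rcases mul_eq_zero.1 h2 with h3 | h3
      · have : c.2 = 1 := by linarith
        rw [this] at hx'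
        linarith
      · linarith
    subst this
    exact hll (G.gap_unique hlk hlk' hx hy)
  · obtain ⟨Z, hZ4, hZ⟩ := (G.mem_smoothGap_iff' hl hlk h0).1 h
    obtain ⟨Z', hZ4', hZ'⟩ := (G.mem_smoothGap_iff' hl' hlk' h0).1 h'
    have := G.card_add_card_le hl hlk hl' hlk' hll h0 hZ hZ'
    omega

end GapData
end AztecDiamond

namespace AztecDiamond

/-! ### Holomorphic charts -/

section Charts

variable {p₀ : ℝ[X]}

theorem exists_affine_point (p₀ : ℝ[X]) (z : ℂ) : ∃ w : ℂ, w ^ 2 = aeval z p₀ :=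
  IsAlgClosed.exists_pow_nat_eq _ two_pos

instance : Nonempty (AffineCurve p₀) :=
  ⟨⟨(0, (exists_affine_point p₀ 0).choose), (exists_affine_point p₀ 0).choose_spec⟩⟩

open Classical in
/-- The point `(z, w)` of the affine curve, if it lies on it. -/
noncomputable def curvePoint (p₀ : ℝ[X]) (z w : ℂ) : AffineCurve p₀ :=
  if h : w ^ 2 = aeval z p₀ then ⟨(z, w), h⟩ else Classical.arbitrary _

theorem curvePoint_val {z w : ℂ} (h : w ^ 2 = aeval z p₀) : (curvePoint p₀ z w).1 = (z, w) := by
  rw [curvePoint, dif_pos h]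

@[simp]
theorem zCoord_coe (a : AffineCurve p₀) : zCoord (a : Surface p₀) = a.1.1 := rfl

@[simp]
theorem wCoord_coe (a : AffineCurve p₀) : wCoord (a : Surface p₀) = a.1.2 := rfl

theorem coord_relation {P : Surface p₀} (hP : P ≠ ∞) : wCoord P ^ 2 = aeval (zCoord P) p₀ := by
  obtain ⟨a, rfl⟩ := OnePoint.ne_infty_iff_exists.1 hP
  exact a.2

theorem surface_ext {P Q : Surface p₀} (hP : P ≠ ∞) (hQ : Q ≠ ∞) (hz : zCoord P = zCoord Q)
    (hw : wCoord P = wCoord Q) : P = Q := by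
  obtain ⟨a, rfl⟩ := OnePoint.ne_infty_iff_exists.1 hP
  obtain ⟨b, rfl⟩ := OnePoint.ne_infty_iff_exists.1 hQ
  congr 1
  exact Subtype.ext (Prod.ext hz hw)

/-- The data of a holomorphic chart of the affine curve. -/
theorem exists_affine_chart {f : AffineCurve p₀ → ℂ} {S : Set (AffineCurve p₀)} (hS : IsOpen S)
    (hf : ContinuousOn f S) {T : Set ℂ} (hT : IsOpen T) {Z W : ℂ → ℂ}
    (hZ : ∀ t ∈ T, AnalyticAt ℂ Z t) (hW : ∀ t ∈ T, AnalyticAt ℂ W t)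
    (hrel : ∀ t ∈ T, W t ^ 2 = aeval (Z t) p₀)
    (hST : ∀ a ∈ S, f a ∈ T ∧ Z (f a) = a.1.1 ∧ W (f a) = a.1.2)
    (hTS : ∀ t ∈ T, curvePoint p₀ (Z t) (W t) ∈ S ∧ f (curvePoint p₀ (Z t) (W t)) = t)
    (hreg : ∀ t ∈ T, deriv Z t ≠ 0 ∨ deriv W t ≠ 0) :
    ∃ e : OpenPartialHomeomorph (Surface p₀) ℂ, IsHolomorphicChart e ∧
      e.source = (fun a : AffineCurve p₀ => (a : Surface p₀)) '' S ∧ e.target = T ∧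
      (∀ a ∈ S, e (a : Surface p₀) = f a) ∧
      ∀ t ∈ T, e.symm t ≠ ∞ ∧ zCoord (e.symm t) = Z t ∧ wCoord (e.symm t) = W t := by
  let e₀ : OpenPartialHomeomorph (AffineCurve p₀) ℂ :=
    { toFun := f
      invFun := fun t => curvePoint p₀ (Z t) (W t)
      source := S
      target := T
      map_source' := fun a ha => (hST a ha).1
      map_target' := fun t ht => (hTS t ht).1
      left_inv' := by
        intro a ha
        obtain ⟨h1, h2, h3⟩ := hST a ha
        apply Subtype.ext
        rw [curvePoint_val (hrel _ h1), h2, h3]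
      right_inv' := fun t ht => (hTS t ht).2
      open_source := hS
      open_target := hT
      continuousOn_toFun := hf
      continuousOn_invFun := by
        refine Topology.IsInducing.subtypeVal.continuousOn_iff.2 ?_
        refine ContinuousOn.congr (f := fun t => (Z t, W t)) ?_ fun t ht => curvePoint_val (hrel t ht)
        exact ContinuousOn.prodMk (fun t ht => (hZ t ht).continuousAt.continuousWithinAt)
          fun t ht => (hW t ht).continuousAt.continuousWithinAt }
  set e := e₀.lift_openEmbedding (OnePoint.isOpenEmbedding_coe (X := AffineCurve p₀)) with he
  have hsymm : ∀ t, e.symm t = ((curvePoint p₀ (Z t) (W t) : AffineCurve p₀) : Surface p₀) :=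
    fun t => rfl
  have hzc : ∀ t ∈ T, zCoord (e.symm t) = Z t := fun t ht => by
    rw [hsymm, zCoord_coe, curvePoint_val (hrel t ht)]
  have hwc : ∀ t ∈ T, wCoord (e.symm t) = W t := fun t ht => by
    rw [hsymm, wCoord_coe, curvePoint_val (hrel t ht)]
  have hzE : ∀ t ∈ T, (fun s => zCoord (e.symm s)) =ᶠ[𝓝 t] Z := fun t ht => by
    filter_upwards [hT.mem_nhds ht] with s hs using hzc s hs
  have hwE : ∀ t ∈ T, (fun s => wCoord (e.symm s)) =ᶠ[𝓝 t] W := fun t ht => by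
    filter_upwards [hT.mem_nhds ht] with s hs using hwc s hs
  refine ⟨e, ⟨fun t ht _ => (hZ t ht).congr (hzE t ht).symm,
    fun t ht _ => (hW t ht).congr (hwE t ht).symm, fun t ht _ => ?_,
    fun t _ h => absurd h (by rw [hsymm]; exact OnePoint.coe_ne_infty _),
    fun t _ h => absurd h (by rw [hsymm]; exact OnePoint.coe_ne_infty _)⟩, rfl, rfl,
    fun a ha => OpenPartialHomeomorph.lift_openEmbedding_apply _ _,
    fun t ht => ⟨OnePoint.coe_ne_infty _, hzc t ht, hwc t ht⟩⟩
  rw [(hzE t ht).deriv_eq, (hwE t ht).deriv_eq]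
  exact hreg t ht

theorem analyticAt_aeval_curve (P : ℝ[X]) (z : ℂ) : AnalyticAt ℂ (fun z : ℂ => aeval z P) z :=
  analyticAt_id.aeval_polynomial P

theorem hasDerivAt_aeval_curve (P : ℝ[X]) (z : ℂ) :
    HasDerivAt (fun z : ℂ => aeval z P) (aeval z (derivative P)) z :=
  P.hasDerivAt_aeval z

/-- The square root `exp (log z / 2)`. -/
noncomputable def halfPow (z : ℂ) : ℂ := Complex.exp (Complex.log z / 2)

theorem halfPow_sq {z : ℂ} (hz : z ≠ 0) : halfPow z ^ 2 = z := by
  rw [halfPow, ← Complex.exp_nat_mul]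
  push_cast
  rw [mul_div_cancel₀ _ (two_ne_zero' ℂ), Complex.exp_log hz]

theorem halfPow_ne_zero (z : ℂ) : halfPow z ≠ 0 := Complex.exp_ne_zero _

theorem halfPow_re_pos {z : ℂ} (hz : z ∈ Complex.slitPlane) : 0 < (halfPow z).re := by
  rw [halfPow, Complex.exp_re]
  refine mul_pos (Real.exp_pos _) (Real.cos_pos_of_mem_Ioo ?_)
  have h1 := Complex.neg_pi_lt_log_im z
  have h2 : (Complex.log z).im < Real.pi := by
    rw [Complex.log_im]
    exact lt_of_le_of_ne (Complex.arg_le_pi z) (Complex.mem_slitPlane_iff_arg.1 hz).1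
  have e : (Complex.log z / 2).im = (Complex.log z).im / 2 := by simp
  rw [e]
  constructor <;> linarith

theorem analyticAt_halfPow {z : ℂ} (hz : z ∈ Complex.slitPlane) : AnalyticAt ℂ halfPow z :=
  ((analyticAt_clog hz).div_const).cexp

theorem eq_of_sq_eq_of_re_pos {u v : ℂ} (h : u ^ 2 = v ^ 2) (hu : 0 < u.re) (hv : 0 < v.re) :
    u = v := by
  rcases sq_eq_sq_iff_eq_or_eq_neg.1 h with h | h
  · exact h
  · rw [h, Complex.neg_re] at hu
    linarith

/-- Away from the branch points, `z` is a holomorphic coordinate. -/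
theorem exists_sheet_chart (a : AffineCurve p₀) (ha : a.1.2 ≠ 0) :
    ∃ e : OpenPartialHomeomorph (Surface p₀) ℂ, IsHolomorphicChart e ∧ (a : Surface p₀) ∈ e.source ∧
      (∀ P ∈ e.source, e P = zCoord P) ∧
      ∀ t ∈ e.target, e.symm t ≠ ∞ ∧ zCoord (e.symm t) = t ∧ wCoord (e.symm t) ≠ 0 := by
  obtain ⟨⟨z₀, w₀⟩, hrel₀⟩ := a
  simp only at ha hrel₀
  have hP0 : aeval z₀ p₀ ≠ 0 := by
    rw [← hrel₀]
    exact pow_ne_zero 2 ha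
  -- The quotient is 1 at z₀, so the principal square root is available nearby and w = w₀√F. The
  -- condition Re(w/w₀) > 0 selects the sheet of the given point.
  set F : ℂ → ℂ := fun z => aeval z p₀ / aeval z₀ p₀ with hF
  have hFa : ∀ z, AnalyticAt ℂ F z := fun z => (analyticAt_aeval_curve p₀ z).div_const
  have hFc : Continuous F := continuous_iff_continuousAt.2 fun z => (hFa z).continuousAt
  set T : Set ℂ := F ⁻¹' Complex.slitPlane with hT
  have hTo : IsOpen T := Complex.isOpen_slitPlane.preimage hFc
  set W : ℂ → ℂ := fun z => w₀ * halfPow (F z) with hW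
  have hWsq : ∀ z ∈ T, W z ^ 2 = aeval z p₀ := by
    intro z hz
    rw [hW]
    simp only
    rw [mul_pow, halfPow_sq (Complex.slitPlane_ne_zero hz), hrel₀, hF]
    field_simp
  have hWa : ∀ z ∈ T, AnalyticAt ℂ W z := fun z hz =>
    analyticAt_const.mul ((analyticAt_halfPow hz).fun_comp (hFa z))
  set S : Set (AffineCurve p₀) := {b | b.1.1 ∈ T ∧ 0 < (b.1.2 / w₀).re} with hS
  have hc1 : Continuous fun b : AffineCurve p₀ => b.1.1 := by fun_prop
  have hc2 : Continuous fun b : AffineCurve p₀ => (b.1.2 / w₀).re := by fun_prop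
  have hSo : IsOpen S := (hTo.preimage hc1).inter (isOpen_lt continuous_const hc2)
  have hST : ∀ b ∈ S, b.1.1 ∈ T ∧ b.1.1 = b.1.1 ∧ W b.1.1 = b.1.2 := by
    rintro b ⟨hb1, hb2⟩
    refine ⟨hb1, rfl, ?_⟩
    have h1 : halfPow (F b.1.1) = b.1.2 / w₀ := by
      refine eq_of_sq_eq_of_re_pos ?_ (halfPow_re_pos hb1) hb2
      rw [halfPow_sq (Complex.slitPlane_ne_zero hb1), div_pow, b.2, hrel₀]
    rw [hW]
    simp only
    rw [h1, mul_div_cancel₀ _ ha]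
  obtain ⟨e, he, hes, het, hef, hesymm⟩ := exists_affine_chart (p₀ := p₀) (f := fun b => b.1.1)
    (S := S) hSo hc1.continuousOn hTo (Z := fun z => z) (W := W) (fun t _ => analyticAt_id) hWa
    hWsq hST
    (fun t ht => by
      rw [hS]
      simp only [mem_ofPred_eq, curvePoint_val (hWsq t ht)]
      refine ⟨⟨ht, ?_⟩, trivial⟩
      rw [hW]
      simp only
      rw [mul_div_cancel_left₀ _ ha]
      exact halfPow_re_pos ht)
    (fun t _ => Or.inl (by simp))
  refine ⟨e, he, ?_, ?_, ?_⟩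
  · rw [hes]
    refine ⟨_, ⟨?_, ?_⟩, rfl⟩
    · change F z₀ ∈ Complex.slitPlane
      rw [hF]
      simp only
      rw [div_self hP0]
      exact Complex.one_mem_slitPlane
    · simp [ha]
  · intro P hP
    rw [hes] at hP
    obtain ⟨b, hb, rfl⟩ := hP
    exact hef b hb
  · intro t ht
    rw [het] at ht
    obtain ⟨h1, h2, h3⟩ := hesymm t ht
    refine ⟨h1, h2, ?_⟩
    rw [h3]
    exact mul_ne_zero ha (halfPow_ne_zero _)

/-- At a branch point, `w` is a holomorphic coordinate. -/
theorem exists_branch_chart {z₀ : ℂ} (h0 : aeval z₀ p₀ = 0) (hd : aeval z₀ (derivative p₀) ≠ 0) :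
    ∃ e : OpenPartialHomeomorph (Surface p₀) ℂ, IsHolomorphicChart e ∧
      ((⟨(z₀, 0), by simp [h0]⟩ : AffineCurve p₀) : Surface p₀) ∈ e.source ∧
      (∀ P ∈ e.source, e P = wCoord P) ∧
      (∀ t ∈ e.target, e.symm t ≠ ∞ ∧ wCoord (e.symm t) = t) ∧
      ∃ V ∈ 𝓝 z₀, ∀ a : AffineCurve p₀, a.1.1 ∈ V → (a : Surface p₀) ∈ e.source := by
  have hstrict : HasStrictDerivAt (fun z : ℂ => aeval z p₀) (aeval z₀ (derivative p₀)) z₀ := by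
    have := (analyticAt_aeval_curve p₀ z₀).hasStrictDerivAt
    rwa [(hasDerivAt_aeval_curve p₀ z₀).deriv] at this
  have hdc : Continuous fun z : ℂ => aeval z (derivative p₀) := (derivative p₀).continuous_aeval
  -- Here p₀ is a local coordinate, restricted to p₀' ≠ 0 so that its inverse is holomorphic on the
  -- whole target. The chart is w, with z recovered as φ⁻¹(w²).
  set φ := ((hstrict.hasStrictFDerivAt_equiv hd).toOpenPartialHomeomorph _).restrOpen
    {z | aeval z (derivative p₀) ≠ 0} (isOpen_ne_fun hdc continuous_const) with hφ
  have hφc : ∀ z, φ z = aeval z p₀ := fun z => rfl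
  have hφz : z₀ ∈ φ.source :=
    ⟨(hstrict.hasStrictFDerivAt_equiv hd).mem_toOpenPartialHomeomorph_source, hd⟩
  have hφd : ∀ z ∈ φ.source, aeval z (derivative p₀) ≠ 0 := fun z hz => hz.2
  have hsymm_d : ∀ y ∈ φ.target,
      HasDerivAt φ.symm (aeval (φ.symm y) (derivative p₀))⁻¹ y := fun y hy =>
    φ.hasDerivAt_symm hy (hφd _ (φ.map_target hy)) (hasDerivAt_aeval_curve p₀ _)
  have hsymm_a : ∀ y ∈ φ.target, AnalyticAt ℂ φ.symm y := fun y hy =>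
    (DifferentiableOn.analyticOnNhd (fun y hy => (hsymm_d y hy).differentiableAt.differentiableWithinAt)
      φ.open_target) y hy
  set T : Set ℂ := (fun t : ℂ => t ^ 2) ⁻¹' φ.target with hT
  have hTo : IsOpen T := φ.open_target.preimage (by fun_prop)
  set Z : ℂ → ℂ := fun t => φ.symm (t ^ 2) with hZ
  have hZa : ∀ t ∈ T, AnalyticAt ℂ Z t := fun t ht =>
    (hsymm_a _ ht).fun_comp (f := fun t : ℂ => t ^ 2) (analyticAt_id.pow 2)
  have hrel : ∀ t ∈ T, t ^ 2 = aeval (Z t) p₀ := fun t ht => (φ.right_inv ht).symm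
  set S : Set (AffineCurve p₀) := {b | b.1.1 ∈ φ.source} with hS
  have hSo : IsOpen S := φ.open_source.preimage (by fun_prop)
  obtain ⟨e, he, hes, het, hef, hesymm⟩ := exists_affine_chart (p₀ := p₀) (f := fun b => b.1.2)
    (S := S) hSo (Continuous.continuousOn (by fun_prop)) hTo (Z := Z) (W := fun t => t) hZa
    (fun t _ => analyticAt_id) hrel
    (fun b hb => by
      have h1 : b.1.2 ^ 2 = φ b.1.1 := b.2
      refine ⟨?_, ?_, rfl⟩
      · rw [hT, mem_preimage, h1]
        exact φ.map_source hb
      · rw [hZ]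
        simp only
        rw [h1, φ.left_inv hb])
    (fun t ht => by
      rw [hS]
      simp only [mem_ofPred_eq, curvePoint_val (hrel t ht)]
      exact ⟨φ.map_target ht, trivial⟩)
    (fun t _ => Or.inr (by simp))
  refine ⟨e, he, ?_, ?_, ?_, φ.source, φ.open_source.mem_nhds hφz, ?_⟩
  · rw [hes]
    exact ⟨_, hφz, rfl⟩
  · intro P hP
    rw [hes] at hP
    obtain ⟨b, hb, rfl⟩ := hP
    exact hef b hb
  · intro t ht
    rw [het] at ht
    obtain ⟨h1, h2, h3⟩ := hesymm t ht
    exact ⟨h1, h3⟩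
  · intro b hb
    rw [hes]
    exact ⟨b, hb, rfl⟩

end Charts
end AztecDiamond

namespace AztecDiamond

/-! ### The chart at infinity -/

section Infinity

variable {p₀ : ℝ[X]}

theorem aeval_reverse_eq (p₀ : ℝ[X]) {z : ℂ} (hz : z ≠ 0) :
    aeval z⁻¹ p₀.reverse * z ^ p₀.natDegree = aeval z p₀ := by
  let _ := invertibleOfNonzero hz
  have := eval₂_reverse_mul_pow (algebraMap ℝ ℂ) z p₀
  rwa [invOf_eq_inv] at this

theorem aeval_reverse_zero (p₀ : ℝ[X]) : aeval (0 : ℂ) p₀.reverse = p₀.leadingCoeff := by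
  rw [aeval_def, eval₂_at_zero, coeff_zero_reverse]
  rfl

/-- Sets of points with bounded `z` are relatively compact in the affine curve. -/
theorem isCompact_z_le (p₀ : ℝ[X]) (M : ℝ) : IsCompact {a : AffineCurve p₀ | ‖a.1.1‖ ≤ M} := by
  have hclosed : IsClosed {P : ℂ × ℂ | P.2 ^ 2 = aeval P.1 p₀} := by
    refine isClosed_eq (by fun_prop) ?_
    exact (p₀.continuous_aeval (A := ℂ)).comp continuous_fst
  have hemb : IsClosedEmbedding (fun a : AffineCurve p₀ => a.1) := hclosed.isClosedEmbedding_subtypeVal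
  obtain ⟨B, hB⟩ := (isCompact_closedBall (0 : ℂ) M).exists_bound_of_continuousOn
    (f := fun z => aeval z p₀) (p₀.continuous_aeval (A := ℂ)).continuousOn
  have hK : IsCompact ((Metric.closedBall (0 : ℂ) M) ×ˢ (Metric.closedBall (0 : ℂ) (B + 1))) :=
    (isCompact_closedBall _ _).prod (isCompact_closedBall _ _)
  refine (hemb.isCompact_preimage hK).of_isClosed_subset (isClosed_le (by fun_prop) continuous_const) ?_
  intro a ha
  have ha' : a.1.1 ∈ Metric.closedBall (0 : ℂ) M := by simpa using ha
  refine ⟨ha', ?_⟩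
  have h1 := hB _ ha'
  rw [← a.2, norm_pow] at h1
  rw [mem_closedBall_zero_iff]
  nlinarith [sq_nonneg (‖a.1.2‖ - 1), norm_nonneg a.1.2]

theorem tendsto_z_coclosedCompact (p₀ : ℝ[X]) :
    Tendsto (fun a : AffineCurve p₀ => ‖a.1.1‖) (coclosedCompact _) atTop := by
  refine tendsto_atTop.2 fun M => ?_
  have h := (isCompact_z_le p₀ M).compl_mem_coclosedCompact_of_isClosed
    (isClosed_le (by fun_prop) continuous_const)
  filter_upwards [h] with a ha
  have : ¬ ‖a.1.1‖ ≤ M := ha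
  exact (not_le.1 this).le

/-- A map into the surface tends to `∞` if its `z`-coordinate does. -/
theorem tendsto_nhds_infty_of_z {ι : Type*} {l : Filter ι} {f : ι → Surface p₀}
    (hf : ∀ M : ℝ, ∀ᶠ i in l, f i = ∞ ∨ M < ‖zCoord (f i)‖) : Tendsto f l (𝓝 ∞) := by
  rw [OnePoint.hasBasis_nhds_infty.tendsto_right_iff]
  rintro K ⟨hK1, hK2⟩
  obtain ⟨M, hM⟩ := hK2.exists_bound_of_continuousOn (f := fun a : AffineCurve p₀ => a.1.1)
    (Continuous.continuousOn (by fun_prop))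
  filter_upwards [hf M] with i hi
  rcases eq_or_ne (f i) ∞ with h | h
  · rw [h]
    exact Or.inr rfl
  · have hi' := hi.resolve_left h
    obtain ⟨a, ha⟩ := OnePoint.ne_infty_iff_exists.1 h
    rw [← ha] at hi' ⊢
    refine Or.inl ⟨a, fun haK => ?_, rfl⟩
    exact (hM a haK).not_gt hi'

theorem tendsto_zCoord_infty : Tendsto (fun P : Surface p₀ => ‖zCoord P‖) (𝓝[≠] ∞) atTop := by
  rw [OnePoint.nhdsNE_infty_eq, tendsto_map'_iff]
  exact tendsto_z_coclosedCompact p₀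

/-- A holomorphic chart at infinity, with `z = 1 / t²`. -/
theorem exists_infty_chart (hlead : 0 < p₀.leadingCoeff) {g : ℕ} (hdeg : p₀.natDegree = 2 * g + 1) :
    ∃ e : OpenPartialHomeomorph (Surface p₀) ℂ, IsHolomorphicChart e ∧ ∞ ∈ e.source ∧ e ∞ = 0 ∧
      (∀ P ∈ e.source, P ≠ ∞ → zCoord P ≠ 0 ∧ wCoord P ≠ 0 ∧ e P ^ 2 = (zCoord P)⁻¹) ∧
      ∀ t ∈ e.target, t ≠ 0 → e.symm t ≠ ∞ := by
  set rv : ℂ → ℂ := fun s => aeval s p₀.reverse with hrv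
  have hrvc : Continuous rv := p₀.reverse.continuous_aeval
  set V : Set ℂ := rv ⁻¹' Complex.slitPlane with hV
  have hVo : IsOpen V := Complex.isOpen_slitPlane.preimage hrvc
  have h0V : (0 : ℂ) ∈ V := by
    rw [hV, mem_preimage, hrv]
    simp only
    rw [aeval_reverse_zero, Complex.ofReal_mem_slitPlane]
    exact hlead
  have hrv0 : ∀ s ∈ V, rv s ≠ 0 := fun s hs => Complex.slitPlane_ne_zero hs
  set r : ℂ → ℂ := fun s => halfPow (rv s) with hr
  have hra : ∀ s ∈ V, AnalyticAt ℂ r s := fun s hs =>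
    (analyticAt_halfPow hs).fun_comp (analyticAt_aeval_curve _ s)
  have hr0 : ∀ s, r s ≠ 0 := fun s => halfPow_ne_zero _
  have hr2 : ∀ s ∈ V, r s ^ 2 = rv s := fun s hs => halfPow_sq (hrv0 s hs)
  have hrvz : ∀ z : ℂ, z ≠ 0 → aeval z p₀ = rv z⁻¹ * z ^ (2 * g + 1) := fun z hz => by
    rw [← aeval_reverse_eq p₀ hz, hdeg]
  set T : Set ℂ := (fun t : ℂ => t ^ 2) ⁻¹' V with hT
  have hTo : IsOpen T := hVo.preimage (by fun_prop)
  set Z : ℂ → ℂ := fun t => (t ^ 2)⁻¹ with hZ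
  set W : ℂ → ℂ := fun t => r (t ^ 2) / t ^ (2 * g + 1) with hW
  have hrel : ∀ t ∈ T, t ≠ 0 → W t ^ 2 = aeval (Z t) p₀ := by
    intro t ht h0
    rw [hrvz _ (inv_ne_zero (pow_ne_zero 2 h0)), inv_inv, hW]
    simp only
    rw [div_pow, hr2 (t ^ 2) ht, inv_pow, ← pow_mul, ← pow_mul, mul_comm (2 * g + 1) 2, div_eq_mul_inv]
  -- With r² the reversed polynomial, w² = r(1/z)² z^{2g+1}. Hence t = r(1/z) z^g / w satisfies t² =
  -- 1/z, and t distinguishes the two sheets.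
  set f : AffineCurve p₀ → ℂ := fun a => r a.1.1⁻¹ * a.1.1 ^ g / a.1.2 with hf
  set S : Set (AffineCurve p₀) := {a | a.1.1 ≠ 0 ∧ a.1.1⁻¹ ∈ V} with hS
  have hw0 : ∀ a ∈ S, a.1.2 ≠ 0 := by
    rintro a ⟨h1, h2⟩ h3
    have h4 := a.2
    rw [h3, hrvz _ h1] at h4
    have := mul_ne_zero (hrv0 _ h2) (pow_ne_zero (2 * g + 1) h1)
    exact this (by rw [← h4]; simp)
  have hf2 : ∀ a ∈ S, f a ^ 2 = a.1.1⁻¹ := by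
    intro a ha
    have h1 := ha.1
    rw [hf]
    simp only
    rw [div_pow, mul_pow, hr2 _ ha.2, a.2, hrvz _ h1]
    have h2 := hrv0 _ ha.2
    generalize rv (a.1.1)⁻¹ = v at h2
    generalize a.1.1 = z at h1
    field_simp
    ring
  have hf0 : ∀ a ∈ S, f a ≠ 0 := fun a ha =>
    div_ne_zero (mul_ne_zero (hr0 _) (pow_ne_zero _ ha.1)) (hw0 a ha)
  have hfc : ContinuousOn f S := by
    intro a ha
    refine ContinuousAt.continuousWithinAt ?_
    have hz : ContinuousAt (fun a : AffineCurve p₀ => a.1.1) a := by fun_prop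
    have hw : ContinuousAt (fun a : AffineCurve p₀ => a.1.2) a := by fun_prop
    have h1 : ContinuousAt (fun a : AffineCurve p₀ => r a.1.1⁻¹) a :=
      ContinuousAt.comp (f := fun a : AffineCurve p₀ => a.1.1⁻¹) (hra _ ha.2).continuousAt
        (hz.inv₀ ha.1)
    exact (h1.mul (hz.pow g)).div hw (hw0 a ha)
  have hSo : IsOpen S := by
    rw [isOpen_iff_mem_nhds]
    intro a ha
    have hz : ContinuousAt (fun a : AffineCurve p₀ => a.1.1) a := by fun_prop
    filter_upwards [hz.eventually_ne ha.1, (hz.inv₀ ha.1).eventually_mem (hVo.mem_nhds ha.2)]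
      with b h1 h2 using ⟨h1, h2⟩
  have hSinf : ∀ᶠ a in coclosedCompact (AffineCurve p₀), a ∈ S := by
    have h1 := tendsto_z_coclosedCompact p₀
    have h2 : Tendsto (fun a : AffineCurve p₀ => a.1.1⁻¹) (coclosedCompact _) (𝓝 0) :=
      tendsto_inv₀_cobounded.comp (tendsto_norm_atTop_iff_cobounded.1 h1)
    filter_upwards [h1.eventually_gt_atTop 0, h2.eventually_mem (hVo.mem_nhds h0V)] with a h3 h4
    exact ⟨norm_pos_iff.1 h3, h4⟩
  set src : Set (Surface p₀) := insert ∞ ((fun a : AffineCurve p₀ => (a : Surface p₀)) '' S)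
    with hsrc
  have hcurve : ∀ t ∈ T, t ≠ 0 → curvePoint p₀ (Z t) (W t) ∈ S ∧
      f (curvePoint p₀ (Z t) (W t)) = t := by
    intro t ht h0
    have h1 := curvePoint_val (hrel t ht h0)
    refine ⟨?_, ?_⟩
    · rw [hS, mem_ofPred_eq, h1]
      exact ⟨inv_ne_zero (pow_ne_zero 2 h0), by simp only [hZ, inv_inv]; exact ht⟩
    · rw [hf]
      simp only
      rw [h1]
      simp only [hZ, hW, inv_inv]
      have h2 := hr0 (t ^ 2)
      generalize r (t ^ 2) = v at h2
      rw [inv_pow, ← pow_mul, pow_succ]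
      field_simp
  have hback : ∀ a ∈ S, f a ∈ T ∧ curvePoint p₀ (Z (f a)) (W (f a)) = a := by
    intro a ha
    have hT' : f a ∈ T := by
      rw [hT, mem_preimage, hf2 a ha]
      exact ha.2
    refine ⟨hT', Subtype.ext ?_⟩
    rw [curvePoint_val (hrel _ hT' (hf0 a ha))]
    refine Prod.ext ?_ ?_
    · rw [hZ]
      simp only
      rw [hf2 a ha, inv_inv]
    · rw [hW]
      simp only
      rw [hf2 a ha, pow_succ, pow_mul, hf2 a ha, hf]
      simp only
      have h1 := hr0 (a.1.1)⁻¹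
      have h2 := ha.1
      have h3 := hw0 a ha
      generalize r (a.1.1)⁻¹ = v at h1
      generalize a.1.1 = z at h2
      generalize a.1.2 = w at h3
      rw [inv_pow]
      field_simp
  classical
  let e : OpenPartialHomeomorph (Surface p₀) ℂ :=
    { toFun := fun P => P.elim 0 f
      invFun := fun t => if t = 0 then ∞ else ((curvePoint p₀ (Z t) (W t) : AffineCurve p₀) : Surface p₀)
      source := src
      target := T
      map_source' := by
        rintro P (rfl | ⟨a, ha, rfl⟩)
        · change (0 : ℂ) ^ 2 ∈ V
          simpa using h0V
        · exact (hback a ha).1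
      map_target' := by
        intro t ht
        by_cases h0 : t = 0
        · rw [if_pos h0]
          exact Or.inl rfl
        · rw [if_neg h0]
          exact Or.inr ⟨_, (hcurve t ht h0).1, rfl⟩
      left_inv' := by
        rintro P (rfl | ⟨a, ha, rfl⟩)
        · exact if_pos rfl
        · exact (if_neg (hf0 a ha)).trans (congrArg _ (hback a ha).2)
      right_inv' := by
        intro t ht
        by_cases h0 : t = 0
        · rw [if_pos h0, h0]
          rfl
        · rw [if_neg h0]
          exact (hcurve t ht h0).2
      open_source := by
        rw [isOpen_iff_mem_nhds]
        rintro P (rfl | ⟨a, ha, rfl⟩)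
        · rw [OnePoint.nhds_infty_eq]
          refine mem_sup.2 ⟨mem_map.2 ?_, mem_pure.2 (Or.inl rfl)⟩
          filter_upwards [hSinf] with a ha
          exact Or.inr ⟨a, ha, rfl⟩
        · rw [OnePoint.nhds_coe_eq]
          refine mem_map.2 ?_
          filter_upwards [hSo.mem_nhds ha] with b hb
          exact Or.inr ⟨b, hb, rfl⟩
      open_target := hTo
      continuousOn_toFun := by
        rintro P (rfl | ⟨a, ha, rfl⟩)
        · refine ContinuousAt.continuousWithinAt (OnePoint.continuousAt_infty'.2 ?_)
          change Tendsto f _ (𝓝 0)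
          rw [tendsto_zero_iff_norm_tendsto_zero]
          have h2 : Tendsto (fun a : AffineCurve p₀ => √‖a.1.1⁻¹‖) (coclosedCompact _) (𝓝 0) := by
            have h1 := tendsto_inv₀_cobounded.comp
              (tendsto_norm_atTop_iff_cobounded.1 (tendsto_z_coclosedCompact p₀))
            have h2 := (Real.continuous_sqrt.tendsto 0).comp (tendsto_zero_iff_norm_tendsto_zero.1 h1)
            rw [Real.sqrt_zero] at h2
            exact h2
          refine h2.congr' ?_
          filter_upwards [hSinf] with a ha
          rw [← hf2 a ha, norm_pow, Real.sqrt_sq (norm_nonneg _)]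
        · refine ContinuousAt.continuousWithinAt (OnePoint.continuousAt_coe.2 ?_)
          exact hfc.continuousAt (hSo.mem_nhds ha)
      continuousOn_invFun := by
        intro t ht
        refine ContinuousAt.continuousWithinAt ?_
        by_cases h0 : t = 0
        · subst h0
          change Tendsto _ _ (𝓝 (if (0 : ℂ) = 0 then ∞ else _))
          rw [if_pos rfl]
          refine tendsto_nhds_infty_of_z fun M => ?_
          have h1 : Tendsto (fun t : ℂ => t ^ 2) (𝓝[≠] 0) (𝓝[≠] 0) := by
            refine tendsto_nhdsWithin_iff.2 ⟨?_, ?_⟩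
            · have : Tendsto (fun t : ℂ => t ^ 2) (𝓝 0) (𝓝 (0 ^ 2)) := Continuous.tendsto (by fun_prop) 0
              rw [zero_pow two_ne_zero] at this
              exact this.mono_left nhdsWithin_le_nhds
            · filter_upwards [self_mem_nhdsWithin] with t ht using pow_ne_zero 2 ht
          have h2 := (tendsto_norm_cobounded_atTop.comp
            (tendsto_inv₀_nhdsNE_zero.comp h1)).eventually_gt_atTop M
          rw [eventually_nhdsWithin_iff] at h2
          filter_upwards [h2, hTo.mem_nhds ht] with t h3 h4
          by_cases h5 : t = 0
          · exact Or.inl (if_pos h5)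
          · right
            rw [if_neg h5, zCoord_coe, curvePoint_val (hrel t h4 h5)]
            exact h3 h5
        · have h1 : ContinuousAt (fun t => curvePoint p₀ (Z t) (W t)) t := by
            refine Topology.IsInducing.subtypeVal.continuousAt_iff.2 ?_
            have h2 : ContinuousAt (fun t => (Z t, W t)) t := by
              refine ContinuousAt.prodMk ?_ ?_
              · exact ContinuousAt.inv₀ (by fun_prop) (pow_ne_zero 2 h0)
              · refine ContinuousAt.div ?_ (by fun_prop) (pow_ne_zero _ h0)
                exact ContinuousAt.comp (f := fun t : ℂ => t ^ 2) (hra _ ht).continuousAt (by fun_prop)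
            refine h2.congr ?_
            filter_upwards [hTo.mem_nhds ht, isOpen_ne.mem_nhds h0] with s hs hs0
            exact (curvePoint_val (hrel s hs hs0)).symm
          refine ContinuousAt.congr (OnePoint.continuous_coe.continuousAt.comp h1) ?_
          filter_upwards [isOpen_ne.mem_nhds h0] with s hs
          exact (if_neg hs).symm }
  have hsym0 : e.symm 0 = ∞ := if_pos rfl
  have hsym : ∀ t, t ≠ 0 → e.symm t = ((curvePoint p₀ (Z t) (W t) : AffineCurve p₀) : Surface p₀) :=
    fun t ht => if_neg ht
  have hne : ∀ t, e.symm t ≠ ∞ → t ≠ 0 := by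
    rintro t h rfl
    exact h hsym0
  have hzE : ∀ t ∈ T, t ≠ 0 → zCoord (e.symm t) = Z t := fun t ht h0 => by
    rw [hsym t h0, zCoord_coe, curvePoint_val (hrel t ht h0)]
  have hwE : ∀ t ∈ T, t ≠ 0 → wCoord (e.symm t) = W t := fun t ht h0 => by
    rw [hsym t h0, wCoord_coe, curvePoint_val (hrel t ht h0)]
  have hev : ∀ t ∈ T, t ≠ 0 → ∀ᶠ s in 𝓝 t, s ∈ T ∧ s ≠ 0 := fun t ht h0 =>
    (hTo.eventually_mem ht).and (isOpen_ne.eventually_mem h0)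
  have hZd : ∀ t, t ≠ 0 → HasDerivAt Z (-(2 * t) / (t ^ 2) ^ 2) t := fun t h0 => by
    exact ((hasDerivAt_pow 2 t).inv (pow_ne_zero 2 h0)).congr_deriv (by simp)
  refine ⟨e, ⟨?_, ?_, ?_, ?_, ?_⟩, Or.inl rfl, rfl, ?_, ?_⟩
  · intro t ht hti
    have h0 := hne t hti
    have : AnalyticAt ℂ Z t := (analyticAt_id.pow 2).inv (pow_ne_zero 2 h0)
    refine this.congr ?_
    filter_upwards [hev t ht h0] with s hs using (hzE s hs.1 hs.2).symm
  · intro t ht hti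
    have h0 := hne t hti
    have : AnalyticAt ℂ W t := ((hra _ ht).fun_comp (f := fun t : ℂ => t ^ 2) (analyticAt_id.pow 2)).div
      (analyticAt_id.pow _) (pow_ne_zero _ h0)
    refine this.congr ?_
    filter_upwards [hev t ht h0] with s hs using (hwE s hs.1 hs.2).symm
  · intro t ht hti
    have h0 := hne t hti
    left
    have : (fun s => zCoord (e.symm s)) =ᶠ[𝓝 t] Z := by
      filter_upwards [hev t ht h0] with s hs using hzE s hs.1 hs.2
    rw [this.deriv_eq, (hZd t h0).deriv]
    exact div_ne_zero (neg_ne_zero.2 (mul_ne_zero two_ne_zero h0)) (pow_ne_zero _ (pow_ne_zero _ h0))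
  · intro t ht hti
    have h0 : t = 0 := by
      by_contra h
      rw [hsym t h] at hti
      exact OnePoint.coe_ne_infty _ hti
    subst h0
    have : MeromorphicAt Z 0 := (MeromorphicAt.id 0).pow 2 |>.inv
    refine this.congr ?_
    filter_upwards [nhdsWithin_le_nhds (hTo.mem_nhds ht), self_mem_nhdsWithin] with s h1 h2
      using (hzE s h1 h2).symm
  · intro t ht hti
    have h0 : t = 0 := by
      by_contra h
      rw [hsym t h] at hti
      exact OnePoint.coe_ne_infty _ hti
    subst h0
    have h1 : AnalyticAt ℂ (fun t : ℂ => r (t ^ 2)) 0 :=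
      (hra _ ht).fun_comp (f := fun t : ℂ => t ^ 2) (analyticAt_id.pow 2)
    have : MeromorphicAt W 0 := h1.meromorphicAt.div ((MeromorphicAt.id 0).pow _)
    refine this.congr ?_
    filter_upwards [nhdsWithin_le_nhds (hTo.mem_nhds ht), self_mem_nhdsWithin] with s h1 h2
      using (hwE s h1 h2).symm
  · rintro P (rfl | ⟨a, ha, rfl⟩) hP
    · exact absurd rfl hP
    · exact ⟨ha.1, hw0 a ha, hf2 a ha⟩
  · intro t _ h0
    rw [hsym t h0]
    exact OnePoint.coe_ne_infty _

end Infinity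
end AztecDiamond

namespace AztecDiamond

/-! ### Critical points in coordinates -/

theorem exists_analytic_log {f : ℂ → ℂ} {t : ℂ} (hf : AnalyticAt ℂ f t) (h0 : f t ≠ 0) :
    ∃ L : ℂ → ℂ, AnalyticAt ℂ L t ∧ ∀ᶠ s in 𝓝 t, Complex.exp (L s) = f s := by
  refine ⟨fun s => Complex.log (f s / f t) + Complex.log (f t), ?_, ?_⟩
  · refine AnalyticAt.add (AnalyticAt.clog (hf.div analyticAt_const h0) ?_) analyticAt_const
    rw [div_self h0]
    exact Complex.one_mem_slitPlane
  · filter_upwards [hf.continuousAt.eventually_ne h0] with s hs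
    rw [Complex.exp_add, Complex.exp_log (div_ne_zero hs h0), Complex.exp_log h0,
      div_mul_cancel₀ _ h0]

namespace IsHolomorphicChart

variable {p₀ : ℝ[X]} {e : OpenPartialHomeomorph (Surface p₀) ℂ} (he : IsHolomorphicChart e)

omit he in
theorem eventually_affine {t : ℂ} (ht : t ∈ e.target) (hti : e.symm t ≠ ∞) :
    ∀ᶠ s in 𝓝 t, s ∈ e.target ∧ e.symm s ≠ ∞ :=
  (e.open_target.eventually_mem ht).and ((e.symm.continuousAt ht).eventually_ne hti)

include he

/-- Differentiating `w² = p₀(z)`. -/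
theorem deriv_relation {t : ℂ} (ht : t ∈ e.target) (hti : e.symm t ≠ ∞) :
    2 * wCoord (e.symm t) * deriv (fun s => wCoord (e.symm s)) t =
      aeval (zCoord (e.symm t)) (derivative p₀) * deriv (fun s => zCoord (e.symm s)) t := by
  have hz := (he.analyticAt_z t ht hti).differentiableAt.hasDerivAt
  have hw := (he.analyticAt_w t ht hti).differentiableAt.hasDerivAt
  have h1 := (hasDerivAt_aeval_curve p₀ (zCoord (e.symm t))).comp t hz
  have h2 := hw.pow 2
  have h3 : (fun s => wCoord (e.symm s)) ^ 2 =ᶠ[𝓝 t]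
      (fun z : ℂ => aeval z p₀) ∘ fun s => zCoord (e.symm s) := by
    filter_upwards [eventually_affine ht hti] with s hs using coord_relation hs.2
  have h4 := (h2.congr_of_eventuallyEq h3.symm).unique h1
  simpa using h4

/-- If z' = 0, then 2ww' = 0 and so w' = 0, against the regularity of the parametrization. -/
theorem deriv_z_ne_zero {t : ℂ} (ht : t ∈ e.target) (hti : e.symm t ≠ ∞)
    (hw : wCoord (e.symm t) ≠ 0) : deriv (fun s => zCoord (e.symm s)) t ≠ 0 := by
  intro h
  have h1 := he.deriv_relation ht hti
  rw [h, mul_zero, mul_eq_zero, mul_eq_zero] at h1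
  exact (he.regular t ht hti).elim (fun h2 => h2 h) fun h2 => by simp_all

end IsHolomorphicChart

namespace SpectralData

variable {k : ℕ} {α β : Fin k → ℝ} {p₀ q : ℝ[X]} (S : SpectralData α β p₀ q)

theorem _root_.AztecDiamond.rho_eq {k : ℕ} (α β : Fin k → ℝ) (q : ℝ[X]) (P : Surface p₀)
    (h0 : zCoord P ≠ 0) (h1 : zCoord P ≠ 1) :
    rho α β q P = (aeval (zCoord P) (clearedSymbol α β).trace + aeval (zCoord P) q * wCoord P) /
      (2 * (zCoord P - 1) ^ k) := by
  have h : aeval (zCoord P) (clearedSymbol α β).trace =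
      (zCoord P - 1) ^ k * (symbol α β (zCoord P)).trace := by
    have := congrArg Matrix.trace (clearedSymbol_map α β h0 h1)
    rw [Matrix.trace_smul, smul_eq_mul] at this
    rw [← this, Matrix.trace, Matrix.trace, map_sum]
    rfl
  have h2 : (zCoord P - 1) ^ k ≠ 0 := pow_ne_zero _ (sub_ne_zero.2 h1)
  rw [rho, h]
  field_simp

include S

/-- The product with its conjugate T - qw is T² - q²p₀ = 4(z-1)^{2k}; so ρ has no zeros over z ≠ 1.
-/
theorem trace_add_ne_zero {z w : ℂ} (hw : w ^ 2 = aeval z p₀) (h1 : z ≠ 1) :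
    aeval z (clearedSymbol α β).trace + aeval z q * w ≠ 0 := by
  intro h
  have h4 : aeval z (4 : ℝ[X]) = (4 : ℂ) := map_ofNat _ 4
  have h2 := congrArg (aeval z) S.hp
  simp only [discrPoly, map_sub, map_mul, map_pow, h4, aeval_X, map_one] at h2
  rw [← hw] at h2
  have h3 : 4 * (z - 1) ^ (2 * k) = 0 := by
    linear_combination -h2 + (aeval z (clearedSymbol α β).trace - aeval z q * w) * h
  exact pow_ne_zero (2 * k) (sub_ne_zero.2 h1) ((mul_eq_zero.1 h3).resolve_left (by norm_num))

/-- The derivative of a local branch. -/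
theorem deriv_branch {χ η : ℝ} {e : OpenPartialHomeomorph (Surface p₀) ℂ}
    (he : IsHolomorphicChart e) {t : ℂ} (ht : t ∈ e.target) (hti : e.symm t ≠ ∞) {G : ℂ → ℂ}
    (hG : IsLocalBranch α β q χ η e t G) {z w z' w' : ℂ} (hz : zCoord (e.symm t) = z)
    (hw : wCoord (e.symm t) = w) (hz' : deriv (fun s => zCoord (e.symm s)) t = z')
    (hw' : deriv (fun s => wCoord (e.symm s)) t = w') :
    z ≠ 0 ∧ z ≠ 1 ∧ ∃ L' : ℂ,
      L' * (aeval z (clearedSymbol α β).trace + aeval z q * w) * (z - 1) =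
        z' * aeval z ((X - 1) * derivative (clearedSymbol α β).trace -
          C (k : ℝ) * (clearedSymbol α β).trace) +
        w * z' * aeval z ((X - 1) * derivative q - C (k : ℝ) * q) + (z - 1) * aeval z q * w' ∧
      deriv G t = k / 4 * (η + 1) * (z' / z) - k / 2 * (z' / (z - 1)) - χ / 2 * L' := by
  obtain ⟨L₀, L₁, L, h₀, h₁, hL, hev⟩ := hG
  obtain ⟨e0, e1, e2, -⟩ := hev.self_of_nhds
  rw [hz] at e0 e1
  have hz0 : z ≠ 0 := by
    rw [← e0]
    exact Complex.exp_ne_zero _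
  have hz1 : z - 1 ≠ 0 := by
    rw [← e1]
    exact Complex.exp_ne_zero _
  have dz := (he.analyticAt_z t ht hti).differentiableAt.hasDerivAt
  have dw := (he.analyticAt_w t ht hti).differentiableAt.hasDerivAt
  rw [hz'] at dz
  rw [hw'] at dw
  have d0 := h₀.differentiableAt.hasDerivAt
  have d1 := h₁.differentiableAt.hasDerivAt
  have dL := hL.differentiableAt.hasDerivAt
  have c0 : z * deriv L₀ t = z' := by
    rw [← e0]
    refine (d0.cexp.congr_of_eventuallyEq ?_).unique dz
    filter_upwards [hev] with s hs using hs.1.symm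
  have c1 : (z - 1) * deriv L₁ t = z' := by
    rw [← e1]
    refine (d1.cexp.congr_of_eventuallyEq ?_).unique (dz.sub_const 1)
    filter_upwards [hev] with s hs using hs.2.1.symm
  -- The denominator of ρ is cleared before differentiating, so that only polynomials in z and w
  -- occur.
  have key : ∀ᶠ s in 𝓝 t, Complex.exp (L s) * (2 * (zCoord (e.symm s) - 1) ^ k) =
      aeval (zCoord (e.symm s)) (clearedSymbol α β).trace +
        aeval (zCoord (e.symm s)) q * wCoord (e.symm s) := by
    filter_upwards [hev] with s hs
    have s0 : zCoord (e.symm s) ≠ 0 := by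
      rw [← hs.1]
      exact Complex.exp_ne_zero _
    have s1 : zCoord (e.symm s) - 1 ≠ 0 := by
      rw [← hs.2.1]
      exact Complex.exp_ne_zero _
    rw [hs.2.2.1, rho_eq α β q _ s0 (sub_ne_zero.1 s1), div_mul_cancel₀]
    exact mul_ne_zero two_ne_zero (pow_ne_zero _ s1)
  have dl := dL.cexp.mul (((dz.sub_const 1).pow k).const_mul 2)
  have dr := ((hasDerivAt_aeval_curve (clearedSymbol α β).trace (zCoord (e.symm t))).comp t dz).add
    (((hasDerivAt_aeval_curve q (zCoord (e.symm t))).comp t dz).mul dw)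
  have e3 := key.self_of_nhds
  have e4 := (dl.congr_of_eventuallyEq (key.mono fun s hs => hs.symm)).unique dr
  obtain ⟨j, hj⟩ : ∃ j, k = j + 1 := ⟨k - 1, by have := S.hk; omega⟩
  refine ⟨hz0, sub_ne_zero.1 hz1, deriv L t, ?_, ?_⟩
  · simp only [Pi.pow_apply, Function.comp_apply, hz, hw] at e3 e4
    simp only [map_sub, map_mul, aeval_X, map_one, map_natCast]
    have e5 : ((z - 1) ^ (k - 1)) * (z - 1) = (z - 1) ^ k := by
      rw [hj, Nat.add_sub_cancel, pow_succ]
    linear_combination (z - 1) * e4 - (deriv L t * (z - 1) + k * z') * e3 -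
      Complex.exp (L t) * 2 * k * z' * e5
  · have dG := ((d0.const_mul ((k : ℂ) / 4 * ((η : ℂ) + 1))).sub (d1.const_mul ((k : ℂ) / 2))).sub
      (dL.const_mul ((χ : ℂ) / 2))
    have : deriv G t = _ := (dG.congr_of_eventuallyEq (hev.mono fun s hs => hs.2.2.2)).deriv
    rw [this, ← c0, mul_div_cancel_left₀ _ hz0, c0, ← c1, mul_div_cancel_left₀ _ hz1]

theorem exists_branch (χ η : ℝ) {e : OpenPartialHomeomorph (Surface p₀) ℂ}
    (he : IsHolomorphicChart e) {t : ℂ} (ht : t ∈ e.target) (hti : e.symm t ≠ ∞)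
    (h0 : zCoord (e.symm t) ≠ 0) (h1 : zCoord (e.symm t) ≠ 1) :
    ∃ G, IsLocalBranch α β q χ η e t G := by
  have az := he.analyticAt_z t ht hti
  have aw := he.analyticAt_w t ht hti
  obtain ⟨L₀, a0, b0⟩ := exists_analytic_log az h0
  obtain ⟨L₁, a1, b1⟩ := exists_analytic_log (az.sub analyticAt_const) (sub_ne_zero.2 h1)
  have aρ : AnalyticAt ℂ (fun s => (aeval (zCoord (e.symm s)) (clearedSymbol α β).trace +
      aeval (zCoord (e.symm s)) q * wCoord (e.symm s)) / (2 * (zCoord (e.symm s) - 1) ^ k)) t :=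
    ((az.aeval_polynomial _).add ((az.aeval_polynomial _).mul aw)).div
      (analyticAt_const.mul ((az.sub analyticAt_const).pow k))
      (mul_ne_zero two_ne_zero (pow_ne_zero _ (sub_ne_zero.2 h1)))
  obtain ⟨L, a2, b2⟩ := exists_analytic_log aρ (div_ne_zero
    (S.trace_add_ne_zero (coord_relation hti) h1)
    (mul_ne_zero two_ne_zero (pow_ne_zero _ (sub_ne_zero.2 h1))))
  refine ⟨fun s => (k : ℂ) / 4 * ((η : ℂ) + 1) * L₀ s - (k : ℂ) / 2 * L₁ s - (χ : ℂ) / 2 * L s,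
    L₀, L₁, L, a0, a1, a2, ?_⟩
  filter_upwards [b0, b1, b2, az.continuousAt.eventually_ne h0, az.continuousAt.eventually_ne h1]
    with s s0 s1 s2 s3 s4
  refine ⟨s0, s1, ?_, rfl⟩
  rw [s2, rho_eq α β q _ s3 s4]

/-- Critical points off the branch points. -/
theorem isCriticalPoint_iff {N : ℝ[X]}
    (hN : (X - 1) * derivative (clearedSymbol α β).trace -
      C (k : ℝ) * (clearedSymbol α β).trace = q * N)
    (hN' : 2 * (clearedSymbol α β).trace * N =
      2 * ((X - 1) * derivative q - C (k : ℝ) * q) * p₀ + q * (X - 1) * derivative p₀)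
    {χ η : ℝ} (a : AffineCurve p₀) (h0 : a.1.1 ≠ 0) (h1 : a.1.1 ≠ 1) (hw : a.1.2 ≠ 0) :
    IsCriticalPoint α β q χ η (a : Surface p₀) ↔
      k / 2 * a.1.2 * (η * (a.1.1 - 1) - (a.1.1 + 1)) = χ * (a.1.1 * aeval a.1.1 N) := by
  have main : ∀ (e : OpenPartialHomeomorph (Surface p₀) ℂ), IsHolomorphicChart e →
      (a : Surface p₀) ∈ e.source → ∀ G, IsLocalBranch α β q χ η e (e a) G →
      (deriv G (e a) = 0 ↔
        k / 2 * a.1.2 * (η * (a.1.1 - 1) - (a.1.1 + 1)) = χ * (a.1.1 * aeval a.1.1 N)) := by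
    intro e he hae G hG
    have hinv := e.left_inv hae
    have ht := e.map_source hae
    have hti : e.symm (e a) ≠ ∞ := by
      rw [hinv]
      exact OnePoint.coe_ne_infty _
    have hz : zCoord (e.symm (e a)) = a.1.1 := by rw [hinv, zCoord_coe]
    have hww : wCoord (e.symm (e a)) = a.1.2 := by rw [hinv, wCoord_coe]
    obtain ⟨-, -, L', c1, c2⟩ := S.deriv_branch he ht hti hG hz hww rfl rfl
    have hz' := he.deriv_z_ne_zero ht hti (by rwa [hww])
    have hrel := he.deriv_relation ht hti
    rw [hz, hww] at hrel
    have hcurve := a.2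
    have hS := S.trace_add_ne_zero hcurve h1
    have hNz := congrArg (aeval a.1.1) hN'
    rw [hN] at c1
    generalize deriv (fun s => zCoord (e.symm s)) (e a) = z' at *
    generalize deriv (fun s => wCoord (e.symm s)) (e a) = w' at *
    generalize a.1.1 = z at *
    generalize a.1.2 = w at *
    have h1' := sub_ne_zero.2 h1
    -- This is dρ/ρ = N dz/((z-1)w) in the chart. It holds in any chart, so criticality does not
    -- depend on the choice.
    have key : L' * w * (z - 1) = z' * aeval z N := by
      refine mul_left_cancel₀ hS ?_
      simp only [map_add, map_sub, map_mul, map_ofNat, aeval_X, map_one, map_natCast]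
        at c1 hNz ⊢
      linear_combination w * c1 + (z' * ((z - 1) * aeval z (derivative q) - k * aeval z q)) * hcurve +
        (z - 1) * aeval z q / 2 * hrel - z' / 2 * hNz
    have key2 : deriv G (e a) * (2 * w * z * (z - 1)) =
        z' * (k / 2 * w * (η * (z - 1) - (z + 1)) - χ * (z * aeval z N)) := by
      rw [c2]
      field_simp
      linear_combination -(8 * χ * z) * key
    constructor
    · intro h
      rw [h, zero_mul] at key2
      exact sub_eq_zero.1 ((mul_eq_zero.1 key2.symm).resolve_left hz')
    · intro h
      rw [h, sub_self, mul_zero] at key2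
      exact (mul_eq_zero.1 key2).resolve_right
        (mul_ne_zero (mul_ne_zero (mul_ne_zero two_ne_zero hw) h0) h1')
  constructor
  · rintro ⟨e, he, hae, -, G, hG, hG'⟩
    exact (main e he hae G hG).1 hG'
  · intro h
    obtain ⟨e, he, hae, -, -⟩ := exists_sheet_chart a hw
    have hinv := e.left_inv hae
    obtain ⟨G, hG⟩ := S.exists_branch χ η he (e.map_source hae)
      (by rw [hinv]; exact OnePoint.coe_ne_infty _) (by rwa [hinv]) (by rwa [hinv])
    exact ⟨e, he, hae, OnePoint.coe_ne_infty _, G, hG, (main e he hae G hG).2 h⟩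

/-- A real branch point is critical only for `χ = 0`. -/
theorem isCriticalPoint_branch_iff {χ η x : ℝ} (a : AffineCurve p₀) (hx : a.1.1 = x) (hw : a.1.2 = 0)
    (h0 : x < 0) : IsCriticalPoint α β q χ η (a : Surface p₀) ↔ χ = 0 := by
  have hp : aeval a.1.1 p₀ = 0 := by
    rw [← a.2, hw]
    simp
  have hpx : p₀.eval x = 0 := by
    rw [hx, aeval_ofReal] at hp
    exact_mod_cast hp
  have hd : aeval a.1.1 (derivative p₀) ≠ 0 := by
    rw [hx, aeval_ofReal]
    exact_mod_cast S.derivative_ne_zero hpx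
  have hq : aeval a.1.1 q ≠ 0 := by
    rw [hx, aeval_ofReal]
    exact_mod_cast S.q_ne_zero_of_nonneg hpx.ge
  have h0' : a.1.1 ≠ 0 := by
    rw [hx]
    exact_mod_cast h0.ne
  have h1' : a.1.1 ≠ 1 := by
    rw [hx]
    exact_mod_cast (h0.trans one_pos).ne
  have main : ∀ (e : OpenPartialHomeomorph (Surface p₀) ℂ), IsHolomorphicChart e →
      (a : Surface p₀) ∈ e.source → ∀ G, IsLocalBranch α β q χ η e (e a) G →
      (deriv G (e a) = 0 ↔ χ = 0) := by
    intro e he hae G hG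
    have hinv := e.left_inv hae
    have ht := e.map_source hae
    have hti : e.symm (e a) ≠ ∞ := by
      rw [hinv]
      exact OnePoint.coe_ne_infty _
    have hz : zCoord (e.symm (e a)) = a.1.1 := by rw [hinv, zCoord_coe]
    have hww : wCoord (e.symm (e a)) = a.1.2 := by rw [hinv, wCoord_coe]
    have hrel := he.deriv_relation ht hti
    rw [hz, hww, hw, mul_zero, zero_mul] at hrel
    -- At a branch point dz vanishes but dw does not, so of dF only the term of log ρ survives, and
    -- it is nonzero unless χ = 0.
    have hz' := (mul_eq_zero.1 hrel.symm).resolve_left hd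
    have hw' := (he.regular _ ht hti).resolve_left fun h => h hz'
    obtain ⟨-, -, L', c1, c2⟩ := S.deriv_branch he ht hti hG hz hww hz' rfl
    have hL' : L' ≠ 0 := by
      rintro rfl
      rw [zero_mul, zero_mul, zero_mul, mul_zero, zero_mul, zero_add, zero_add] at c1
      exact mul_ne_zero (mul_ne_zero (sub_ne_zero.2 h1') hq) hw' c1.symm
    rw [c2]
    simp [hL']
  constructor
  · rintro ⟨e, he, hae, -, G, hG, hG'⟩
    exact (main e he hae G hG).1 hG'
  · intro h
    obtain ⟨e, he, hae, -, -⟩ := exists_branch_chart hp hd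
    have hae' : (a : Surface p₀) ∈ e.source := by
      convert hae using 2
      exact Subtype.ext (Prod.ext rfl hw)
    have hinv := e.left_inv hae'
    obtain ⟨G, hG⟩ := S.exists_branch χ η he (e.map_source hae')
      (by rw [hinv]; exact OnePoint.coe_ne_infty _) (by rwa [hinv]) (by rwa [hinv])
    exact ⟨e, he, hae', OnePoint.coe_ne_infty _, G, hG, (main e he hae' G hG).2 h⟩

end SpectralData
end AztecDiamond

namespace AztecDiamond

/-! ### The smooth region -/

/-- The index of the piece containing a point is a continuous map to a discrete space with
preconnected nonempty fibres, so it identifies the components with the indices. -/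
theorem enatCard_connectedComponents {Y ι : Type*} [TopologicalSpace Y] [Fintype ι] {X : Set Y}
    {U : ι → Set Y} (hX : X = ⋃ i, U i) (hU : ∀ i, IsOpen (U i)) (hc : ∀ i, IsPreconnected (U i))
    (hne : ∀ i, (U i).Nonempty) (hd : ∀ i j, i ≠ j → Disjoint (U i) (U j)) :
    ENat.card (ConnectedComponents X) = Fintype.card ι := by
  have hex : ∀ x : X, ∃ i, (x : Y) ∈ U i := fun x => mem_iUnion.1 (hX ▸ x.2)
  choose f hf using hex
  have huniq : ∀ (x : X) i, (x : Y) ∈ U i → f x = i := fun x i hi => by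
    by_contra h
    exact Set.disjoint_left.1 (hd _ _ h) (hf x) hi
  let _ : TopologicalSpace ι := ⊥
  have : DiscreteTopology ι := ⟨rfl⟩
  have hcont : Continuous f := by
    refine continuous_discrete_rng.2 fun i => ?_
    have : f ⁻¹' {i} = Subtype.val ⁻¹' U i := by
      ext x
      exact ⟨fun h => by have := hf x; rwa [show f x = i from h] at this, huniq x i⟩
    rw [this]
    exact (hU i).preimage continuous_subtype_val
  have hsub : ∀ i, U i ⊆ X := fun i => hX ▸ subset_iUnion U i
  have hbij : Function.Bijective hcont.connectedComponentsLift := by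
    constructor
    · intro a b hab
      obtain ⟨x, rfl⟩ := ConnectedComponents.surjective_coe a
      obtain ⟨y, rfl⟩ := ConnectedComponents.surjective_coe b
      rw [hcont.connectedComponentsLift_apply_coe, hcont.connectedComponentsLift_apply_coe] at hab
      have hpre : IsPreconnected ((Subtype.val : X → Y) ⁻¹' U (f x)) := by
        rw [← Topology.IsInducing.subtypeVal.isPreconnected_image, Subtype.image_preimage_coe,
          inter_eq_right.2 (hsub _)]
        exact hc _
      refine ConnectedComponents.coe_eq_coe'.2 ?_
      have hy : y ∈ (Subtype.val : X → Y) ⁻¹' U (f x) := by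
        rw [hab]
        exact hf y
      exact hpre.subset_connectedComponent hy (hf x)
    · intro i
      obtain ⟨y, hy⟩ := hne i
      exact ⟨((⟨y, hsub i hy⟩ : X) : ConnectedComponents X), by
        rw [hcont.connectedComponentsLift_apply_coe]
        exact huniq _ i hy⟩
  rw [ENat.card_congr (Equiv.ofBijective _ hbij), ENat.card_eq_coe_fintype_card]

theorem encard_ge_four_iff {Y : Type*} {A : Set Y} :
    4 ≤ A.encard ↔ ∃ Z : Finset Y, Z.card = 4 ∧ ∀ z ∈ Z, z ∈ A := by
  constructor
  · intro h
    obtain ⟨t, ht, ht4⟩ := exists_subset_encard_eq h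
    have hfin : t.Finite := finite_of_encard_eq_coe (k := 4) (by rw [ht4]; rfl)
    refine ⟨hfin.toFinset, ?_, fun z hz => ht (hfin.mem_toFinset.1 hz)⟩
    rw [hfin.encard_eq_coe_toFinset_card] at ht4
    exact_mod_cast ht4
  · rintro ⟨Z, hZ, h⟩
    have h1 : (Z : Set Y) ⊆ A := fun z hz => h z hz
    have h2 := encard_le_encard h1
    rw [encard_coe_eq_coe_finsetCard, hZ] at h2
    exact_mod_cast h2

/-- The point `(x, σ √p₀(x))`. -/
noncomputable def realPoint (p₀ : ℝ[X]) (z : ℝ × ℝ) : AffineCurve p₀ :=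
  curvePoint p₀ z.2 ((z.1 * √(p₀.eval z.2) : ℝ) : ℂ)

theorem realPoint_val {p₀ : ℝ[X]} {z : ℝ × ℝ} (hz : z.1 = 1 ∨ z.1 = -1) (h : 0 ≤ p₀.eval z.2) :
    (realPoint p₀ z).1 = ((z.2 : ℂ), ((z.1 * √(p₀.eval z.2) : ℝ) : ℂ)) := by
  refine curvePoint_val ?_
  have h1 : z.1 ^ 2 = 1 := by rcases hz with h | h <;> rw [h] <;> norm_num
  rw [aeval_ofReal, ← Complex.ofReal_pow, mul_pow, h1, Real.sq_sqrt h, one_mul]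

theorem eq_realPoint {p₀ : ℝ[X]} (a : AffineCurve p₀) {x : ℝ} (hx : a.1.1 = x) (h : 0 ≤ p₀.eval x) :
    ∃ z : ℝ × ℝ, (z.1 = 1 ∨ z.1 = -1) ∧ z.2 = x ∧ a = realPoint p₀ z := by
  have h1 := a.2
  have h2 : a.1.2 ^ 2 = ((√(p₀.eval x) : ℝ) : ℂ) ^ 2 := by
    rw [h1, hx, aeval_ofReal, ← Complex.ofReal_pow, Real.sq_sqrt h]
  rcases sq_eq_sq_iff_eq_or_eq_neg.1 h2 with h3 | h3
  · refine ⟨(1, x), Or.inl rfl, rfl, Subtype.ext ?_⟩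
    rw [realPoint_val (Or.inl rfl) h]
    exact Prod.ext hx (by rw [h3]; simp)
  · refine ⟨(-1, x), Or.inr rfl, rfl, Subtype.ext ?_⟩
    rw [realPoint_val (Or.inr rfl) h]
    exact Prod.ext hx (by rw [h3]; simp)

namespace SpectralData

variable {k : ℕ} {α β : Fin k → ℝ} {p₀ q : ℝ[X]} (S : SpectralData α β p₀ q) {N : ℝ[X]}
  (hN : (X - 1) * derivative (clearedSymbol α β).trace -
      C (k : ℝ) * (clearedSymbol α β).trace = q * N)
  (hN' : 2 * (clearedSymbol α β).trace * N =
      2 * ((X - 1) * derivative q - C (k : ℝ) * q) * p₀ + q * (X - 1) * derivative p₀)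
  {l : ℕ} (hl : 1 ≤ l) (hlk : l < kPrime p₀)
include S hN hN' hl hlk

theorem isCriticalPoint_realPoint {χ η : ℝ} {z : ℝ × ℝ} (hz : z.1 = 1 ∨ z.1 = -1)
    (hx : z.2 ∈ gap p₀ l) :
    IsCriticalPoint α β q χ η (realPoint p₀ z : Surface p₀) ↔
      critFun k p₀ N (z.1 * χ) η 1 z.2 = 0 := by
  have R := S.nonposRooted
  have hp := R.eval_gap_pos hl hlk hx
  have hneg := R.gap_neg hl hlk hx
  have hv := realPoint_val hz hp.le
  have hs := Real.sqrt_pos.2 hp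
  have h1 : z.1 ^ 2 = 1 := by rcases hz with h | h <;> rw [h] <;> norm_num
  have hz0 : z.1 ≠ 0 := by
    intro h
    rw [h] at h1
    norm_num at h1
  rw [S.isCriticalPoint_iff hN hN' (realPoint p₀ z) (by rw [hv]; simp only; exact_mod_cast hneg.ne)
    (by rw [hv]; simp only; exact_mod_cast (hneg.trans one_pos).ne)
    (by rw [hv]; simp only; exact_mod_cast mul_ne_zero hz0 hs.ne'), hv]
  simp only
  have key : ((k / 2 * (z.1 * √(p₀.eval z.2)) * (η * (z.2 - 1) - (z.2 + 1)) : ℝ) : ℂ) =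
      ((χ * (z.2 * N.eval z.2) : ℝ) : ℂ) ↔ _ := Complex.ofReal_inj
  push_cast at key
  rw [aeval_ofReal]
  push_cast
  rw [key, critFun]
  constructor
  · intro h
    linear_combination z.1 * h - k / 2 * √(p₀.eval z.2) * (η * (z.2 - 1) - (z.2 + 1)) * h1
  · intro h
    linear_combination z.1 * h + χ * (z.2 * N.eval z.2) * h1

omit hN hN' in
theorem loop_cases {P : Surface p₀} (hP : P ∈ loop p₀ l) :
    (∃ z : ℝ × ℝ, (z.1 = 1 ∨ z.1 = -1) ∧ z.2 ∈ gap p₀ l ∧ P = (realPoint p₀ z : Surface p₀)) ∨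
    ∃ a : AffineCurve p₀, P = (a : Surface p₀) ∧ a.1.2 = 0 ∧
      (a.1.1 = branchPoint p₀ (2 * l) ∨ a.1.1 = branchPoint p₀ (2 * l - 1)) := by
  have R := S.nonposRooted
  obtain ⟨a, rfl, r, hr, har⟩ := hP
  have hw : p₀.eval r = 0 → a.1.2 = 0 := by
    intro h
    have := a.2
    rw [har, aeval_ofReal, h, Complex.ofReal_zero] at this
    exact pow_eq_zero_iff two_ne_zero |>.1 this
  rcases eq_or_lt_of_le hr.1 with h | h
  · right
    exact ⟨a, rfl, hw (h ▸ R.eval_left hlk), Or.inl (by rw [har, h])⟩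
  rcases eq_or_lt_of_le hr.2 with h' | h'
  · right
    exact ⟨a, rfl, hw (h' ▸ R.eval_right hl hlk), Or.inr (by rw [har, h'])⟩
  left
  have hg : r ∈ gap p₀ l := ⟨h, h'⟩
  obtain ⟨z, hz, hzr, hza⟩ := eq_realPoint a har (R.eval_gap_pos hl hlk hg).le
  exact ⟨z, hz, hzr ▸ hg, by rw [hza]⟩

omit hN hN' in
theorem realPoint_mem_loop {z : ℝ × ℝ} (hz : z.1 = 1 ∨ z.1 = -1) (hx : z.2 ∈ gap p₀ l) :
    (realPoint p₀ z : Surface p₀) ∈ loop p₀ l :=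
  ⟨_, rfl, z.2, Ioo_subset_Icc_self hx,
    by rw [realPoint_val hz (S.nonposRooted.eval_gap_pos hl hlk hx).le]⟩

omit hN hN' in
theorem realPoint_inj {z z' : ℝ × ℝ} (hz : z.1 = 1 ∨ z.1 = -1) (hx : z.2 ∈ gap p₀ l)
    (hz' : z'.1 = 1 ∨ z'.1 = -1) (hx' : z'.2 ∈ gap p₀ l)
    (h : (realPoint p₀ z : Surface p₀) = realPoint p₀ z') : z = z' := by
  have hp := S.nonposRooted.eval_gap_pos hl hlk hx
  have hp' := S.nonposRooted.eval_gap_pos hl hlk hx'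
  have h1 := congrArg zCoord h
  have h2 := congrArg wCoord h
  rw [zCoord_coe, zCoord_coe, realPoint_val hz hp.le, realPoint_val hz' hp'.le] at h1
  rw [wCoord_coe, wCoord_coe, realPoint_val hz hp.le, realPoint_val hz' hp'.le] at h2
  simp only [Complex.ofReal_inj] at h1 h2
  rw [← h1] at h2
  exact Prod.ext (mul_right_cancel₀ (Real.sqrt_pos.2 hp).ne' h2) h1

/-- The smooth region away from the axis `χ = 0`. -/
theorem four_le_encard_iff {χ η : ℝ} (hχ : χ ≠ 0) :
    4 ≤ {P : Surface p₀ | P ∈ loop p₀ l ∧ IsCriticalPoint α β q χ η P}.encard ↔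
      (χ, η) ∈ smoothGap k p₀ N l := by
  have R := S.nonposRooted
  have hA : {P : Surface p₀ | P ∈ loop p₀ l ∧ IsCriticalPoint α β q χ η P} =
      (fun z => (realPoint p₀ z : Surface p₀)) '' {z | IsGapZero k p₀ N χ η 1 l z} := by
    ext P
    constructor
    · rintro ⟨hP, hc⟩
      rcases S.loop_cases hl hlk hP with ⟨z, hz, hx, rfl⟩ | ⟨a, rfl, hw, ha⟩
      · exact ⟨z, ⟨hz, hx, (S.isCriticalPoint_realPoint hN hN' hl hlk hz hx).1 hc⟩, rfl⟩
      · have hB := R.gap_right_neg hl hlk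
        refine absurd ?_ hχ
        rcases ha with ha | ha
        · exact (S.isCriticalPoint_branch_iff a ha hw ((R.gap_left_lt_right hl hlk).trans hB)).1 hc
        · exact (S.isCriticalPoint_branch_iff a ha hw hB).1 hc
    · rintro ⟨z, ⟨hz, hx, h⟩, rfl⟩
      exact ⟨S.realPoint_mem_loop hl hlk hz hx,
        (S.isCriticalPoint_realPoint hN hN' hl hlk hz hx).2 h⟩
  have hinj : InjOn (fun z => (realPoint p₀ z : Surface p₀)) {z | IsGapZero k p₀ N χ η 1 l z} :=
    fun z hz z' hz' h => S.realPoint_inj hl hlk hz.1 hz.2.1 hz'.1 hz'.2.1 h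
  rw [hA, hinj.encard_image, encard_ge_four_iff,
    (S.gapData hN hN').mem_smoothGap_iff' hl hlk (c := (χ, η)) hχ]
  rfl

/-- For χ = 0 the two branch points of the loop are critical for every η. Four critical points
therefore occur exactly when some x in the gap solves the linear equation, which gives the pair (x,
±√p₀(x)). -/
theorem four_le_encard_axis_iff {η : ℝ} :
    4 ≤ {P : Surface p₀ | P ∈ loop p₀ l ∧ IsCriticalPoint α β q 0 η P}.encard ↔
      ((0 : ℝ), η) ∈ smoothGap k p₀ N l := by
  have R := S.nonposRooted
  have hk := (S.gapData hN hN').k_pos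
  have hAB := R.gap_left_lt_right hl hlk
  have hB := R.gap_right_neg hl hlk
  have hcrit : ∀ z : ℝ × ℝ, (z.1 = 1 ∨ z.1 = -1) → z.2 ∈ gap p₀ l →
      (IsCriticalPoint α β q 0 η (realPoint p₀ z : Surface p₀) ↔ η * (z.2 - 1) = z.2 + 1) := by
    intro z hz hx
    have hs := Real.sqrt_pos.2 (R.eval_gap_pos hl hlk hx)
    rw [S.isCriticalPoint_realPoint hN hN' hl hlk hz hx, critFun, mul_zero, zero_mul, sub_zero,
      one_mul, mul_eq_zero, sub_eq_zero, or_iff_right (by positivity)]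
  rw [(S.gapData hN hN').mem_smoothGap_axis hl hlk]
  set A := {P : Surface p₀ | P ∈ loop p₀ l ∧ IsCriticalPoint α β q 0 η P} with hA
  set f : Surface p₀ → ℂ × ℂ := fun P => (zCoord P, wCoord P) with hf
  constructor
  · intro h
    by_contra hno
    have hinj : InjOn f A := by
      rintro P ⟨⟨a, rfl, -⟩, -⟩ Q ⟨⟨b, rfl, -⟩, -⟩ hPQ
      exact surface_ext (OnePoint.coe_ne_infty _) (OnePoint.coe_ne_infty _)
        (congrArg Prod.fst hPQ) (congrArg Prod.snd hPQ)
    have hsub : f '' A ⊆ {((branchPoint p₀ (2 * l) : ℂ), (0 : ℂ)),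
        ((branchPoint p₀ (2 * l - 1) : ℂ), (0 : ℂ))} := by
      rintro _ ⟨P, ⟨hP, hc⟩, rfl⟩
      rcases S.loop_cases hl hlk hP with ⟨z, hz, hx, rfl⟩ | ⟨a, rfl, hw, ha⟩
      · exact absurd ⟨z.2, hx, (hcrit z hz hx).1 hc⟩ hno
      · rcases ha with ha | ha
        · exact Or.inl (Prod.ext ha hw)
        · exact Or.inr (Prod.ext ha hw)
    have h1 := h.trans (hinj.encard_image.symm.le.trans (encard_le_encard hsub))
    have h2 := h1.trans (encard_insert_le _ _)
    rw [encard_singleton] at h2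
    exact absurd h2 (by decide)
  · rintro ⟨x, hx, hxη⟩
    have hp := R.eval_gap_pos hl hlk hx
    have hs := Real.sqrt_pos.2 hp
    have hbranch : ∀ y, y < 0 → p₀.eval y = 0 →
        y ∈ Icc (branchPoint p₀ (2 * l)) (branchPoint p₀ (2 * l - 1)) → ((y : ℂ), (0 : ℂ)) ∈ f '' A := by
      intro y hy hy0 hyI
      have hv : (curvePoint p₀ (y : ℂ) 0).1 = ((y : ℂ), (0 : ℂ)) := curvePoint_val (by
        rw [aeval_ofReal, hy0]
        simp)
      refine ⟨(curvePoint p₀ (y : ℂ) 0 : AffineCurve p₀), ⟨⟨_, rfl, y, hyI, by rw [hv]⟩, ?_⟩, ?_⟩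
      · exact (S.isCriticalPoint_branch_iff _ (x := y) (by rw [hv]) (by rw [hv]) hy).2 rfl
      · rw [hf]
        simp only [zCoord_coe, wCoord_coe, hv]
    have hreal : ∀ z : ℝ × ℝ, (z.1 = 1 ∨ z.1 = -1) → z.2 = x →
        ((x : ℂ), ((z.1 * √(p₀.eval x) : ℝ) : ℂ)) ∈ f '' A := by
      rintro ⟨σ, y⟩ hz rfl
      refine ⟨(realPoint p₀ (σ, y) : AffineCurve p₀),
        ⟨S.realPoint_mem_loop hl hlk hz hx, (hcrit _ hz hx).2 hxη⟩, ?_⟩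
      rw [hf]
      simp only [zCoord_coe, wCoord_coe, realPoint_val hz hp.le]
    have h1 := hbranch _ (hAB.trans hB) (R.eval_left hlk) ⟨le_rfl, hAB.le⟩
    have h2 := hbranch _ hB (R.eval_right hl hlk) ⟨hAB.le, le_rfl⟩
    have h3 := hreal (1, x) (Or.inl rfl) rfl
    have h4 := hreal (-1, x) (Or.inr rfl) rfl
    have hsub : {((branchPoint p₀ (2 * l) : ℂ), (0 : ℂ)), ((branchPoint p₀ (2 * l - 1) : ℂ), (0 : ℂ)),
        ((x : ℂ), ((1 * √(p₀.eval x) : ℝ) : ℂ)), ((x : ℂ), ((-1 * √(p₀.eval x) : ℝ) : ℂ))} ⊆ f '' A := by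
      rintro P (rfl | rfl | rfl | rfl)
      exacts [h1, h2, h3, h4]
    refine le_trans ?_ ((encard_le_encard hsub).trans (encard_image_le _ _))
    have n1 : branchPoint p₀ (2 * l) ≠ x := hx.1.ne
    have n2 : branchPoint p₀ (2 * l - 1) ≠ x := hx.2.ne'
    have n3 : (1 * √(p₀.eval x) : ℝ) ≠ -1 * √(p₀.eval x) := by
      intro h
      linarith
    rw [encard_insert_of_notMem, encard_insert_of_notMem, encard_insert_of_notMem, encard_singleton]
    · decide
    · simp only [mem_singleton_iff, Prod.mk.injEq, Complex.ofReal_inj, true_and]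
      exact n3
    · simp only [mem_insert_iff, mem_singleton_iff, Prod.mk.injEq, Complex.ofReal_inj, n2, false_and,
        or_self, not_false_eq_true]
    · simp only [mem_insert_iff, mem_singleton_iff, Prod.mk.injEq, Complex.ofReal_inj, n1, hAB.ne,
        false_and, or_self, not_false_eq_true]

omit hl hlk in
-- The restriction to the square (-1,1)² costs nothing, by `smoothGap_subset`.
theorem smoothRegion_eq : smoothRegion α β p₀ q =
    ⋃ i : Fin (kPrime p₀ - 1), smoothGap k p₀ N (i + 1) := by
  ext c
  have key : ∀ l, 1 ≤ l → l < kPrime p₀ →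
      (4 ≤ {P : Surface p₀ | P ∈ loop p₀ l ∧ IsCriticalPoint α β q c.1 c.2 P}.encard ↔
        c ∈ smoothGap k p₀ N l) := by
    intro l hl hlk
    obtain ⟨χ, η⟩ := c
    rcases eq_or_ne χ 0 with rfl | hχ
    · exact S.four_le_encard_axis_iff hN hN' hl hlk
    · exact S.four_le_encard_iff hN hN' hl hlk hχ
  rw [mem_iUnion]
  constructor
  · rintro ⟨-, -, l, hl, hlk, h⟩
    refine ⟨⟨l - 1, by omega⟩, ?_⟩
    rw [Nat.sub_add_cancel hl]
    exact (key l hl hlk).1 h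
  · rintro ⟨i, hi⟩
    have hi1 : 1 ≤ (i : ℕ) + 1 := by omega
    have hi2 : (i : ℕ) + 1 < kPrime p₀ := by omega
    obtain ⟨h1, h2⟩ := (S.gapData hN hN').smoothGap_subset hi1 hi2 hi
    exact ⟨h1, h2, i + 1, hi1, hi2, (key _ hi1 hi2).2 hi⟩

omit hN hN' hl hlk in
theorem enatCard_components : ENat.card (ConnectedComponents (smoothRegion α β p₀ q)) =
    ((kPrime p₀ - 1 : ℕ) : ℕ∞) := by
  obtain ⟨N, hN, hN'⟩ := S.exists_numerator
  have G := S.gapData hN hN'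
  have h := enatCard_connectedComponents (S.smoothRegion_eq hN hN')
    (fun i => isOpen_smoothGap k p₀ N (i + 1))
    (fun i => G.isPreconnected_smoothGap (by omega) (by omega))
    (fun i => G.smoothGap_nonempty (by omega) (by omega))
    (fun i j hij => G.disjoint_smoothGap (by omega) (by omega) (by omega) (by omega)
      fun h => hij (Fin.ext (by omega)))
  rw [h, Fintype.card_fin]

end SpectralData
end AztecDiamond

namespace AztecDiamond

/-! ### Removable singularities and growth -/

theorem exists_analytic_extension {f : ℂ → ℂ} {c : ℂ} (hd : ∀ᶠ z in 𝓝[≠] c, DifferentiableAt ℂ f z)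
    {M : ℝ} (hb : ∀ᶠ z in 𝓝[≠] c, ‖f z‖ ≤ M) : ∃ F, AnalyticAt ℂ F c ∧ f =ᶠ[𝓝[≠] c] F := by
  set s := insert c {z | DifferentiableAt ℂ f z ∧ ‖f z‖ ≤ M} with hs
  have hsc : s ∈ 𝓝 c := insert_mem_nhds_iff.2 (hd.and hb)
  have h := Complex.differentiableOn_update_limUnder_of_bddAbove (f := f) (c := c) (s := s) hsc
    (fun z hz => (hz.1.resolve_left hz.2).1.differentiableWithinAt)
    ⟨M, by
      rintro _ ⟨z, hz, rfl⟩
      exact (hz.1.resolve_left hz.2).2⟩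
  refine ⟨_, h.analyticAt hsc, ?_⟩
  filter_upwards [self_mem_nhdsWithin] with z hz
  exact (Function.update_of_ne hz _ _).symm

theorem limUnder_eq_of_extension {f F : ℂ → ℂ} {c : ℂ} (hF : ContinuousAt F c)
    (h : f =ᶠ[𝓝[≠] c] F) : limUnder (𝓝[≠] c) f = F c :=
  ((hF.tendsto.mono_left nhdsWithin_le_nhds).congr' h.symm).limUnder_eq

theorem eventually_limUnder_eq {f F : ℂ → ℂ} {c : ℂ} (hF : AnalyticAt ℂ F c)
    (h : f =ᶠ[𝓝[≠] c] F) : (fun s => limUnder (𝓝[≠] s) f) =ᶠ[𝓝 c] F := by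
  have h1 : ∀ᶠ s in 𝓝[≠] c, f =ᶠ[𝓝 s] F := by
    filter_upwards [eventually_eventually_nhdsWithin.2 h, self_mem_nhdsWithin] with s hs hsc
    change ∀ᶠ x in 𝓝 s, f x = F x
    rwa [(isOpen_compl_singleton (x := c)).nhdsWithin_eq hsc] at hs
  rw [eventually_nhdsWithin_iff] at h1
  filter_upwards [h1, hF.eventually_analyticAt] with s h2 h3
  refine limUnder_eq_of_extension h3.continuousAt ?_
  by_cases hs : s = c
  · rw [hs]
    exact h
  · exact (h2 hs).filter_mono nhdsWithin_le_nhds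

/-- An entire function of polynomial growth is a polynomial. -/
theorem exists_polynomial_of_growth {F : ℂ → ℂ} (hF : Differentiable ℂ F) {g : ℕ} {C M : ℝ}
    (h : ∀ z, M < ‖z‖ → ‖F z‖ * ‖z‖ ≤ C * ‖z‖ ^ g) :
    ∃ a ∈ degreeLT ℂ g, ∀ z, F z = a.eval z := by
  induction g generalizing F C M with
  | zero =>
    refine ⟨0, zero_mem _, fun z => ?_⟩
    rw [eval_zero]
    -- For g = 0 the bound is C/|z|, so F tends to 0 at infinity and vanishes by Liouville's
    -- theorem.
    refine hF.apply_eq_of_tendsto_cocompact z ?_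
    rw [tendsto_zero_iff_norm_tendsto_zero]
    have h1 : Tendsto (fun z : ℂ => C / ‖z‖) (cocompact ℂ) (𝓝 0) :=
      (tendsto_norm_cocompact_atTop (E := ℂ)).const_div_atTop C
    refine squeeze_zero' (Eventually.of_forall fun _ => norm_nonneg _) ?_ h1
    filter_upwards [(tendsto_norm_cocompact_atTop (E := ℂ)).eventually_gt_atTop (max M 0)] with z hz
    rw [le_div_iff₀ ((le_max_right _ _).trans_lt hz)]
    simpa using h z ((le_max_left _ _).trans_lt hz)
  | succ g ih =>
    -- The quotient (F - F(0))/z is entire and its growth exponent is one less.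
    have hG : Differentiable ℂ (dslope F 0) := by
      rw [← differentiableOn_univ, Complex.differentiableOn_dslope univ_mem]
      exact hF.differentiableOn
    have hGz : ∀ z, z * dslope F 0 z = F z - F 0 := fun z => by
      simpa using sub_smul_dslope F 0 z
    obtain ⟨b, hb, hbz⟩ := ih hG (C := C + ‖F 0‖) (M := max M 1) fun z hz => by
      have h1 : 1 < ‖z‖ := (le_max_right _ _).trans_lt hz
      have h2 := h z ((le_max_left _ _).trans_lt hz)
      have h3 : ‖F z‖ ≤ C * ‖z‖ ^ g := by
        rw [pow_succ, ← mul_assoc] at h2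
        exact le_of_mul_le_mul_right h2 (one_pos.trans h1)
      have h4 : 1 ≤ ‖z‖ ^ g := one_le_pow₀ h1.le
      rw [← norm_mul, mul_comm, hGz]
      refine (norm_sub_le _ _).trans ?_
      nlinarith [norm_nonneg (F 0)]
    refine ⟨Polynomial.C (F 0) + X * b, ?_, fun z => ?_⟩
    · rw [mem_degreeLT] at hb ⊢
      refine (degree_add_le _ _).trans_lt (max_lt ?_ ?_)
      · exact degree_C_le.trans_lt (by exact_mod_cast g.succ_pos)
      · rcases eq_or_ne b 0 with rfl | hb0
        · rw [mul_zero, degree_zero]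
          exact WithBot.bot_lt_coe _
        · rw [degree_mul, degree_X, degree_eq_natDegree hb0] at *
          norm_cast at hb ⊢
          omega
    · rw [eval_add, eval_C, eval_mul, eval_X, ← hbz, hGz]
      ring

/-- Bounded singularities are removable; the limit `limUnder` defines the entire extension. -/
theorem exists_polynomial_of_growth_off_finite {f : ℂ → ℂ} {R : Set ℂ} (hR : R.Finite)
    (hf : ∀ z ∉ R, AnalyticAt ℂ f z) (hb : ∀ z ∈ R, ∃ B : ℝ, ∀ᶠ s in 𝓝[≠] z, ‖f s‖ ≤ B) {g : ℕ}
    {C M : ℝ} (h : ∀ z ∉ R, M < ‖z‖ → ‖f z‖ * ‖z‖ ≤ C * ‖z‖ ^ g) :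
    ∃ a ∈ degreeLT ℂ g, ∀ z ∉ R, f z = a.eval z := by
  have hRe : ∀ z, ∀ᶠ s in 𝓝[≠] z, s ∉ R := fun z => by
    have : (R \ {z})ᶜ ∈ 𝓝 z := (hR.subset sdiff_subset).isClosed.isOpen_compl.mem_nhds (by simp)
    filter_upwards [nhdsWithin_le_nhds this, self_mem_nhdsWithin] with s h1 h2 h3
    exact h1 ⟨h3, h2⟩
  have hext : ∀ z, ∃ F, AnalyticAt ℂ F z ∧ f =ᶠ[𝓝[≠] z] F := fun z => by
    by_cases hz : z ∈ R
    · obtain ⟨B, hB⟩ := hb z hz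
      exact exists_analytic_extension ((hRe z).mono fun s hs => (hf s hs).differentiableAt) hB
    · exact ⟨f, hf z hz, EventuallyEq.rfl⟩
  set F : ℂ → ℂ := fun s => limUnder (𝓝[≠] s) f with hF
  have hFd : Differentiable ℂ F := fun z => by
    obtain ⟨Φ, h1, h2⟩ := hext z
    exact (h1.congr (eventually_limUnder_eq h1 h2).symm).differentiableAt
  have hFf : ∀ z ∉ R, F z = f z := fun z hz =>
    limUnder_eq_of_extension (hf z hz).continuousAt EventuallyEq.rfl
  obtain ⟨B, hB⟩ := hR.isBounded.exists_norm_le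
  obtain ⟨a, ha, hav⟩ := exists_polynomial_of_growth hFd (M := max M B) (C := C) (g := g) fun z hz => by
    have hzR : z ∉ R := fun h' => ((le_max_right _ _).trans_lt hz).not_ge (hB z h')
    rw [hFf z hzR]
    exact h z hzR ((le_max_left _ _).trans_lt hz)
  exact ⟨a, ha, fun z hz => by rw [← hFf z hz, hav]⟩

theorem norm_eval_mul_le {g : ℕ} {a : ℂ[X]} (ha : a ∈ degreeLT ℂ g) :
    ∃ C : ℝ, ∀ z : ℂ, 1 ≤ ‖z‖ → ‖a.eval z‖ * ‖z‖ ≤ C * ‖z‖ ^ g := by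
  refine ⟨∑ i ∈ a.support, ‖a.coeff i‖, fun z hz => ?_⟩
  rw [eval_eq_sum, Polynomial.sum, Finset.sum_mul]
  refine (mul_le_mul_of_nonneg_right (norm_sum_le _ _) (norm_nonneg _)).trans ?_
  rw [Finset.sum_mul]
  refine Finset.sum_le_sum fun i hi => ?_
  rw [norm_mul, norm_pow, mul_assoc, ← pow_succ]
  refine mul_le_mul_of_nonneg_left (pow_le_pow_right₀ hz ?_) (norm_nonneg _)
  have h1 := (le_degree_of_mem_supp i hi).trans_lt (mem_degreeLT.1 ha)
  exact_mod_cast h1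

/-- Two-sided growth bound for a polynomial. -/
theorem norm_aeval_bounds {p : ℝ[X]} (hp : p ≠ 0) : ∃ c C M : ℝ, 0 < c ∧ 0 ≤ C ∧ 1 ≤ M ∧ ∀ z : ℂ, M < ‖z‖ →
    c * ‖z‖ ^ p.natDegree ≤ ‖aeval z p‖ ∧ ‖aeval z p‖ ≤ C * ‖z‖ ^ p.natDegree := by
  set L := ‖(p.leadingCoeff : ℂ)‖ with hL
  have hL0 : 0 < L := by
    rw [hL, norm_pos_iff]
    exact_mod_cast leadingCoeff_ne_zero.2 hp
  have hc : Tendsto (fun s : ℂ => ‖aeval s p.reverse‖) (𝓝 0) (𝓝 L) := by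
    have : Continuous fun s : ℂ => ‖aeval s p.reverse‖ := (p.reverse.continuous_aeval (A := ℂ)).norm
    have := this.tendsto 0
    rwa [aeval_reverse_zero] at this
  have h1 := hc.eventually (Ioo_mem_nhds (show L / 2 < L by linarith) (show L < 2 * L by linarith))
  obtain ⟨ε, hε, h2⟩ := Metric.eventually_nhds_iff_ball.1 h1
  refine ⟨L / 2, 2 * L, max 1 ε⁻¹, by positivity, by positivity, le_max_left _ _, fun z hz => ?_⟩
  have hz1 : 0 < ‖z‖ := one_pos.trans ((le_max_left _ _).trans_lt hz)
  have h3 : z⁻¹ ∈ Metric.ball (0 : ℂ) ε := by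
    rw [mem_ball_zero_iff, norm_inv]
    exact inv_lt_of_inv_lt₀ hε ((le_max_right _ _).trans_lt hz)
  have h4 := h2 _ h3
  rw [← aeval_reverse_eq p (norm_pos_iff.1 hz1), norm_mul, norm_pow]
  have h5 : 0 ≤ ‖z‖ ^ p.natDegree := by positivity
  exact ⟨mul_le_mul_of_nonneg_right h4.1.le h5, mul_le_mul_of_nonneg_right h4.2.le h5⟩

/-! ### Changes of coordinates -/

section Transition

variable {p₀ : ℝ[X]}

/-- The default value of `wCoord` at ∞ is 0, so the single condition w ≠ 0 excludes the branch
points and ∞ alike. Below it singles out the complement of a finite set. -/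
theorem ne_infty_of_wCoord {P : Surface p₀} (h : wCoord P ≠ 0) : P ≠ ∞ := by
  rintro rfl
  exact h rfl

theorem finite_rootSet (h : p₀ ≠ 0) : {z : ℂ | aeval z p₀ = 0}.Finite := by
  refine (p₀.rootSet_finite ℂ).subset fun z hz => ?_
  exact (mem_rootSet_of_ne h).2 hz

theorem finite_wCoord_eq_zero (h : p₀ ≠ 0) : {P : Surface p₀ | wCoord P = 0}.Finite := by
  refine (((finite_rootSet h).image
    fun z => ((curvePoint p₀ z 0 : AffineCurve p₀) : Surface p₀)).insert ∞).subset fun P hP => ?_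
  rcases eq_or_ne P ∞ with rfl | hP'
  · exact Or.inl rfl
  · have h1 := coord_relation hP'
    have hw : wCoord P = 0 := hP
    rw [hw] at h1
    refine Or.inr ⟨zCoord P, ?_, ?_⟩
    · rw [mem_ofPred_eq, ← h1]
      simp
    · have h2 := curvePoint_val h1
      exact surface_ext (OnePoint.coe_ne_infty _) hP' (by rw [zCoord_coe, h2])
        (by rw [wCoord_coe, h2, hw])

theorem eventually_wCoord_ne (h : p₀ ≠ 0) (e : OpenPartialHomeomorph (Surface p₀) ℂ) {t : ℂ}
    (ht : t ∈ e.target) : ∀ᶠ s in 𝓝[≠] t, s ∈ e.target ∧ wCoord (e.symm s) ≠ 0 := by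
  have h1 : (e.target ∩ e.symm ⁻¹' {P : Surface p₀ | wCoord P = 0}).Finite := by
    refine Finite.of_finite_image (f := e.symm) ((finite_wCoord_eq_zero h).subset ?_)
      (e.symm.injOn.mono inter_subset_left)
    rintro _ ⟨s, hs, rfl⟩
    exact hs.2
  have h2 := (h1.subset (sdiff_subset (t := {t}))).isClosed.isOpen_compl.mem_nhds
    (show t ∉ _ \ {t} by simp)
  filter_upwards [nhdsWithin_le_nhds h2, nhdsWithin_le_nhds (e.open_target.mem_nhds ht),
    self_mem_nhdsWithin] with s h3 h4 h5
  exact ⟨h4, fun h6 => h3 ⟨⟨h4, h6⟩, h5⟩⟩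

variable {e e' : OpenPartialHomeomorph (Surface p₀) ℂ} (he : IsHolomorphicChart e)
  (he' : IsHolomorphicChart e')

theorem transition_continuousAt {t : ℂ} (ht : t ∈ e.target) (ht' : e.symm t ∈ e'.source) :
    ContinuousAt (fun s => e' (e.symm s)) t :=
  ContinuousAt.comp (f := e.symm) (e'.continuousAt ht') (e.symm.continuousAt ht)

theorem eventually_mem_source {t : ℂ} (ht : t ∈ e.target) (ht' : e.symm t ∈ e'.source) :
    ∀ᶠ s in 𝓝 t, s ∈ e.target ∧ e.symm s ∈ e'.source :=
  (e.open_target.eventually_mem ht).and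
    ((e.symm.continuousAt ht).eventually_mem (e'.open_source.mem_nhds ht'))

include he he'

theorem transition_hasDerivAt {t : ℂ} (ht : t ∈ e.target) (ht' : e.symm t ∈ e'.source)
    (hw : wCoord (e.symm t) ≠ 0) :
    ∃ d, HasDerivAt (fun s => e' (e.symm s)) d t ∧ deriv (fun s => zCoord (e.symm s)) t =
      deriv (fun s => zCoord (e'.symm s)) (e' (e.symm t)) * d := by
  have hi := e'.left_inv ht'
  have hti := ne_infty_of_wCoord hw
  have hz := (he.analyticAt_z t ht hti).differentiableAt.hasDerivAt
  have hz' := (he'.analyticAt_z _ (e'.map_source ht') (by rwa [hi])).differentiableAt.hasDerivAt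
  have h0 := he'.deriv_z_ne_zero (e'.map_source ht') (by rwa [hi]) (by rwa [hi])
  have hev : (fun s => zCoord (e.symm s)) =ᶠ[𝓝 t]
      (fun s => zCoord (e'.symm s)) ∘ fun s => e' (e.symm s) := by
    filter_upwards [eventually_mem_source ht ht'] with s hs
    simp only [Function.comp_apply, e'.left_inv hs.2]
  have hd := HasDerivAt.of_comp_left (f := fun s => zCoord (e'.symm s)) (transition_continuousAt ht ht') hz'
    hz h0 hev.symm
  exact ⟨_, hd, (mul_div_cancel₀ _ h0).symm⟩

/-- Away from the finitely many points with w = 0 both charts are locally functions of z, so the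
transition is differentiable; at the others continuity makes the singularity removable. -/
theorem transition_analyticAt (h : p₀ ≠ 0) {t : ℂ} (ht : t ∈ e.target) (ht' : e.symm t ∈ e'.source) :
    AnalyticAt ℂ (fun s => e' (e.symm s)) t := by
  refine Complex.analyticAt_of_differentiable_on_punctured_nhds_of_continuousAt ?_
    (transition_continuousAt ht ht')
  filter_upwards [eventually_wCoord_ne h e ht,
    nhdsWithin_le_nhds (eventually_mem_source ht ht')] with s hs hs'
  obtain ⟨d, hd, -⟩ := transition_hasDerivAt he he' hs.1 hs'.2 hs.2
  exact hd.differentiableAt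

end Transition

end AztecDiamond

namespace AztecDiamond

/-! ### The holomorphic forms `a(z) dz / w` -/

/-- The hyperelliptic curve `w² = p₀(z)` is smooth, of odd degree `2 g + 1`. -/
structure IsOddCurve (p₀ : ℝ[X]) (g : ℕ) : Prop where
  lead : 0 < p₀.leadingCoeff
  deg : p₀.natDegree = 2 * g + 1
  sep : p₀.Separable

/-- The coefficient of `a(z) dz / w` in the chart `e`. -/
noncomputable def formCoeff {p₀ : ℝ[X]} (a : ℂ[X]) (e : OpenPartialHomeomorph (Surface p₀) ℂ)
    (s : ℂ) : ℂ :=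
  a.eval (zCoord (e.symm s)) * deriv (fun s => zCoord (e.symm s)) s / wCoord (e.symm s)

section Coeff

variable {p₀ : ℝ[X]} {e e' : OpenPartialHomeomorph (Surface p₀) ℂ} (he : IsHolomorphicChart e)
  (he' : IsHolomorphicChart e') (a : ℂ[X])
include he

theorem formCoeff_analyticAt {t : ℂ} (ht : t ∈ e.target) (hw : wCoord (e.symm t) ≠ 0) :
    AnalyticAt ℂ (formCoeff a e) t := by
  have hti := ne_infty_of_wCoord hw
  have hz := he.analyticAt_z t ht hti
  have h1 : AnalyticAt ℂ (fun s => a.eval (zCoord (e.symm s))) t := by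
    have := hz.aeval_polynomial a
    simpa only [coe_aeval_eq_eval] using this
  exact (h1.mul hz.deriv).div (he.analyticAt_w t ht hti) hw

include he' in
theorem formCoeff_transition {t : ℂ} (ht : t ∈ e.target) (ht' : e.symm t ∈ e'.source)
    (hw : wCoord (e.symm t) ≠ 0) :
    formCoeff a e t = formCoeff a e' (e' (e.symm t)) * deriv (fun s => e' (e.symm s)) t := by
  obtain ⟨d, hd, hd'⟩ := transition_hasDerivAt he he' ht ht' hw
  rw [formCoeff, formCoeff, e'.left_inv ht', hd.deriv, hd']
  ring

omit he in
theorem transition_tendsto_ne {t : ℂ} (ht : t ∈ e.target) (ht' : e.symm t ∈ e'.source) :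
    Tendsto (fun s => e' (e.symm s)) (𝓝[≠] t) (𝓝[≠] (e' (e.symm t))) := by
  refine tendsto_nhdsWithin_iff.2 ⟨(transition_continuousAt ht ht').tendsto.mono_left
    nhdsWithin_le_nhds, ?_⟩
  filter_upwards [nhdsWithin_le_nhds (eventually_mem_source ht ht'), self_mem_nhdsWithin]
    with s hs hst h
  exact hst (e.symm.injOn hs.1 ht (e'.injOn hs.2 ht' h))

/-- Extensions can be transported to other charts. -/
theorem exists_extension_of_transition (h0 : p₀ ≠ 0) (he' : IsHolomorphicChart e') {t : ℂ}
    (ht : t ∈ e.target) (ht' : e.symm t ∈ e'.source)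
    (h : ∃ F, AnalyticAt ℂ F (e' (e.symm t)) ∧ formCoeff a e' =ᶠ[𝓝[≠] (e' (e.symm t))] F) :
    ∃ F, AnalyticAt ℂ F t ∧ formCoeff a e =ᶠ[𝓝[≠] t] F := by
  obtain ⟨F, hF, hFe⟩ := h
  have hφ := transition_analyticAt he he' h0 ht ht'
  refine ⟨fun s => F (e' (e.symm s)) * deriv (fun s => e' (e.symm s)) s,
    (hF.fun_comp (f := fun s => e' (e.symm s)) hφ).mul hφ.deriv, ?_⟩
  filter_upwards [(transition_tendsto_ne ht ht').eventually hFe,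
    eventually_wCoord_ne h0 e ht, nhdsWithin_le_nhds (eventually_mem_source ht ht')] with s h1 h2 h3
  rw [formCoeff_transition he he' a h3.1 h3.2 h2.2, h1]

/-- At a simple branch point the form is holomorphic. -/
theorem exists_extension_branch {t : ℂ} (ht : t ∈ e.target) (hti : e.symm t ≠ ∞)
    (hd : aeval (zCoord (e.symm t)) (derivative p₀) ≠ 0) (h0 : p₀ ≠ 0) :
    ∃ F, AnalyticAt ℂ F t ∧ formCoeff a e =ᶠ[𝓝[≠] t] F := by
  have hz := he.analyticAt_z t ht hti
  have h1 : AnalyticAt ℂ (fun s => a.eval (zCoord (e.symm s))) t := by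
    have := hz.aeval_polynomial a
    simpa only [coe_aeval_eq_eval] using this
  have h2 : AnalyticAt ℂ (fun s => aeval (zCoord (e.symm s)) (derivative p₀)) t :=
    hz.aeval_polynomial _
  refine ⟨fun s => a.eval (zCoord (e.symm s)) * (2 * deriv (fun s => wCoord (e.symm s)) s /
    aeval (zCoord (e.symm s)) (derivative p₀)),
    h1.mul ((analyticAt_const.mul (he.analyticAt_w t ht hti).deriv).div h2 hd), ?_⟩
  filter_upwards [eventually_wCoord_ne h0 e ht, nhdsWithin_le_nhds (h2.continuousAt.eventually_ne hd)]
    with s hs hs'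
  have hr := he.deriv_relation hs.1 (ne_infty_of_wCoord hs.2)
  have hw := hs.2
  rw [formCoeff, mul_div_assoc]
  congr 1
  rw [div_eq_div_iff hw hs']
  linear_combination -hr

end Coeff

namespace IsOddCurve

variable {p₀ : ℝ[X]} {g : ℕ} (K : IsOddCurve p₀ g)
include K

theorem ne_zero : p₀ ≠ 0 := by
  intro h
  have := K.lead
  simp [h] at this

theorem derivative_ne_zero {z : ℂ} (h : aeval z p₀ = 0) : aeval z (derivative p₀) ≠ 0 :=
  K.sep.aeval_derivative_ne_zero h

/-- The chart at infinity, with the size of the derivative of `z`. -/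
theorem exists_chart_infty : ∃ e : OpenPartialHomeomorph (Surface p₀) ℂ, IsHolomorphicChart e ∧
    ∞ ∈ e.source ∧ ∀ t ∈ e.target, e.symm t ≠ ∞ →
      ‖deriv (fun s => zCoord (e.symm s)) t‖ ^ 2 = 4 * ‖zCoord (e.symm t)‖ ^ 3 := by
  obtain ⟨e, he, hs, he0, hP, -⟩ := exists_infty_chart K.lead K.deg
  refine ⟨e, he, hs, fun t ht hti => ?_⟩
  have hz : ∀ s ∈ e.target, e.symm s ≠ ∞ → s ≠ 0 ∧ zCoord (e.symm s) = (s ^ 2)⁻¹ := by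
    intro s hs' hsi
    have h1 := hP _ (e.map_target hs') hsi
    rw [e.right_inv hs'] at h1
    refine ⟨?_, by rw [h1.2.2, inv_inv]⟩
    rintro rfl
    rw [← he0, e.left_inv hs] at hsi
    exact hsi rfl
  have ht0 := (hz t ht hti).1
  have hd : HasDerivAt (fun s : ℂ => (s ^ 2)⁻¹) (-(2 * t) / (t ^ 2) ^ 2) t :=
    ((hasDerivAt_pow 2 t).inv (pow_ne_zero 2 ht0)).congr_deriv (by simp)
  have hev : (fun s => zCoord (e.symm s)) =ᶠ[𝓝 t] fun s => (s ^ 2)⁻¹ := by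
    filter_upwards [IsHolomorphicChart.eventually_affine ht hti] with s hs using (hz s hs.1 hs.2).2
  rw [hev.deriv_eq, hd.deriv, (hz t ht hti).2, norm_div, norm_neg, norm_mul, norm_inv, norm_pow,
    norm_pow, Complex.norm_ofNat]
  have := norm_ne_zero_iff.2 ht0
  field_simp
  norm_num

/-- The coefficient a(z)z'/w is bounded near ∞: |a| = O(|z|^{g-1}), |z'| = 2|z|^{3/2}, and |w| is at
least a constant times |z|^{g+1/2}. The singularity is removable. -/
theorem exists_extension_infty {a : ℂ[X]} (ha : a ∈ degreeLT ℂ g)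
    {e : OpenPartialHomeomorph (Surface p₀) ℂ} (he : IsHolomorphicChart e) (hs : ∞ ∈ e.source)
    (hd : ∀ t ∈ e.target, e.symm t ≠ ∞ →
      ‖deriv (fun s => zCoord (e.symm s)) t‖ ^ 2 = 4 * ‖zCoord (e.symm t)‖ ^ 3) :
    ∃ F, AnalyticAt ℂ F (e ∞) ∧ formCoeff a e =ᶠ[𝓝[≠] (e ∞)] F := by
  have ht := e.map_source hs
  obtain ⟨A, hA⟩ := norm_eval_mul_le ha
  obtain ⟨c, B, M, hc, -, hM, hB⟩ := norm_aeval_bounds K.ne_zero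
  have hz : Tendsto (fun s => ‖zCoord (e.symm s)‖) (𝓝[≠] (e ∞)) atTop := by
    refine tendsto_zCoord_infty.comp (tendsto_nhdsWithin_iff.2 ⟨?_, ?_⟩)
    · have := (e.symm.continuousAt ht).tendsto
      rw [e.left_inv hs] at this
      exact this.mono_left nhdsWithin_le_nhds
    · filter_upwards [eventually_wCoord_ne K.ne_zero e ht] with s h1
      exact ne_infty_of_wCoord h1.2
  refine exists_analytic_extension (M := √(4 * A ^ 2 / c)) ?_ ?_
  · filter_upwards [eventually_wCoord_ne K.ne_zero e ht] with s h1
    exact (formCoeff_analyticAt he a h1.1 h1.2).differentiableAt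
  · filter_upwards [eventually_wCoord_ne K.ne_zero e ht, hz.eventually_gt_atTop M] with s h1 h2
    have hi := ne_infty_of_wCoord h1.2
    have h3 := hA _ (hM.trans h2.le)
    have h4 := (hB _ h2).1
    rw [← coord_relation hi, norm_pow, K.deg] at h4
    have h5 := hd s h1.1 hi
    have hw := norm_pos_iff.2 h1.2
    have hx : 0 < ‖zCoord (e.symm s)‖ := one_pos.trans_le (hM.trans h2.le)
    refine Real.le_sqrt_of_sq_le ?_
    rw [formCoeff, norm_div, norm_mul, div_pow, mul_pow, h5, div_le_div_iff₀ (by positivity) hc]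
    generalize ‖zCoord (e.symm s)‖ = x at *
    generalize ‖wCoord (e.symm s)‖ = w at *
    have h6 : (‖a.eval (zCoord (e.symm s))‖ * x) ^ 2 ≤ (A * x ^ g) ^ 2 :=
      pow_le_pow_left₀ (by positivity) h3 2
    have e1 : x ^ (2 * g + 1) = (x ^ g) ^ 2 * x := by ring
    rw [e1] at h4
    calc ‖a.eval (zCoord (e.symm s))‖ ^ 2 * (4 * x ^ 3) * c
        = 4 * c * x * (‖a.eval (zCoord (e.symm s))‖ * x) ^ 2 := by ring
      _ ≤ 4 * c * x * (A * x ^ g) ^ 2 := mul_le_mul_of_nonneg_left h6 (by positivity)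
      _ = 4 * A ^ 2 * (c * ((x ^ g) ^ 2 * x)) := by ring
      _ ≤ 4 * A ^ 2 * w ^ 2 := mul_le_mul_of_nonneg_left h4 (by positivity)

theorem exists_extension {a : ℂ[X]} (ha : a ∈ degreeLT ℂ g)
    {e : OpenPartialHomeomorph (Surface p₀) ℂ} (he : IsHolomorphicChart e) {t : ℂ}
    (ht : t ∈ e.target) : ∃ F, AnalyticAt ℂ F t ∧ formCoeff a e =ᶠ[𝓝[≠] t] F := by
  by_cases hti : e.symm t = ∞
  · obtain ⟨e', he', hs', hd'⟩ := K.exists_chart_infty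
    refine exists_extension_of_transition he a K.ne_zero he' ht (by rwa [hti]) ?_
    rw [hti]
    exact K.exists_extension_infty ha he' hs' hd'
  by_cases hw : wCoord (e.symm t) = 0
  · refine exists_extension_branch he a ht hti (K.derivative_ne_zero ?_) K.ne_zero
    rw [← coord_relation hti, hw]
    simp
  · exact ⟨_, formCoeff_analyticAt he a ht hw, EventuallyEq.rfl⟩

end IsOddCurve

open Classical in
/-- The form `a(z) dz / w`. -/
noncomputable def formOf {p₀ : ℝ[X]} (a : ℂ[X]) (e : surfaceAtlas p₀) (t : ℂ) : ℂ :=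
  if t ∈ e.1.target then limUnder (𝓝[≠] t) (formCoeff a e.1) else 0

theorem formOf_notMem {p₀ : ℝ[X]} (a : ℂ[X]) (e : surfaceAtlas p₀) {t : ℂ} (ht : t ∉ e.1.target) :
    formOf a e t = 0 := if_neg ht

namespace IsOddCurve

variable {p₀ : ℝ[X]} {g : ℕ} (K : IsOddCurve p₀ g) {a : ℂ[X]} (ha : a ∈ degreeLT ℂ g)
  (e : surfaceAtlas p₀)
include K ha

theorem exists_formOf_eq {t : ℂ} (ht : t ∈ e.1.target) :
    ∃ F, AnalyticAt ℂ F t ∧ formCoeff a e.1 =ᶠ[𝓝[≠] t] F ∧ formOf a e =ᶠ[𝓝 t] F := by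
  obtain ⟨F, hF, hFe⟩ := K.exists_extension ha e.2 ht
  refine ⟨F, hF, hFe, ?_⟩
  filter_upwards [e.1.open_target.mem_nhds ht, eventually_limUnder_eq hF hFe] with s h1 h2
  rw [formOf, if_pos h1, h2]

theorem formOf_analyticAt {t : ℂ} (ht : t ∈ e.1.target) : AnalyticAt ℂ (formOf a e) t := by
  obtain ⟨F, hF, -, h⟩ := K.exists_formOf_eq ha e ht
  exact hF.congr h.symm

theorem tendsto_formCoeff {t : ℂ} (ht : t ∈ e.1.target) :
    Tendsto (formCoeff a e.1) (𝓝[≠] t) (𝓝 (formOf a e t)) := by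
  obtain ⟨F, hF, h1, h2⟩ := K.exists_formOf_eq ha e ht
  rw [h2.self_of_nhds]
  exact (hF.continuousAt.tendsto.mono_left nhdsWithin_le_nhds).congr' h1.symm

theorem formOf_eq {t : ℂ} (ht : t ∈ e.1.target) (hw : wCoord (e.1.symm t) ≠ 0) :
    formOf a e t = formCoeff a e.1 t :=
  tendsto_nhds_unique (K.tendsto_formCoeff ha e ht)
    ((formCoeff_analyticAt e.2 a ht hw).continuousAt.tendsto.mono_left nhdsWithin_le_nhds)

/-- The transformation law holds where w ≠ 0 and passes to the other points by continuity. -/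
theorem formOf_mem : formOf a ∈ holomorphicForms (surfaceAtlas p₀) := by
  refine ⟨fun e t ht => K.formOf_analyticAt ha e ht, fun e t ht => formOf_notMem a e ht,
    fun e e' t ht ht' => ?_⟩
  have hφ := transition_analyticAt e.2 e'.2 K.ne_zero ht ht'
  have h1 : Tendsto (fun s => formOf a e' (e'.1 (e.1.symm s)) * deriv (fun s => e'.1 (e.1.symm s)) s)
      (𝓝[≠] t) (𝓝 (formOf a e' (e'.1 (e.1.symm t)) * deriv (fun s => e'.1 (e.1.symm s)) t)) := by
    refine Tendsto.mono_left ?_ nhdsWithin_le_nhds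
    exact (((K.formOf_analyticAt ha e' (e'.1.map_source ht')).fun_comp
      (f := fun s => e'.1 (e.1.symm s)) hφ).mul hφ.deriv).continuousAt.tendsto
  have h2 := (K.formOf_analyticAt ha e ht).continuousAt.tendsto.mono_left
    (nhdsWithin_le_nhds (s := {t}ᶜ))
  refine tendsto_nhds_unique h2 (h1.congr' ?_)
  filter_upwards [eventually_wCoord_ne K.ne_zero e.1 ht,
    nhdsWithin_le_nhds (eventually_mem_source ht ht')] with s h3 h4
  rw [K.formOf_eq ha e h3.1 h3.2, formCoeff_transition e.2 e'.2 a h3.1 h4.2 h3.2,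
    K.formOf_eq ha e' (e'.1.map_source h4.2) (by rw [e'.1.left_inv h4.2]; exact h3.2)]

omit ha e in
/-- The linear map `a ↦ a(z) dz / w`. -/
noncomputable def formMap : degreeLT ℂ g →ₗ[ℂ] holomorphicForms (surfaceAtlas p₀) where
  toFun a := ⟨formOf a.1, K.formOf_mem a.2⟩
  map_add' a b := by
    refine Subtype.ext (funext fun e => funext fun t => ?_)
    change formOf (a.1 + b.1) e t = formOf a.1 e t + formOf b.1 e t
    by_cases ht : t ∈ e.1.target
    · refine tendsto_nhds_unique (K.tendsto_formCoeff (a + b).2 e ht)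
        (((K.tendsto_formCoeff a.2 e ht).add (K.tendsto_formCoeff b.2 e ht)).congr fun s => ?_)
      simp only [formCoeff, Submodule.coe_add, eval_add]
      ring
    · rw [formOf_notMem _ _ ht, formOf_notMem _ _ ht, formOf_notMem _ _ ht, add_zero]
  map_smul' c a := by
    refine Subtype.ext (funext fun e => funext fun t => ?_)
    change formOf (c • a.1) e t = c * formOf a.1 e t
    by_cases ht : t ∈ e.1.target
    · refine tendsto_nhds_unique (K.tendsto_formCoeff (c • a).2 e ht)
        (((K.tendsto_formCoeff a.2 e ht).const_mul c).congr fun s => ?_)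
      simp only [formCoeff, Submodule.coe_smul, eval_smul, smul_eq_mul]
      ring
    · rw [formOf_notMem _ _ ht, formOf_notMem _ _ ht, mul_zero]

omit ha e in
theorem formMap_apply (a : degreeLT ℂ g) : (K.formMap a).1 = formOf a.1 := rfl

omit ha e K in
theorem _root_.AztecDiamond.deriv_z_sheet {e : OpenPartialHomeomorph (Surface p₀) ℂ}
    (h : ∀ t ∈ e.target, e.symm t ≠ ∞ ∧ zCoord (e.symm t) = t ∧ wCoord (e.symm t) ≠ 0) {t : ℂ}
    (ht : t ∈ e.target) : deriv (fun s => zCoord (e.symm s)) t = 1 := by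
  have : (fun s => zCoord (e.symm s)) =ᶠ[𝓝 t] fun s => s := by
    filter_upwards [e.open_target.mem_nhds ht] with s hs using (h s hs).2.1
  rw [this.deriv_eq, deriv_id'']

omit ha e in
-- In a chart with coordinate z the coefficient is a(z)/w, so a zero form makes a vanish on an open
-- set.
theorem formMap_injective : Function.Injective K.formMap := by
  rw [← LinearMap.ker_eq_bot, LinearMap.ker_eq_bot']
  intro a ha
  have ha' : formOf a.1 = (0 : surfaceAtlas p₀ → ℂ → ℂ) := by
    rw [← K.formMap_apply, ha]
    rfl
  obtain ⟨z, hz⟩ : ∃ z : ℂ, aeval z p₀ ≠ 0 := by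
    by_contra! h
    have h1 := finite_rootSet (p₀ := p₀) K.ne_zero
    rw [show {z : ℂ | aeval z p₀ = 0} = univ from eq_univ_of_forall h] at h1
    exact infinite_univ h1
  obtain ⟨w, hw⟩ := exists_affine_point p₀ z
  have hw0 : w ≠ 0 := by
    rintro rfl
    exact hz (by rw [← hw]; simp)
  obtain ⟨e, he, hae, -, hs⟩ := exists_sheet_chart (⟨(z, w), hw⟩ : AffineCurve p₀) hw0
  refine Subtype.ext (eq_zero_of_infinite_isRoot _ ?_)
  refine (infinite_of_mem_nhds _ (e.open_target.mem_nhds (e.map_source hae))).mono fun t ht => ?_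
  have h1 := K.formOf_eq a.2 ⟨e, he⟩ ht (hs t ht).2.2
  rw [ha', formCoeff, deriv_z_sheet hs ht, (hs t ht).2.1, mul_one] at h1
  exact (div_eq_zero_iff.1 h1.symm).resolve_right (hs t ht).2.2

end IsOddCurve
end AztecDiamond

namespace AztecDiamond

/-! ### All holomorphic forms -/

/-- A square root of `p₀(z)`. -/
noncomputable def curveRoot (p₀ : ℝ[X]) (z : ℂ) : ℂ := (exists_affine_point p₀ z).choose

theorem curveRoot_sq (p₀ : ℝ[X]) (z : ℂ) : curveRoot p₀ z ^ 2 = aeval z p₀ :=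
  (exists_affine_point p₀ z).choose_spec

theorem curveRoot_ne_zero {p₀ : ℝ[X]} {z : ℂ} (h : aeval z p₀ ≠ 0) : curveRoot p₀ z ≠ 0 := by
  intro h1
  rw [← curveRoot_sq, h1] at h
  exact h (by simp)

/-- The point `(z, √p₀(z))`. -/
noncomputable def upper (p₀ : ℝ[X]) (z : ℂ) : AffineCurve p₀ :=
  ⟨(z, curveRoot p₀ z), curveRoot_sq p₀ z⟩

/-- The point `(z, -√p₀(z))`. -/
noncomputable def lower (p₀ : ℝ[X]) (z : ℂ) : AffineCurve p₀ :=
  ⟨(z, -curveRoot p₀ z), (neg_sq _).trans (curveRoot_sq p₀ z)⟩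

theorem eq_upper_or_lower {p₀ : ℝ[X]} {P : Surface p₀} (hP : P ≠ ∞) :
    P = upper p₀ (zCoord P) ∨ P = lower p₀ (zCoord P) := by
  have h1 := coord_relation hP
  rw [← curveRoot_sq] at h1
  rcases sq_eq_sq_iff_eq_or_eq_neg.1 h1 with h | h
  · exact Or.inl (surface_ext hP (OnePoint.coe_ne_infty _) rfl h)
  · exact Or.inr (surface_ext hP (OnePoint.coe_ne_infty _) rfl h)

theorem exists_forall_mem_of_nhds_infty {p₀ : ℝ[X]} {U : Set (Surface p₀)} (hU : U ∈ 𝓝 ∞) :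
    ∃ M : ℝ, ∀ a : AffineCurve p₀, M < ‖a.1.1‖ → (a : Surface p₀) ∈ U := by
  obtain ⟨K, ⟨-, hK⟩, hKU⟩ := OnePoint.hasBasis_nhds_infty.mem_iff.1 hU
  obtain ⟨M, hM⟩ := hK.exists_bound_of_continuousOn (f := fun a : AffineCurve p₀ => a.1.1)
    (Continuous.continuousOn (by fun_prop))
  refine ⟨M, fun a ha => hKU (Or.inl ⟨a, fun haK => ?_, rfl⟩)⟩
  exact (hM a haK).not_gt ha

namespace IsOddCurve

variable {p₀ : ℝ[X]} {g : ℕ} (K : IsOddCurve p₀ g) {f : surfaceAtlas p₀ → ℂ → ℂ}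
  (hf : f ∈ holomorphicForms (surfaceAtlas p₀))

include hf in
/-- The quotient of a form by `dz / w`, away from the branch points. -/
theorem _root_.AztecDiamond.exists_quotient : ∃ H : Surface p₀ → ℂ, ∀ e : surfaceAtlas p₀,
    ∀ t ∈ e.1.target, wCoord (e.1.symm t) ≠ 0 →
      H (e.1.symm t) * deriv (fun s => zCoord (e.1.symm s)) t = f e t * wCoord (e.1.symm t) := by
  have hex : ∀ P : Surface p₀, ∃ h : ℂ, wCoord P ≠ 0 → ∀ e : surfaceAtlas p₀, P ∈ e.1.source →
      h * deriv (fun s => zCoord (e.1.symm s)) (e.1 P) = f e (e.1 P) * wCoord P := by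
    intro P
    by_cases hw : wCoord P = 0
    · exact ⟨0, fun h => absurd hw h⟩
    obtain ⟨a, rfl⟩ := OnePoint.ne_infty_iff_exists.1 (ne_infty_of_wCoord hw)
    obtain ⟨e', he', hae', -, hs⟩ := exists_sheet_chart a hw
    refine ⟨f ⟨e', he'⟩ (e' a) * wCoord (a : Surface p₀), fun _ e hae => ?_⟩
    have hi := e.1.left_inv hae
    have ht := e.1.map_source hae
    obtain ⟨d, hd, hd'⟩ := transition_hasDerivAt e.2 he' ht (by rwa [hi]) (by rwa [hi])
    have h1 := hf.2.2 e ⟨e', he'⟩ (e.1 a) ht (by rwa [hi])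
    rw [hi] at h1
    rw [hi, deriv_z_sheet hs (e'.map_source hae'), one_mul] at hd'
    rw [hd', h1, hd.deriv]
    ring
  choose H hH using hex
  refine ⟨H, fun e t ht hw => ?_⟩
  have := hH (e.1.symm t) hw e (e.1.map_target ht)
  rwa [e.1.right_inv ht] at this

/-! ### Even and odd parts of the quotient of a form by dz/w. -/

section Quotient

variable {H : Surface p₀ → ℂ} (hH : ∀ e : surfaceAtlas p₀, ∀ t ∈ e.1.target,
  wCoord (e.1.symm t) ≠ 0 →
    H (e.1.symm t) * deriv (fun s => zCoord (e.1.symm s)) t = f e t * wCoord (e.1.symm t))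
include hf hH

/-- Near an unramified point, both sheets carry holomorphic data. -/
theorem _root_.AztecDiamond.quotient_local {z₀ : ℂ} (h0 : aeval z₀ p₀ ≠ 0) : ∃ u v w : ℂ → ℂ,
    AnalyticAt ℂ u z₀ ∧ AnalyticAt ℂ v z₀ ∧ AnalyticAt ℂ w z₀ ∧ ∀ᶠ z in 𝓝 z₀,
      H (upper p₀ z) + H (lower p₀ z) = (u z - v z) * w z ∧
      (H (upper p₀ z) - H (lower p₀ z)) / curveRoot p₀ z = u z + v z := by
  have hr := curveRoot_ne_zero h0
  obtain ⟨e, he, hae, hez, hs⟩ := exists_sheet_chart (upper p₀ z₀) hr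
  obtain ⟨e', he', hae', hez', hs'⟩ := exists_sheet_chart (lower p₀ z₀) (neg_ne_zero.2 hr)
  have ht : z₀ ∈ e.target := by
    have := e.map_source hae
    rwa [hez _ hae] at this
  have ht' : z₀ ∈ e'.target := by
    have := e'.map_source hae'
    rwa [hez' _ hae'] at this
  have i1 : e.symm z₀ = upper p₀ z₀ := by
    have := e.left_inv hae
    rwa [hez _ hae] at this
  have i2 : e'.symm z₀ = lower p₀ z₀ := by
    have := e'.left_inv hae'
    rwa [hez' _ hae'] at this
  have aw := he.analyticAt_w z₀ ht (hs _ ht).1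
  have aw' := he'.analyticAt_w z₀ ht' (hs' _ ht').1
  refine ⟨f ⟨e, he⟩, f ⟨e', he'⟩, fun z => wCoord (e.symm z), hf.1 ⟨e, he⟩ _ ht,
    hf.1 ⟨e', he'⟩ _ ht', aw, ?_⟩
  have hne : ∀ᶠ z in 𝓝 z₀, wCoord (e.symm z) - wCoord (e'.symm z) ≠ 0 := by
    refine (aw.continuousAt.sub aw'.continuousAt).eventually_ne ?_
    simp only [Pi.sub_apply, i1, i2]
    change curveRoot p₀ z₀ - -curveRoot p₀ z₀ ≠ 0
    rw [sub_neg_eq_add, ← two_mul]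
    exact mul_ne_zero two_ne_zero hr
  filter_upwards [hne, e.open_target.mem_nhds ht, e'.open_target.mem_nhds ht'] with z hz hzt hzt'
  obtain ⟨a1, a2, a3⟩ := hs z hzt
  obtain ⟨b1, b2, b3⟩ := hs' z hzt'
  have hww : wCoord (e'.symm z) = -wCoord (e.symm z) := by
    have h1 := coord_relation a1
    have h2 := coord_relation b1
    rw [a2] at h1
    rw [b2, ← h1] at h2
    refine (sq_eq_sq_iff_eq_or_eq_neg.1 h2).resolve_left fun h => hz ?_
    rw [h, sub_self]
  have q1 := hH ⟨e, he⟩ z hzt a3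
  have q2 := hH ⟨e', he'⟩ z hzt' b3
  rw [deriv_z_sheet hs hzt, mul_one] at q1
  rw [deriv_z_sheet hs' hzt', mul_one, hww] at q2
  -- The root `curveRoot` is chosen pointwise and need not be continuous, so the charts may meet the
  -- upper and lower points in either order. Both combinations in the conclusion are unchanged by
  -- the swap.
  have key : (e.symm z = upper p₀ z ∧ e'.symm z = lower p₀ z) ∨
      (e.symm z = lower p₀ z ∧ e'.symm z = upper p₀ z) := by
    rcases eq_upper_or_lower a1 with h | h <;> rcases eq_upper_or_lower b1 with h' | h' <;>
      rw [a2] at h <;> rw [b2] at h'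
    · exact absurd (by rw [h, h', sub_self]) hz
    · exact Or.inl ⟨h, h'⟩
    · exact Or.inr ⟨h, h'⟩
    · exact absurd (by rw [h, h', sub_self]) hz
  rcases key with ⟨h, h'⟩ | ⟨h, h'⟩
  · have hw : wCoord (e.symm z) = curveRoot p₀ z := by
      rw [h]
      rfl
    rw [h] at q1
    rw [h'] at q2
    rw [q1, q2, h, ← h, hw]
    rw [hw] at a3
    refine ⟨by ring, ?_⟩
    field_simp
    ring
  · have hw : wCoord (e.symm z) = -curveRoot p₀ z := by
      rw [h]
      rfl
    rw [h] at q1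
    rw [h'] at q2
    rw [q1, q2, ← h, hw]
    rw [hw, neg_ne_zero] at a3
    refine ⟨by ring, ?_⟩
    field_simp
    ring

include K

/-- Bounds near a branch point. -/
theorem quotient_branch {z₀ : ℂ} (h0 : aeval z₀ p₀ = 0) : ∃ B : ℝ, ∀ᶠ z in 𝓝[≠] z₀,
    ‖H (upper p₀ z) + H (lower p₀ z)‖ ≤ B ∧
    ‖(H (upper p₀ z) - H (lower p₀ z)) / curveRoot p₀ z‖ ≤ B := by
  obtain ⟨e, he, hae, hew, hs, V, hV, hVe⟩ := exists_branch_chart h0 (K.derivative_ne_zero h0)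
  have ht0 : (0 : ℂ) ∈ e.target := by
    have := e.map_source hae
    rwa [hew _ hae] at this
  have hfa := hf.1 ⟨e, he⟩ 0 ht0
  have hwd : ∀ t ∈ e.target, deriv (fun s => wCoord (e.symm s)) t = 1 := by
    intro t ht
    have : (fun s => wCoord (e.symm s)) =ᶠ[𝓝 t] fun s => s := by
      filter_upwards [e.open_target.mem_nhds ht] with s hs' using (hs s hs').2
    rw [this.deriv_eq, deriv_id'']
  have hroot : Tendsto (curveRoot p₀) (𝓝 z₀) (𝓝 0) := by
    have h1 : Tendsto (fun z : ℂ => √‖aeval z p₀‖) (𝓝 z₀) (𝓝 √‖aeval z₀ p₀‖) :=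
      ((Real.continuous_sqrt.comp ((p₀.continuous_aeval (A := ℂ)).norm))).tendsto z₀
    rw [h0, norm_zero, Real.sqrt_zero] at h1
    refine tendsto_zero_iff_norm_tendsto_zero.2 (h1.congr fun z => ?_)
    rw [← curveRoot_sq, norm_pow, Real.sqrt_sq (norm_nonneg _)]
  have hroot' : Tendsto (fun z => -curveRoot p₀ z) (𝓝 z₀) (𝓝 0) := by
    simpa using hroot.neg
  -- Differentiability of the coefficient at 0 bounds f(w) - f(0) by L|w|, which controls the odd
  -- part after division by w.
  obtain ⟨L, hL⟩ := (hfa.differentiableAt.isBigO_sub).bound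
  -- In the coordinate w one has dz/dw = 2w/p₀', so H = f p₀'/2.
  have hval : ∀ a : AffineCurve p₀, a.1.1 ∈ V → a.1.2 ≠ 0 → H (a : Surface p₀) =
      f ⟨e, he⟩ a.1.2 * aeval a.1.1 (derivative p₀) / 2 := by
    intro a haV ha0
    have hs' := hVe a haV
    have ht := e.map_source hs'
    have hi := e.left_inv hs'
    have hw := hew _ hs'
    rw [wCoord_coe] at hw
    have h1 := hH ⟨e, he⟩ (e a) ht (by rw [hi]; exact ha0)
    have h2 := he.deriv_relation ht (by rw [hi]; exact OnePoint.coe_ne_infty _)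
    have h3 := he.deriv_z_ne_zero ht (by rw [hi]; exact OnePoint.coe_ne_infty _)
      (by rw [hi]; exact ha0)
    simp only at h1
    rw [hi, wCoord_coe] at h1
    rw [hi, hwd _ ht, wCoord_coe, zCoord_coe] at h2
    rw [hw] at h1 h2 h3
    refine mul_right_cancel₀ h3 ?_
    linear_combination h1 + f ⟨e, he⟩ a.1.2 / 2 * h2
  set f₀ := f ⟨e, he⟩ with hf₀
  set B₁ := ‖f₀ 0‖ + 1 with hB₁
  set D := ‖aeval z₀ (derivative p₀)‖ + 1 with hD
  have hbd : ∀ᶠ t in 𝓝 (0 : ℂ), ‖f₀ t‖ ≤ B₁ :=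
    (hfa.continuousAt.norm.eventually_lt continuousAt_const (by rw [hB₁]; linarith)).mono
      fun t ht => le_of_lt ht
  have hDe : ∀ᶠ z in 𝓝 z₀, ‖aeval z (derivative p₀)‖ ≤ D := by
    have : ContinuousAt (fun z : ℂ => ‖aeval z (derivative p₀)‖) z₀ :=
      ((derivative p₀).continuous_aeval (A := ℂ)).norm.continuousAt
    exact (this.eventually_lt continuousAt_const (by rw [hD]; linarith)).mono fun t ht => le_of_lt ht
  have hpe : ∀ᶠ z in 𝓝[≠] z₀, aeval z p₀ ≠ 0 := by
    have : ({z : ℂ | aeval z p₀ = 0} \ {z₀})ᶜ ∈ 𝓝 z₀ :=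
      ((finite_rootSet K.ne_zero).subset sdiff_subset).isClosed.isOpen_compl.mem_nhds (by simp)
    filter_upwards [nhdsWithin_le_nhds this, self_mem_nhdsWithin] with s h1 h2 h3
    exact h1 ⟨h3, h2⟩
  refine ⟨max (B₁ * D) (L * D), ?_⟩
  filter_upwards [hpe, nhdsWithin_le_nhds hV, nhdsWithin_le_nhds hDe,
    nhdsWithin_le_nhds (hroot.eventually hbd), nhdsWithin_le_nhds (hroot'.eventually hbd),
    nhdsWithin_le_nhds (hroot.eventually hL), nhdsWithin_le_nhds (hroot'.eventually hL)]
    with z h1 h2 h3 h4 h5 h6 h7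
  have hr := curveRoot_ne_zero h1
  have e1 : H (upper p₀ z) = f₀ (curveRoot p₀ z) * aeval z (derivative p₀) / 2 :=
    hval (upper p₀ z) h2 hr
  have e2 : H (lower p₀ z) = f₀ (-curveRoot p₀ z) * aeval z (derivative p₀) / 2 :=
    hval (lower p₀ z) h2 (neg_ne_zero.2 hr)
  rw [e1, e2]
  have hn := norm_pos_iff.2 hr
  simp only [sub_zero, norm_neg] at h6 h7
  constructor
  · refine le_trans ?_ (le_max_left _ _)
    have : f₀ (curveRoot p₀ z) * aeval z (derivative p₀) / 2 +
        f₀ (-curveRoot p₀ z) * aeval z (derivative p₀) / 2 =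
        (f₀ (curveRoot p₀ z) + f₀ (-curveRoot p₀ z)) / 2 * aeval z (derivative p₀) := by ring
    rw [this, norm_mul, norm_div, Complex.norm_ofNat]
    refine mul_le_mul ?_ h3 (norm_nonneg _) (by positivity)
    linarith [norm_add_le (f₀ (curveRoot p₀ z)) (f₀ (-curveRoot p₀ z))]
  · refine le_trans ?_ (le_max_right _ _)
    have : (f₀ (curveRoot p₀ z) * aeval z (derivative p₀) / 2 -
        f₀ (-curveRoot p₀ z) * aeval z (derivative p₀) / 2) / curveRoot p₀ z =
        ((f₀ (curveRoot p₀ z) - f₀ 0) - (f₀ (-curveRoot p₀ z) - f₀ 0)) / (2 * curveRoot p₀ z) *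
          aeval z (derivative p₀) := by
      field_simp
      ring
    have hLn : 0 ≤ L := by
      by_contra! hneg
      have := (norm_nonneg _).trans h6
      nlinarith
    rw [this, norm_mul, norm_div, norm_mul, Complex.norm_ofNat]
    refine mul_le_mul ?_ h3 (norm_nonneg _) hLn
    rw [div_le_iff₀ (by positivity)]
    linarith [norm_sub_le (f₀ (curveRoot p₀ z) - f₀ 0) (f₀ (-curveRoot p₀ z) - f₀ 0)]

omit hf in
/-- Growth at infinity. -/
theorem quotient_growth (hf : f ∈ holomorphicForms (surfaceAtlas p₀)) : ∃ C M : ℝ, 0 ≤ C ∧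
    ∀ a : AffineCurve p₀, M < ‖a.1.1‖ → a.1.2 ≠ 0 → ‖H (a : Surface p₀)‖ * ‖a.1.1‖ ≤ C * ‖a.1.1‖ ^ g := by
  obtain ⟨e, he, hs, hd⟩ := K.exists_chart_infty
  obtain ⟨c, B, M, hc, hB0, hM, hB⟩ := norm_aeval_bounds K.ne_zero
  have hfa := (hf.1 ⟨e, he⟩ _ (e.map_source hs)).continuousAt
  set f₀ := f ⟨e, he⟩ with hf₀
  set B₁ := ‖f₀ (e ∞)‖ + 1 with hB₁
  have hbd : ∀ᶠ t in 𝓝 (e ∞), ‖f₀ t‖ ≤ B₁ :=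
    (hfa.norm.eventually_lt continuousAt_const (by rw [hB₁]; linarith)).mono fun t ht => le_of_lt ht
  obtain ⟨M', hM'⟩ := exists_forall_mem_of_nhds_infty
    ((e.open_source.eventually_mem hs).and ((e.continuousAt hs).eventually hbd))
  -- The constant comes from 4|H|²|z|³ = |f|²|w|² ≤ B₁² B |z|^{2g+1}.
  refine ⟨√(B₁ ^ 2 * B / 4), max M M', Real.sqrt_nonneg _, fun a ha ha0 => ?_⟩
  obtain ⟨h1, h2⟩ := hM' a ((le_max_right _ _).trans_lt ha)
  have hMa := (le_max_left _ _).trans_lt ha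
  have ht := e.map_source h1
  have hi := e.left_inv h1
  have h3 := hd _ ht (by rw [hi]; exact OnePoint.coe_ne_infty _)
  have h4 := hH ⟨e, he⟩ (e a) ht (by rw [hi]; exact ha0)
  simp only at h4
  rw [hi] at h3 h4
  rw [wCoord_coe] at h4
  rw [zCoord_coe] at h3
  have h5 := (hB _ hMa).2
  rw [← a.2, norm_pow, K.deg] at h5
  have h6 := congrArg (fun x => ‖x‖ ^ 2) h4
  simp only [norm_mul, mul_pow] at h6
  rw [h3] at h6
  have hx : 0 < ‖a.1.1‖ := one_pos.trans_le (hM.trans hMa.le)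
  have h7 : ‖f ⟨e, he⟩ (e a)‖ ^ 2 ≤ B₁ ^ 2 := pow_le_pow_left₀ (norm_nonneg _) h2 2
  have e1 : √(B₁ ^ 2 * B / 4) * ‖a.1.1‖ ^ g = √(B₁ ^ 2 * B / 4 * (‖a.1.1‖ ^ g) ^ 2) := by
    rw [Real.sqrt_mul (by positivity), Real.sqrt_sq (by positivity)]
  rw [e1]
  refine Real.le_sqrt_of_sq_le ?_
  generalize ‖a.1.1‖ = x at *
  have h8 : ‖H (a : Surface p₀)‖ ^ 2 * (4 * x ^ 3) ≤ B₁ ^ 2 * (B * x ^ (2 * g + 1)) := by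
    rw [h6]
    exact mul_le_mul h7 h5 (by positivity) (by positivity)
  refine le_of_mul_le_mul_right (?_ : _ * (4 * x) ≤ _ * (4 * x)) (by positivity)
  calc (‖H (a : Surface p₀)‖ * x) ^ 2 * (4 * x) = ‖H (a : Surface p₀)‖ ^ 2 * (4 * x ^ 3) := by ring
    _ ≤ _ := h8
    _ = _ := by ring

/-- The sum of H over the two sheets and the difference divided by w are single-valued functions of
z, bounded near branch points. The sum grows like |z|^{g-1} at most, so it is a polynomial of degree
less than g. Since |w| is at least a constant times |z|^g, the other one is O(1/|z|) and vanishes.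
Hence H is half the sum. -/
theorem exists_quotient_eq_eval : ∃ a ∈ degreeLT ℂ g, ∀ P : Surface p₀, wCoord P ≠ 0 →
    H P = a.eval (zCoord P) := by
  have hR := finite_rootSet (p₀ := p₀) K.ne_zero
  obtain ⟨C, M, hC, hM⟩ := K.quotient_growth hH hf
  obtain ⟨c, B, M', hc, -, hM1, hB⟩ := norm_aeval_bounds K.ne_zero
  obtain ⟨a, ha, hav⟩ := exists_polynomial_of_growth_off_finite
    (f := fun z => H (upper p₀ z) + H (lower p₀ z)) hR
    (fun z hz => by
      obtain ⟨u, v, w, hu, hv, hw, h⟩ := quotient_local hf hH hz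
      exact ((hu.sub hv).mul hw).congr (h.mono fun z hz => hz.1.symm))
    (fun z hz => by
      obtain ⟨B, hB⟩ := K.quotient_branch hf hH hz
      exact ⟨B, hB.mono fun z hz => hz.1⟩)
    (g := g) (C := 2 * C) (M := M) (fun z hz hzM => by
      have hr := curveRoot_ne_zero hz
      have h1 : ‖H (upper p₀ z)‖ * ‖z‖ ≤ C * ‖z‖ ^ g := hM (upper p₀ z) hzM hr
      have h2 : ‖H (lower p₀ z)‖ * ‖z‖ ≤ C * ‖z‖ ^ g := hM (lower p₀ z) hzM (neg_ne_zero.2 hr)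
      have h3 := mul_le_mul_of_nonneg_right (norm_add_le (H (upper p₀ z)) (H (lower p₀ z)))
        (norm_nonneg z)
      linarith)
  obtain ⟨b, hb, hbv⟩ := exists_polynomial_of_growth_off_finite
    (f := fun z => (H (upper p₀ z) - H (lower p₀ z)) / curveRoot p₀ z) hR
    (fun z hz => by
      obtain ⟨u, v, w, hu, hv, hw, h⟩ := quotient_local hf hH hz
      exact (hu.add hv).congr (h.mono fun z hz => hz.2.symm))
    (fun z hz => by
      obtain ⟨B, hB⟩ := K.quotient_branch hf hH hz
      exact ⟨B, hB.mono fun z hz => hz.2⟩)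
    (g := 0) (C := 2 * C / √c) (M := max M M') (fun z hz hzM => by
      have hr := curveRoot_ne_zero hz
      have hzM1 := (le_max_left _ _).trans_lt hzM
      have hzM2 := (le_max_right _ _).trans_lt hzM
      have h1 : ‖H (upper p₀ z)‖ * ‖z‖ ≤ C * ‖z‖ ^ g := hM (upper p₀ z) hzM1 hr
      have h2 : ‖H (lower p₀ z)‖ * ‖z‖ ≤ C * ‖z‖ ^ g := hM (lower p₀ z) hzM1 (neg_ne_zero.2 hr)
      have h3 := mul_le_mul_of_nonneg_right (norm_sub_le (H (upper p₀ z)) (H (lower p₀ z)))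
        (norm_nonneg z)
      have hx : 1 ≤ ‖z‖ := hM1.trans hzM2.le
      have h4 := (hB z hzM2).1
      rw [K.deg, ← curveRoot_sq, norm_pow] at h4
      have h5 : √c * ‖z‖ ^ g ≤ ‖curveRoot p₀ z‖ := by
        refine (sq_le_sq₀ (by positivity) (norm_nonneg _)).1 ?_
        rw [mul_pow, Real.sq_sqrt hc.le]
        refine le_trans (mul_le_mul_of_nonneg_left ?_ hc.le) h4
        rw [← pow_mul, mul_comm g 2]
        exact pow_le_pow_right₀ hx (by omega)
      have hn := norm_pos_iff.2 hr
      have hsc := Real.sqrt_pos.2 hc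
      rw [pow_zero, mul_one, norm_div, div_mul_eq_mul_div, div_le_div_iff₀ hn hsc]
      calc ‖H (upper p₀ z) - H (lower p₀ z)‖ * ‖z‖ * √c ≤ (2 * C * ‖z‖ ^ g) * √c :=
            mul_le_mul_of_nonneg_right (by linarith) hsc.le
        _ = 2 * C * (√c * ‖z‖ ^ g) := by ring
        _ ≤ 2 * C * ‖curveRoot p₀ z‖ := mul_le_mul_of_nonneg_left h5 (by positivity))
  have hb0 : b = 0 := by
    rw [mem_degreeLT] at hb
    exact degree_eq_bot.1 (Nat.WithBot.lt_zero_iff.1 (by exact_mod_cast hb))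
  refine ⟨(2⁻¹ : ℂ) • a, Submodule.smul_mem _ _ ha, fun P hP => ?_⟩
  have hPi := ne_infty_of_wCoord hP
  have hz : aeval (zCoord P) p₀ ≠ 0 := by
    rw [← coord_relation hPi]
    exact pow_ne_zero 2 hP
  have h1 : H (upper p₀ (zCoord P)) + H (lower p₀ (zCoord P)) = a.eval (zCoord P) := hav _ hz
  have h2 : (H (upper p₀ (zCoord P)) - H (lower p₀ (zCoord P))) / curveRoot p₀ (zCoord P) =
      b.eval (zCoord P) := hbv _ hz
  rw [hb0, eval_zero, div_eq_zero_iff, or_iff_left (curveRoot_ne_zero hz), sub_eq_zero] at h2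
  rw [eval_smul, smul_eq_mul, ← h1, ← h2]
  rcases eq_upper_or_lower hPi with h | h
  · rw [← h]
    ring
  · rw [h2, ← h]
    ring

end Quotient

include K

/-- The forms agree where w ≠ 0, hence everywhere by continuity of their coefficients. -/
theorem formMap_surjective : Function.Surjective K.formMap := by
  rintro ⟨f, hf⟩
  obtain ⟨H, hH⟩ := exists_quotient hf
  obtain ⟨a, ha, hHa⟩ := K.exists_quotient_eq_eval hf hH
  refine ⟨⟨a, ha⟩, Subtype.ext (funext fun e => funext fun t => ?_)⟩
  change formOf a e t = f e t
  by_cases ht : t ∈ e.1.target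
  · refine tendsto_nhds_unique (K.tendsto_formCoeff ha e ht)
      (((hf.1 e t ht).continuousAt.tendsto.mono_left nhdsWithin_le_nhds).congr' ?_)
    filter_upwards [eventually_wCoord_ne K.ne_zero e.1 ht] with s hs
    rw [formCoeff, ← hHa _ hs.2, hH e s hs.1 hs.2, mul_div_cancel_right₀ _ hs.2]
  · rw [formOf_notMem a e ht, hf.2.1 e t ht]

/-- The genus of the curve `w² = p₀(z)` with `deg p₀ = 2 g + 1`. -/
theorem genus_eq : genus p₀ = g := by
  have h := (LinearEquiv.ofBijective K.formMap ⟨K.formMap_injective, K.formMap_surjective⟩).rank_eq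
  rw [genus, ← h, (degreeLTEquiv ℂ g).rank_eq, rank_fin_fun]

end IsOddCurve

theorem SpectralData.isOddCurve {k : ℕ} {α β : Fin k → ℝ} {p₀ q : ℝ[X]} (S : SpectralData α β p₀ q) :
    IsOddCurve p₀ (kPrime p₀ - 1) where
  lead := S.leadingCoeff_pos
  deg := by
    have := S.natDegree_succ
    omega
  sep := S.separable

end AztecDiamond
theorem mainTheorem4 (k : ℕ) (hk : 0 < k) (α β : Fin k → ℝ)
    (hα : ∀ m, 0 < α m) (hβ : ∀ m, 0 < β m) (hαβ : ∏ m, α m = ∏ m, β m)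
    (p₀ q : Polynomial ℝ) (hq : q.Monic) (hp₀ : Squarefree p₀)
    (hp : AztecDiamond.discrPoly α β = q ^ 2 * p₀) :
    p₀.natDegree + 1 = 2 * AztecDiamond.kPrime p₀ ∧
    ENat.card (ConnectedComponents (AztecDiamond.smoothRegion α β p₀ q)) =
      ((AztecDiamond.kPrime p₀ - 1 : ℕ) : ℕ∞) ∧
    AztecDiamond.genus p₀ = ((AztecDiamond.kPrime p₀ - 1 : ℕ) : Cardinal) := by
  have S : AztecDiamond.SpectralData α β p₀ q := ⟨hk, hα, hβ, hαβ, hq, hp₀, hp⟩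
  exact ⟨S.natDegree_succ, S.enatCard_components, S.isOddCurve.genus_eq⟩
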